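/- **Model.** A provider allocates finitely many resource types $k\in\mathcal K$, each with capacity $C$ (normalized to $1$) and supply cost $f(y)=ay^s$, $y\in[0,1]$, where $a>0$, $s>1$; thus $f'(y)=asy^{s-1}$ and $\overline c:=f'(1)=as$. There is a finite set of bundles; a nonempty bundle $b$ uses $d_k^b\ge 0$ units of resource $k$ (not all zero), that is, the proportion $r_k^b=d_k^b/C$ of the capacity, and at least one bundle consists of a single resource type. Customers $1,\dots,N$ arrive one at a time; customer $n$ has valuations $v_n^b\in\mathbb R$, $v_n^\emptyset=0$, with $v_n^b/r_k^b\le\overline p$ whenever $r_k^b\ne 0$, where $\overline p>0$. The welfare of an allocation is the total valuation of the allocated bundles minus $\sum_k f(y_k)$, where $y_k\le 1$ is the final utilization of resource $k$; $W_{\mathsf{opt}}$ is its offline maximum. A pricing function is a strictly increasing $\phi:[0,1]\to[0,\infty)$. In $\mathrm{PPM}_\phi$ each arriving customer is offered resource $k$ at the unit price $\phi(y_k)$, where $y_k$ is the current utilization, picks a utility-maximizing (possibly empty) bundle (arbitrary tie-breaking), and receives it unless her utility is negative or a capacity limit would be exceeded, in which case she receives nothing. Bundles are small compared to the capacity: an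 online mechanism is $\alpha$-competitive ($\alpha\ge1$) if for every $\delta>0$ there is $C_0>0$ such that for all $C\ge C_0$ and all arrival instances its outcomes are feasible and satisfy $W_{\mathsf{online}}\ge \frac1\alpha W_{\mathsf{opt}}-\delta$. "$\mathrm{PPM}_\phi$ achieves the optimal competitive ratio $\alpha$" means that $\mathrm{PPM}_\phi$ is $\alpha$-competitive and that no (deterministic) online algorithm is $\beta$-competitive with $1\le\beta<\alpha$. A function given on an initial segment $[0,m]$ of $[0,1]$ only is said to achieve the optimal ratio if it extends to a pricing function on $[0,1]$ and every such extension achieves it. **Notation.** $\alpha_s^{\min}=s^{\frac{s}{s-1}}$, $u_s=(1/s)^{\frac1{s-1}}$, $\alpha_s(u)=\frac{s-1}{u-u^s}$; $\underline\alpha_1(u)=\alpha_s(u)$ for $u\in(0,u_s)$ and $\underline\alpha_1(u)=\alpha_s^{\min}$ for $u\in[u_s,1)$; $P(\eta)=\eta^s-\frac{\alpha_s^{\min}}{s-1}\eta^{s-1}+\frac{\alpha_s^{\min}}{s-1}$ (it has the double root $1/u_s$ and no other positive root); $f'^{-1}(p)=(p/\overline c)^{\frac1{s-1}}$; $$C_s=\overline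 c\Big(\frac1{e^s}-\frac1{s^s}\int_s^{\alpha_s^{\min}}\eta^{s-1}e^{-\eta}d\eta\Big)e^{\alpha_s^{\min}};$$ $$\phi_{\mathsf{ivp}}(y;u)=\overline c\,\frac{e^{y\underline\alpha_1(u)}}{\underline\alpha_1(u)^{s-1}}\int_{y\underline\alpha_1(u)}^{u\underline\alpha_1(u)}\eta^{s-1}e^{-\eta}d\eta+\overline c\,e^{(y-u)\underline\alpha_1(u)},\quad y\in[u,1].$$ If $\overline p>\overline c$, a critical dividing threshold (CDT) is a $u\in(0,1)$ such that $\alpha=\underline\alpha_1(u)$ satisfies $$\int_{u\alpha}^{\alpha}\eta^{s-1}e^{-\eta}d\eta=\frac{\alpha^{s-1}}{e^{u\alpha}}-\frac{\overline p\,\alpha^{s-1}}{\overline c\,e^{\alpha}}.$$ **Theorem.** * LUC, $0<\overline p\le\overline c$. Let $w=f'^{-1}(\overline p/s)$ and $v=f'^{-1}(\overline p)$. Then $0<w<v\le1$, and for every $m\in[w,v]$ the following function $\phi_m$ on $[0,m]$ has $\phi_m(m)=\overline p$ and achieves the optimal competitive ratio $s^{\frac s{s-1}}$. For $m\in(w,v]$: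 $\phi_m(0)=0$ and $\phi_m(y)=\overline c\,\varphi(y)^{s-1}$ for $y\in(0,m]$, where $\varphi(y)$ is the unique root $\varphi\in(0,1]$ of $$\int_{v/m}^{\varphi/y}\frac{\eta^{s-1}}{P(\eta)}\,d\eta=\ln\frac my$$ (the integral being required to exist). For $m=w$: $\phi_w(y)=sf'(y)$ on $[0,w]$. * $\mathrm{HUC}_1$, $\overline c<\overline p\le C_s$. There is a unique CDT $u_{\mathsf{cdt}}$, it lies in $[u_s,1)$, and the equation $$\int_s^{\alpha_s^{\min}\rho}\eta^{s-1}e^{-\eta}d\eta=\frac{s^s}{e^s}-\frac{\overline p\,s^s}{\overline c\,e^{\alpha_s^{\min}\rho}}$$ has a unique root $\rho_s\in[u_s,1]$. For every $u\in[u_s,u_{\mathsf{cdt}}]$ there is a largest $\rho\in[u,1]$ with $\phi_{\mathsf{ivp}}(\rho;u)=\overline p$; it lies in $[\rho_s,1]$, equals $\rho_s$ if $u=u_s$, and equals $1$ if $u=u_{\mathsf{cdt}}$; and the following function $\phi_u$ on $[0,\rho]$ achieves the optimal competitive ratio $s^{\frac s{s-1}}$. For $u>u_s$: $\phi_u(0)=0$;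 $\phi_u(y)=\overline c\,\varphi(y)^{s-1}$ for $y\in(0,u)$, where $\varphi(y)$ is the unique root $\varphi\in(0,1)$ of $\int_{1/u}^{\varphi/y}\frac{\eta^{s-1}}{P(\eta)}d\eta=\ln\frac uy$; and $\phi_u(y)=\phi_{\mathsf{ivp}}(y;u)$ for $y\in[u,\rho]$. For $u=u_s$: $\phi_{u_s}=sf'$ on $[0,u_s)$ and $\phi_{u_s}(y)=\phi_{\mathsf{ivp}}(y;u_s)$ on $[u_s,\rho_s]$. * $\mathrm{HUC}_2$, $\overline p>C_s$. There is a unique CDT $u_{\mathsf{cdt}}$, and it lies in $(0,u_s)$. A pricing function $\phi$ achieves the optimal competitive ratio $\frac{s-1}{u_{\mathsf{cdt}}-u_{\mathsf{cdt}}^s}$ if and only if $\phi(y)=f'(y/u_{\mathsf{cdt}})$ for $y\in[0,u_{\mathsf{cdt}}]$ and $\phi(y)=\phi_{\mathsf{ivp}}(y;u_{\mathsf{cdt}})$ for $y\in[u_{\mathsf{cdt}},1)$; and such a pricing function exists. -/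

import Mathlib

open Set MeasureTheory

noncomputable section

namespace OnlinePricing

/-! ### The allocation model -/

/-- A setup: a supply cost function (the same for every resource type), an upper bound on the
per-unit valuations, and a family `B` of nonempty bundles, bundle `b` consisting of `demand b k`
units of resource type `k`. The empty bundle is the element `none` of `Option B`. -/
structure Setup (K B : Type*) where
  cost : ℝ → ℝ
  pbar : ℝ
  demand : B → K → ℝ
  demand_nonneg : ∀ b k, 0 ≤ demand b k
  demand_pos : ∀ b, ∃ k, 0 < demand b k

namespace Setup

variable {K B : Type*}

/-- `r_k^b`: the units of resource `k` in a bundle, as a proportion of the capacity limit `C`;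
after this normalization the capacity limit is `1`. The empty bundle uses nothing. -/
def share (S : Setup K B) (C : ℝ) (k : K) : Option B → ℝ
  | none => 0
  | some b => S.demand b k / C

/-- The valuation of a possibly empty bundle; the empty bundle is worth `0`. -/
def value (v : B → ℝ) : Option B → ℝ
  | none => 0
  | some b => v b

/-- Utilization of resource `k` after customers `0, …, n - 1` received the bundles `x i`. -/
def usage (S : Setup K B) (C : ℝ) (x : ℕ → Option B) (n : ℕ) (k : K) : ℝ :=
  ∑ i ∈ Finset.range n, S.share C k (x i)

/-- Arrival instances consist of `N` customers with valuations `v 0, …, v (N - 1)`; the per-unit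
valuations are bounded above by `pbar`. -/
def Admissible (S : Setup K B) (C : ℝ) (N : ℕ) (v : ℕ → B → ℝ) : Prop :=
  ∀ n < N, ∀ b k, S.demand b k ≠ 0 → v n b / S.share C k (some b) ≤ S.pbar

/-- The allocation `x` respects all capacity limits. -/
def Feasible (S : Setup K B) (C : ℝ) (N : ℕ) (x : ℕ → Option B) : Prop :=
  ∀ k, S.usage C x N k ≤ 1

variable [Fintype K]

/-- Social welfare: total valuation less total supply cost. -/
def welfare (S : Setup K B) (C : ℝ) (N : ℕ) (v : ℕ → B → ℝ) (x : ℕ → Option B) : ℝ :=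
  ∑ n ∈ Finset.range N, value (v n) (x n) - ∑ k, S.cost (S.usage C x N k)

/-- The offline optimum (a maximum over finitely many welfare values when `B` is finite). -/
def optWelfare (S : Setup K B) (C : ℝ) (N : ℕ) (v : ℕ → B → ℝ) : ℝ :=
  sSup (S.welfare C N v '' {x | S.Feasible C N x})

/-- Quasilinear utility of the possibly empty bundle `o` for a customer with valuation `v`, when
resource `k` is offered at the price `φ (y k)`. -/
def utility (S : Setup K B) (C : ℝ) (φ : ℝ → ℝ) (y : K → ℝ) (v : B → ℝ) (o : Option B) : ℝ :=
  value v o - ∑ k, φ (y k) * S.share C k o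

/-- `x` is an outcome of the posted price mechanism with pricing function `φ`: each customer picks
a utility-maximizing bundle (ties are broken arbitrarily), and gets it unless her utility is
negative or some capacity limit would be exceeded, in which case she leaves with nothing. -/
def PPM (S : Setup K B) (φ : ℝ → ℝ) (C : ℝ) (N : ℕ) (v : ℕ → B → ℝ) (x : ℕ → Option B) : Prop :=
  ∀ n < N, ∃ b : Option B,
    (∀ o, S.utility C φ (S.usage C x n) (v n) o ≤ S.utility C φ (S.usage C x n) (v n) b) ∧
    ((0 ≤ S.utility C φ (S.usage C x n) (v n) b ∧
        (∀ k, S.usage C x n k + S.share C k b ≤ 1) ∧ x n = b) ∨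
      ((S.utility C φ (S.usage C x n) (v n) b < 0 ∨
        ∃ k, 1 < S.usage C x n k + S.share C k b) ∧ x n = none))

/-- `x` is the outcome of the deterministic online algorithm `A`, whose irrevocable decision on
customer `n` may depend on the capacity and on the valuations of customers `0, …, n` only. -/
def AlgOutcome (A : ℝ → (n : ℕ) → (Fin (n + 1) → B → ℝ) → Option B)
    (C : ℝ) (N : ℕ) (v : ℕ → B → ℝ) (x : ℕ → Option B) : Prop :=
  ∀ n < N, x n = A C n (fun i => v i)

/-- A mechanism with set of outcomes `M` is `α`-competitive when bundles are small compared to the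
capacity limit: its outcomes are feasible, and the inequality `W_online ≥ W_opt / α` holds
uniformly over all arrival instances, up to an error that vanishes as the proportions
`demand b k / C` of the capacity limit tend to zero. -/
def Competitive (S : Setup K B) (M : ℝ → ℕ → (ℕ → B → ℝ) → (ℕ → Option B) → Prop)
    (α : ℝ) : Prop :=
  1 ≤ α ∧ ∀ δ > 0, ∃ C₀ > 0, ∀ C ≥ C₀, ∀ N v x, S.Admissible C N v → M C N v x →
    S.Feasible C N x ∧ S.optWelfare C N v / α - δ ≤ S.welfare C N v x

/-- `PPM φ` is `α`-competitive, and no online algorithm has a smaller competitive ratio. -/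
def AchievesOptimalRatio (S : Setup K B) (φ : ℝ → ℝ) (α : ℝ) : Prop :=
  S.Competitive (S.PPM φ) α ∧
    ∀ β, 1 ≤ β → β < α → ¬ ∃ A, S.Competitive (AlgOutcome A) β

end Setup

/-- Pricing functions are nonnegative and strictly increasing in the utilization. -/
def IsPricingFunction (φ : ℝ → ℝ) : Prop :=
  StrictMonoOn φ (Icc 0 1) ∧ ∀ y ∈ Icc (0 : ℝ) 1, 0 ≤ φ y

/-! ### Quantities attached to the power cost `f y = a * y ^ s` -/

/-- The marginal cost `f'`. -/
def marginalCost (a s y : ℝ) : ℝ := a * s * y ^ (s - 1)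

/-- The inverse `f'⁻¹` of the marginal cost on `[0, ∞)`. -/
def invMarginalCost (a s p : ℝ) : ℝ := (p / (a * s)) ^ (1 / (s - 1))

/-- `α_s^min`. -/
def alphaMin (s : ℝ) : ℝ := s ^ (s / (s - 1))

/-- `u_s`. -/
def uS (s : ℝ) : ℝ := (1 / s) ^ (1 / (s - 1))

/-- `α_s(u)`. -/
def alphaS (s u : ℝ) : ℝ := (s - 1) / (u - u ^ s)

open Classical in
/-- The lower bound `α₁(u)`. -/
def alphaOne (s u : ℝ) : ℝ := if u < uS s then alphaS s u else alphaMin s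

/-- The integral of `η ^ (s - 1) * exp (-η)` from `x` to `z`. -/
def gammaInt (s x z : ℝ) : ℝ := ∫ η in x..z, η ^ (s - 1) * Real.exp (-η)

/-- The equation whose positive root `α` is the lower bound `α₂(u)`. -/
def AlphaTwoEq (a s pbar u α : ℝ) : Prop :=
  gammaInt s (u * α) α =
    α ^ (s - 1) / Real.exp (u * α) - pbar * α ^ (s - 1) / (a * s * Real.exp α)

/-- `u` is a critical dividing threshold: `α₁(u)` and `α₂(u)` coincide. -/
def IsCDT (a s pbar u : ℝ) : Prop :=
  u ∈ Ioo 0 1 ∧ AlphaTwoEq a s pbar u (alphaOne s u)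

/-- The price level `C_s` that separates the two high-uncertainty cases. -/
def cS (a s : ℝ) : ℝ :=
  a * s * (1 / Real.exp s - 1 / s ^ s * gammaInt s s (alphaMin s)) * Real.exp (alphaMin s)

/-- The solution on `[u, 1]` of `φ' = α₁(u) * (φ - f')`, `φ u = f' 1`. -/
def phiIvp (a s y u : ℝ) : ℝ :=
  a * s * (Real.exp (y * alphaOne s u) / alphaOne s u ^ (s - 1)) *
      gammaInt s (y * alphaOne s u) (alphaOne s u * u) +
    a * s * Real.exp ((y - u) * alphaOne s u)

/-- The characteristic polynomial `P_s(η; α)`. -/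
def charPoly (s α η : ℝ) : ℝ := η ^ s - α / (s - 1) * η ^ (s - 1) + α / (s - 1)

/-- `ϕ` is a root of `∫_{χ₀}^{ϕ/y} η^(s-1) / P_s(η; α_s^min) dη = ln (m / y)`, the integral being
required to exist. -/
def IsCharRoot (s χ₀ m y ϕ : ℝ) : Prop :=
  IntervalIntegrable (fun η => η ^ (s - 1) / charPoly s (alphaMin s) η) volume χ₀ (ϕ / y) ∧
    ∫ η in χ₀..(ϕ / y), η ^ (s - 1) / charPoly s (alphaMin s) η = Real.log (m / y)

/-- `φ` coincides on `[0, m]` with the function `φ_m` of the low-uncertainty case. With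
`v = f'⁻¹(pbar)` and `w = f'⁻¹(pbar / s)`, this is given by the integral equation if `m > w`; if
`m = w`, its lower limit `v / w` is the double root of the characteristic polynomial, and `φ_w` is
`s * f'`. -/
def IsPhiLUC (a s pbar m : ℝ) (φ : ℝ → ℝ) : Prop :=
  (m = invMarginalCost a s (pbar / s) →
    ∀ y ∈ Icc 0 m, φ y = s * marginalCost a s y) ∧
  (m ≠ invMarginalCost a s (pbar / s) → φ 0 = 0 ∧
    ∀ y ∈ Ioc 0 m, ∃ ϕ ∈ Ioc (0 : ℝ) 1,
      IsCharRoot s (invMarginalCost a s pbar / m) m y ϕ ∧ φ y = a * s * ϕ ^ (s - 1))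

/-- `φ` coincides on `[0, ρ]` with the function `φ_u` of the first high-uncertainty case. If
`u = u_s`, the lower limit `1 / u` of the integral equation is the double root of the
characteristic polynomial, and the first segment is `s * f'`. -/
def IsPhiHUC (a s u ρ : ℝ) (φ : ℝ → ℝ) : Prop :=
  (u = uS s → ∀ y ∈ Ico 0 u, φ y = s * marginalCost a s y) ∧
  (u ≠ uS s → φ 0 = 0 ∧
    ∀ y ∈ Ioo 0 u, ∃ ϕ ∈ Ioo (0 : ℝ) 1, IsCharRoot s (1 / u) u y ϕ ∧ φ y = a * s * ϕ ^ (s - 1)) ∧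
  ∀ y ∈ Icc u ρ, φ y = phiIvp a s y u

/-- The equation that determines `ρ_s`. -/
def RhoSEq (a s pbar ρ : ℝ) : Prop :=
  gammaInt s s (alphaMin s * ρ) =
    s ^ s / Real.exp s - pbar * s ^ s / (a * s * Real.exp (alphaMin s * ρ))

end OnlinePricing

end

/-! Write f(y) = a y^s, and let f* be its conjugate over quantities in [0, 1].

Upper bound. Take the final posted prices as dual prices. Prices only rise, so weak duality bounds
the offline optimum by the customers' realized utilities plus the sum of f*(φ(y_k)). The mechanism
earns the same utilities plus revenue minus cost, which for small bundles is about F(y_k) - f(y_k)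
with F a primitive of φ. So f*(φ) ≤ α (F - f) suffices (`competitive_of_potential`). Equality here
is a differential equation. Below the price f'(1), with φ = f'(ϕ), it reads (s-1) ϕ' ϕ^(s-1) = α
(ϕ^(s-1) - y^(s-1)) (`IsLowSegment`). It is homogeneous: its solutions include the lines y/μ with α
(μ - μ^s) = s - 1, and for α = `alphaMin s` the substitution ϕ = yχ separates variables and gives
the characteristic integral. Above f'(1) it reads φ' = α (φ - f'), solved by `phiIvp`. The value
`phiIvp a s 1 u` strictly decreases in u, equals C_s at u = u_s, and a CDT is exactly a solution of
`phiIvp a s 1 u = pbar`.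

Lower bound. Offer one single-resource bundle at slowly rising valuations and stop at an arbitrary
price p. If ψ(p) is the utilization by then and Ψ its integral, β-competitiveness forces p ψ - Ψ -
f(ψ) ≥ f*(p)/β - δ. The `surplus` compares Ψ with the integral of the inverse of a candidate φ;
convexity of f turns the constraint into a Grönwall inequality for it. For β < `alphaMin s`, along
φ(y) = f'(y/u_s), the surplus divided by y^s must grow at least like a multiple of log y, impossible
over an interval reaching down towards 0. For pbar > C_s the surplus of the candidate of the theorem
is asymptotically nonnegative, while full capacity at y = 1 bounds it by δ minus a constant that is
positive if β < α. For β = α it is squeezed to 0, so ψ must be the inverse of the candidate; applied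
to the run of the posted price mechanism itself, this is uniqueness (`pricing_eq_of_surplus`). -/

namespace OnlinePricing

/-! ### Convexity of the cost, and revenue as a Riemann sum -/

/-- The tangent line inequality for the power function. -/
theorem rpow_tangent_le {s t y : ℝ} (hs : 1 < s) (ht : 0 ≤ t) (hy : 0 ≤ y) :
    t ^ s + s * t ^ (s - 1) * (y - t) ≤ y ^ s := by
  rcases ht.eq_or_lt with rfl | ht
  · rw [Real.zero_rpow (by linarith), Real.zero_rpow (by linarith)]
    simpa using Real.rpow_nonneg hy s
  · have h := one_add_mul_self_le_rpow_one_add (s := y / t - 1) (by have := div_nonneg hy ht.le; linarith) hs.le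
    rw [show 1 + (y / t - 1) = y / t by ring, Real.div_rpow hy ht.le,
      le_div_iff₀ (Real.rpow_pos_of_pos ht s)] at h
    have e : t ^ s = t ^ (s - 1) * t := by
      rw [← Real.rpow_add_one ht.ne']; ring_nf
    calc _ = (1 + s * (y / t - 1)) * t ^ s := by
          rw [e]; field_simp
      _ ≤ _ := h

theorem rpow_tangent_lt {s t y : ℝ} (hs : 1 < s) (ht : 0 < t) (hy : 0 ≤ y) (hne : y ≠ t) :
    t ^ s + s * t ^ (s - 1) * (y - t) < y ^ s := by
  have h := one_add_mul_self_lt_rpow_one_add (s := y / t - 1)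
    (by have := div_nonneg hy ht.le; linarith)
    (by intro h; apply hne; field_simp at h; linarith) hs
  rw [show 1 + (y / t - 1) = y / t by ring, Real.div_rpow hy ht.le,
    lt_div_iff₀ (Real.rpow_pos_of_pos ht s)] at h
  have e : t ^ s = t ^ (s - 1) * t := by
    rw [← Real.rpow_add_one ht.ne']; ring_nf
  calc _ = (1 + s * (y / t - 1)) * t ^ s := by
        rw [e]; field_simp
    _ < _ := h

theorem rpow_sub_rpow_le {s c y : ℝ} (hs : 1 < s) (hc : 0 ≤ c) (hcy : c ≤ y) (hy : y ≤ 1) :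
    y ^ s - c ^ s ≤ s * (y - c) := by
  have h := rpow_tangent_le hs (hc.trans hcy) hc
  have h1 : y ^ (s - 1) ≤ 1 := Real.rpow_le_one (hc.trans hcy) hy (by linarith)
  nlinarith [mul_le_mul_of_nonneg_right h1 (show 0 ≤ s * (y - c) from mul_nonneg (by linarith) (by linarith))]

/-- A potential of a pricing function bounds the revenue collected along an increasing sequence of
utilizations with small increments. -/
theorem potential_le_revenue {φ F : ℝ → ℝ} {m ε : ℝ} (hm0 : 0 ≤ m) (hm1 : m ≤ 1)
    (hφ : IsPricingFunction φ) (hF0 : F 0 ≤ 0)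
    (hF : ∀ y y', 0 ≤ y → y ≤ y' → y' ≤ m → F y' - F y ≤ φ y' * (y' - y))
    {y : ℕ → ℝ} (h0 : y 0 = 0) (hmono : ∀ n, y n ≤ y (n + 1))
    (hstep : ∀ n, y (n + 1) - y n ≤ ε) (N : ℕ) (hle : y N ≤ 1) :
    F (min (y N) m) + φ m * (y N - min (y N) m) - ε * φ (min (y N) m) ≤
      ∑ n ∈ Finset.range N, φ (y n) * (y (n + 1) - y n) := by
  have hε : 0 ≤ ε := (sub_nonneg.2 (hmono 0)).trans (hstep 0)
  have hmon : Monotone y := monotone_nat_of_le_succ hmono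
  induction N with
  | zero =>
    rw [h0, min_eq_left hm0]
    have := mul_nonneg hε (hφ.2 0 ⟨le_rfl, zero_le_one⟩)
    simp; linarith
  | succ n ih =>
    rw [Finset.sum_range_succ]
    have hn1 : y n ≤ 1 := (hmono n).trans hle
    have ih := ih hn1
    have hn0 : 0 ≤ y n := h0 ▸ hmon (Nat.zero_le n)
    have hn0' : 0 ≤ y (n + 1) := hn0.trans (hmono n)
    have hmle := hφ.1.monotoneOn
    set c := min (y n) m with hc
    set c' := min (y (n + 1)) m with hc'
    have hcm : c ≤ m := min_le_right _ _
    have hcm' : c' ≤ m := min_le_right _ _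
    have hc0 : 0 ≤ c := le_min hn0 hm0
    have hcc : c ≤ c' := min_le_min_right _ (hmono n)
    have hcy : c ≤ y n := min_le_left _ _
    have h1 := hF c c' hc0 hcc hcm'
    have h2 : φ c ≤ φ (y n) := hmle ⟨hc0, hcm.trans hm1⟩ ⟨hn0, hn1⟩ hcy
    have h3 : φ c ≤ φ c' := hmle ⟨hc0, hcm.trans hm1⟩ ⟨hc0.trans hcc, hcm'.trans hm1⟩ hcc
    -- Either the truncation at `m` is inactive and both excesses vanish, or `c' = m` and the two
    -- prices agree. The step inequality then closes because the gap between left and right endpoint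
    -- prices, at most `ε * (φ c' - φ c)`, telescopes.
    have h4 : (φ m - φ c') * ((y (n + 1) - c') - (y n - c)) = 0 := by
      rcases le_total (y (n + 1)) m with h | h
      · have e : c' = y (n + 1) := min_eq_left h
        have e' : c = y n := min_eq_left ((hmono n).trans h)
        rw [e, e']; ring
      · have e : c' = m := min_eq_right h
        rw [e]; ring
    have h5 := mul_le_mul_of_nonneg_right h2 (sub_nonneg.2 (hmono n))
    have h6 := mul_le_mul_of_nonneg_left (hstep n) (sub_nonneg.2 h3)
    linarith

/-! ### Primal-dual analysis of the posted price mechanism -/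

namespace Setup

variable {K B : Type*}

theorem share_nonneg (S : Setup K B) {C : ℝ} (hC : 0 < C) (k : K) (o : Option B) :
    0 ≤ S.share C k o := by
  cases o with
  | none => exact le_rfl
  | some b => exact div_nonneg (S.demand_nonneg b k) hC.le

theorem usage_zero (S : Setup K B) (C : ℝ) (x : ℕ → Option B) (k : K) : S.usage C x 0 k = 0 := by
  simp [usage]

theorem usage_succ (S : Setup K B) (C : ℝ) (x : ℕ → Option B) (n : ℕ) (k : K) :
    S.usage C x (n + 1) k = S.usage C x n k + S.share C k (x n) := by
  simp [usage, Finset.sum_range_succ]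

theorem usage_mono (S : Setup K B) {C : ℝ} (hC : 0 < C) (x : ℕ → Option B) (k : K) :
    Monotone fun n => S.usage C x n k :=
  monotone_nat_of_le_succ fun n => by
    rw [usage_succ]; linarith [S.share_nonneg hC k (x n)]

theorem usage_nonneg (S : Setup K B) {C : ℝ} (hC : 0 < C) (x : ℕ → Option B) (n : ℕ) (k : K) :
    0 ≤ S.usage C x n k := by
  rw [← S.usage_zero C x k]; exact S.usage_mono hC x k (Nat.zero_le n)

theorem usage_congr (S : Setup K B) (C : ℝ) {x x' : ℕ → Option B} {n : ℕ}
    (h : ∀ i < n, x i = x' i) : S.usage C x n = S.usage C x' n := by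
  ext k
  exact Finset.sum_congr rfl fun i hi => by rw [h i (Finset.mem_range.1 hi)]

theorem Admissible.value_le {S : Setup K B} {C : ℝ} {N : ℕ} {v : ℕ → B → ℝ}
    (h : S.Admissible C N v) {n : ℕ} (hn : n < N) {k : K} {o : Option B}
    (ho : 0 < S.share C k o) : value (v n) o ≤ S.pbar * S.share C k o := by
  cases o with
  | none => exact absurd ho (lt_irrefl _)
  | some b =>
    have hd : S.demand b k ≠ 0 := by
      rintro h0; simp [share, h0] at ho
    exact (div_le_iff₀ ho).1 (h n hn b k hd)

/-- This makes every sale consume a definite amount of capacity, so that errors made per sale can be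
charged to capacity and stay bounded however many customers arrive. -/
theorem exists_le_demand [Finite B] (S : Setup K B) : ∃ d > 0, ∀ b, ∃ k, d ≤ S.demand b k := by
  choose k hk using S.demand_pos
  rcases isEmpty_or_nonempty B with hB | hB
  · exact ⟨1, one_pos, fun b => hB.elim b⟩
  · obtain ⟨b, hb⟩ := Finite.exists_min fun b => S.demand b (k b)
    exact ⟨_, hk b, fun b' => ⟨k b', hb b'⟩⟩

variable [Fintype K]

theorem utility_le {S : Setup K B} {C : ℝ} (hC : 0 < C) {N : ℕ} {v : ℕ → B → ℝ}
    (h : S.Admissible C N v) {n : ℕ} (hn : n < N) {φ : ℝ → ℝ} {y : K → ℝ}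
    (hφ : ∀ k, 0 ≤ φ (y k)) {k : K} {o : Option B} (ho : 0 < S.share C k o) :
    S.utility C φ y (v n) o ≤ (S.pbar - φ (y k)) * S.share C k o := by
  have h1 := h.value_le hn ho
  have h2 : φ (y k) * S.share C k o ≤ ∑ j, φ (y j) * S.share C j o :=
    Finset.single_le_sum (f := fun j => φ (y j) * S.share C j o)
      (fun j _ => mul_nonneg (hφ j) (S.share_nonneg hC j o)) (Finset.mem_univ k)
  unfold utility; linarith

theorem utility_none (S : Setup K B) (C : ℝ) (φ : ℝ → ℝ) (y : K → ℝ) (v : B → ℝ) :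
    S.utility C φ y v none = 0 := by
  simp [utility, value, share]

theorem exists_demand_le [Finite B] (S : Setup K B) : ∃ d > 0, ∀ b k, S.demand b k ≤ d := by
  obtain ⟨d, hd⟩ := (Set.finite_range fun q : B × K => S.demand q.1 q.2).bddAbove
  exact ⟨max d 1, by positivity, fun b k => (hd ⟨(b, k), rfl⟩).trans (le_max_left _ _)⟩

theorem PPM.usage_le_one {S : Setup K B} {φ : ℝ → ℝ} {C : ℝ} {N : ℕ}
    {v : ℕ → B → ℝ} {x : ℕ → Option B} (h : S.PPM φ C N v x) {n : ℕ} (hn : n ≤ N) (k : K) :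
    S.usage C x n k ≤ 1 := by
  induction n with
  | zero => rw [usage_zero]; exact zero_le_one
  | succ n ih =>
    have ih := ih (by omega)
    rw [usage_succ]
    obtain ⟨b, -, ⟨-, h1, h2⟩ | ⟨-, h2⟩⟩ := h n (by omega)
    · rw [h2]; exact h1 k
    · rw [h2]; simpa [share] using ih

theorem optWelfare_le (S : Setup K B) {C : ℝ} {N : ℕ} {v : ℕ → B → ℝ} {X : ℝ}
    (h : ∀ z, S.Feasible C N z → S.welfare C N v z ≤ X) : S.optWelfare C N v ≤ X := by
  refine csSup_le ⟨_, ⟨fun _ => none, ?_, rfl⟩⟩ ?_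
  · intro k; simp [usage, share]
  · rintro _ ⟨z, hz, rfl⟩; exact h z hz

/-- Payments cancel between customers and provider, so any prices may be inserted. The offline
allocation is split with constant dual prices, the online one with the prices actually posted. -/
theorem welfare_eq (S : Setup K B) (C : ℝ) (N : ℕ) (v : ℕ → B → ℝ) (x : ℕ → Option B)
    (p : ℕ → K → ℝ) :
    S.welfare C N v x =
      ∑ n ∈ Finset.range N, (value (v n) (x n) - ∑ k, p n k * S.share C k (x n)) +
      ∑ k, (∑ n ∈ Finset.range N, p n k * S.share C k (x n) - S.cost (S.usage C x N k)) := by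
  rw [welfare, Finset.sum_sub_distrib, Finset.sum_sub_distrib, Finset.sum_comm]
  ring

/-- A pricing function `φ` with a potential `F` that dominates the conjugate of the supply cost is
competitive. -/
theorem competitive_of_potential [Finite B] (S : Setup K B) {a s : ℝ} (ha : 0 < a) (hs : 1 < s)
    (hcost : ∀ y ∈ Icc (0 : ℝ) 1, S.cost y = a * y ^ s) (hp : 0 < S.pbar) {φ F : ℝ → ℝ}
    {m α : ℝ} (hα : 1 ≤ α) (hφ : IsPricingFunction φ) (hm : m ≤ 1) (hF0 : F 0 ≤ 0)
    (hF : ∀ y y', 0 ≤ y → y ≤ y' → y' < m → F y' - F y ≤ φ y' * (y' - y))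
    (hdual : ∀ y, 0 ≤ y → y < m → ∀ Y ∈ Icc (0 : ℝ) 1,
      φ y * Y - a * Y ^ s ≤ α * (F y - a * y ^ s))
    (hle : ∀ y, 0 ≤ y → y < m → φ y ≤ S.pbar)
    (happ : ∀ η > 0, ∃ y, 0 ≤ y ∧ y < m ∧ S.pbar - η < φ y)
    (hgt : ∀ y, m < y → y ≤ 1 → S.pbar < φ y) : S.Competitive (S.PPM φ) α := by
  refine ⟨hα, fun δ hδ => ?_⟩
  obtain ⟨dM, hdM, hdM'⟩ := S.exists_demand_le
  obtain ⟨dm, hdm, hdm'⟩ := S.exists_le_demand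
  set κ : ℝ := (Fintype.card K : ℝ) with hκ
  have hκ0 : 0 ≤ κ := Nat.cast_nonneg _
  have hD : 0 < dM / dm := div_pos hdM hdm
  have has : 0 < a * s := by positivity
  -- the tolerance for the final price, and the tolerance for the size of a bundle
  obtain ⟨η, hη, hηδ⟩ : ∃ η > 0, η * (κ * (a * s + dM / dm)) ≤ δ / 2 := by
    refine ⟨δ / 2 / (κ * (a * s + dM / dm) + 1), by positivity, ?_⟩
    rw [div_mul_eq_mul_div, div_le_iff₀ (by positivity)]
    nlinarith
  obtain ⟨e, he, heδ⟩ : ∃ e > 0, e * (κ * (a * s + S.pbar)) ≤ δ / 2 := by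
    refine ⟨δ / 2 / (κ * (a * s + S.pbar) + 1), by positivity, ?_⟩
    rw [div_mul_eq_mul_div, div_le_iff₀ (by positivity)]
    nlinarith
  -- The hypotheses control `φ` only strictly below `m`, since the price at full capacity may be
  -- arbitrary. All estimates are made at a point `m'` just below, where the price is within `η` of
  -- `pbar`.
  obtain ⟨m', hm0, hmm, hmη, hφm⟩ :
      ∃ m', 0 ≤ m' ∧ m' < m ∧ m - m' ≤ η ∧ S.pbar - η < φ m' := by
    obtain ⟨y, hy0, hym, hy⟩ := happ η hη
    refine ⟨max y (m - η), le_max_of_le_left hy0, max_lt hym (by linarith), ?_, ?_⟩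
    · linarith [le_max_right y (m - η)]
    · refine hy.trans_le (hφ.1.monotoneOn ⟨hy0, by linarith⟩ ⟨le_max_of_le_left hy0, ?_⟩
        (le_max_left _ _))
      exact max_le (by linarith) (by linarith)
  have hm1 : m' < 1 := hmm.trans_le hm
  refine ⟨max (dM / e) (dM / (1 - m')), lt_max_of_lt_left (by positivity),
    fun C hC N v x hadm hx => ?_⟩
  have hC0 : 0 < C := lt_of_lt_of_le (by positivity) ((le_max_left _ _).trans hC)
  set ε := dM / C with hε
  have hε0 : 0 < ε := by positivity
  have hεe : ε ≤ e := by
    have := (le_max_left _ _).trans hC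
    rw [div_le_iff₀ he] at this
    rw [hε, div_le_iff₀ hC0]; linarith
  have hεm : ε ≤ 1 - m' := by
    have := (le_max_right _ _).trans hC
    rw [div_le_iff₀ (by linarith)] at this
    rw [hε, div_le_iff₀ hC0]; linarith
  have hshare : ∀ k o, S.share C k o ≤ ε := by
    intro k o
    cases o with
    | none => exact hε0.le
    | some b => exact div_le_div_of_nonneg_right (hdM' b k) hC0.le
  have hsh0 := fun k o => S.share_nonneg hC0 k o
  have hu0 := fun n k => S.usage_nonneg hC0 x n k
  have hu1 : ∀ n ≤ N, ∀ k, S.usage C x n k ≤ 1 := fun n hn k => PPM.usage_le_one hx hn k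
  have humono := fun k => S.usage_mono hC0 x k
  have hφmono := hφ.1.monotoneOn
  have hφ0 : ∀ n ≤ N, ∀ k, 0 ≤ φ (S.usage C x n k) := fun n hn k =>
    hφ.2 _ ⟨hu0 n k, hu1 n hn k⟩
  refine ⟨hu1 N le_rfl, ?_⟩
  set u : ℕ → ℝ := fun n => S.utility C φ (S.usage C x n) (v n) (x n) with hu
  have hupos : ∀ n < N, 0 ≤ u n := by
    intro n hn
    obtain ⟨b, hb, ⟨h0, -, h2⟩ | ⟨-, h2⟩⟩ := hx n hn
    · simp only [hu]; rw [h2]; exact h0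
    · simp only [hu]; rw [h2, utility_none]
  have hbuy : ∀ n < N, ∀ k, 0 < S.share C k (x n) → φ (S.usage C x n k) ≤ S.pbar := by
    intro n hn k hk
    have := (hupos n hn).trans (utility_le hC0 hadm hn (hφ0 n hn.le) hk)
    by_contra! hc
    nlinarith [mul_neg_of_neg_of_pos (sub_neg.2 hc) hk]
  have hfinal : ∀ k, ∀ n ≤ N, S.usage C x n k ≤ m + ε := by
    intro k n hn
    induction n with
    | zero => rw [usage_zero]; linarith
    | succ n ih =>
      have ih := ih (by omega)
      rw [usage_succ]
      rcases (hsh0 k (x n)).eq_or_lt with h | h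
      · rw [← h]; simpa using ih
      · have h1 := hbuy n (by omega) k h
        have h2 : S.usage C x n k ≤ m := by
          by_contra! hc
          exact absurd (hgt _ hc (hu1 n (by omega) k)) (not_lt.2 h1)
        linarith [hshare k (x n)]
  -- near capacity the prices are almost `pbar`
  have hnear : ∀ y, m' ≤ y → y ≤ 1 → S.pbar - η < φ y := fun y h1 h2 =>
    hφm.trans_le (hφmono ⟨hm0, hm1.le⟩ ⟨hm0.trans h1, h2⟩ h1)
  -- Only a refusal for lack of capacity can leave a customer below her best utility. The resource
  -- is then within one bundle of full, its price within `η` of `pbar`, and the lost utility at most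
  -- `η * ε`.
  have hbest : ∀ n < N, ∀ o, S.utility C φ (S.usage C x n) (v n) o ≤ u n + η * ε := by
    intro n hn o
    have hηε : 0 ≤ η * ε := by positivity
    obtain ⟨b, hb, ⟨h0, -, h2⟩ | ⟨h1, h2⟩⟩ := hx n hn
    · simp only [hu]; rw [h2]; linarith [hb o]
    · have h3 : 0 ≤ S.utility C φ (S.usage C x n) (v n) b := by
        have := hb none; rwa [utility_none] at this
      obtain ⟨k, hk⟩ := h1.resolve_left (not_lt.2 h3)
      have hk0 : 0 < S.share C k b := by linarith [hu1 n hn.le k]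
      have h4 := utility_le hC0 hadm hn (hφ0 n hn.le) hk0
      have h5 := hnear (S.usage C x n k) (by linarith [hshare k b]) (hu1 n hn.le k)
      have h6 := hupos n hn
      have h7 : (S.pbar - φ (S.usage C x n k)) * S.share C k b ≤ η * ε :=
        mul_le_mul (by linarith) (hshare k b) hk0.le hη.le
      linarith [hb o]
  -- the dual prices
  set c : K → ℝ := fun k => min (S.usage C x N k) m' with hc
  have hc0 : ∀ k, 0 ≤ c k := fun k => le_min (hu0 N k) hm0
  have hcm : ∀ k, c k ≤ m' := fun k => min_le_right _ _
  have hcu : ∀ k, c k ≤ S.usage C x N k := fun k => min_le_left _ _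
  have hpr0 : ∀ k, 0 ≤ φ (c k) := fun k => hφ.2 _ ⟨hc0 k, (hcm k).trans hm1.le⟩
  -- The slack is proportional to the size of the offline bundle, so that its sum over all customers
  -- is bounded through the offline capacity and not through `N`.
  have hoff : ∀ n < N, ∀ o, value (v n) o - ∑ k, φ (c k) * S.share C k o ≤
      u n + η * (dM / dm) * ∑ k, S.share C k o := by
    intro n hn o
    have hslack : o ≠ none → η * ε ≤ η * (dM / dm) * ∑ k, S.share C k o := by
      intro ho
      obtain ⟨b, rfl⟩ := Option.ne_none_iff_exists'.1 ho
      obtain ⟨k, hk⟩ := hdm' b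
      have h1 : dm / C ≤ ∑ k, S.share C k (some b) :=
        (div_le_div_of_nonneg_right hk hC0.le : dm / C ≤ S.share C k (some b)).trans
          (Finset.single_le_sum (f := fun k => S.share C k (some b))
            (fun j _ => hsh0 j _) (Finset.mem_univ k))
      calc η * ε = η * (dM / dm) * (dm / C) := by rw [hε]; field_simp
        _ ≤ _ := mul_le_mul_of_nonneg_left h1 (by positivity)
    by_cases ho : o = none
    · subst ho; simpa [value, share] using hupos n hn
    have hslack := hslack ho
    by_cases hall : ∀ k, 0 < S.share C k o → φ (S.usage C x n k) ≤ φ (c k)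
    · have h1 : ∑ k, φ (S.usage C x n k) * S.share C k o ≤ ∑ k, φ (c k) * S.share C k o := by
        refine Finset.sum_le_sum fun k _ => ?_
        rcases (hsh0 k o).eq_or_lt with h | h
        · rw [← h]; simp
        · exact mul_le_mul_of_nonneg_right (hall k h) h.le
      have h2 := hbest n hn o
      unfold utility at h2
      linarith
    -- A current price above its dual price is possible only where the dual price was truncated at
    -- `m'`; that price alone already takes all but `η` of the largest per-unit valuation.
    · push Not at hall
      obtain ⟨k, hk0, hk⟩ := hall
      have hcm' : c k = m' := by
        by_contra hne
        have : c k = S.usage C x N k := by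
          rcases min_choice (S.usage C x N k) m' with h | h
          · exact h
          · exact absurd h hne
        rw [this] at hk
        exact absurd (hφmono ⟨hu0 n k, hu1 n hn.le k⟩ ⟨hu0 N k, hu1 N le_rfl k⟩
          (humono k hn.le)) (not_le.2 hk)
      have h1 := hadm.value_le hn hk0
      have h2 : φ (c k) * S.share C k o ≤ ∑ j, φ (c j) * S.share C j o :=
        Finset.single_le_sum (f := fun j => φ (c j) * S.share C j o)
          (fun j _ => mul_nonneg (hpr0 j) (hsh0 j o)) (Finset.mem_univ k)
      rw [hcm'] at h2
      have h3 : (S.pbar - φ m') * S.share C k o ≤ η * ε :=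
        mul_le_mul (by linarith) (hshare k o) hk0.le hη.le
      linarith [hupos n hn]
  -- the offline optimum
  have hopt : S.optWelfare C N v ≤ ∑ n ∈ Finset.range N, u n +
      ∑ k, α * (F (c k) - a * c k ^ s) + η * (dM / dm) * κ := by
    refine S.optWelfare_le fun z hz => ?_
    rw [S.welfare_eq C N v z fun _ k => φ (c k)]
    have h1 : ∑ n ∈ Finset.range N, (value (v n) (z n) - ∑ k, φ (c k) * S.share C k (z n)) ≤
        ∑ n ∈ Finset.range N, u n + η * (dM / dm) * κ := by
      calc _ ≤ ∑ n ∈ Finset.range N, (u n + η * (dM / dm) * ∑ k, S.share C k (z n)) :=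
            Finset.sum_le_sum fun n hn => hoff n (Finset.mem_range.1 hn) (z n)
        _ = ∑ n ∈ Finset.range N, u n + η * (dM / dm) * ∑ k, S.usage C z N k := by
            rw [Finset.sum_add_distrib, ← Finset.mul_sum, Finset.sum_comm]; rfl
        _ ≤ _ := by
            gcongr
            calc ∑ k, S.usage C z N k ≤ ∑ _k : K, (1 : ℝ) := Finset.sum_le_sum fun k _ => hz k
              _ = κ := by simp [hκ]
    have h2 : ∑ k, (∑ n ∈ Finset.range N, φ (c k) * S.share C k (z n) -
        S.cost (S.usage C z N k)) ≤ ∑ k, α * (F (c k) - a * c k ^ s) := by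
      refine Finset.sum_le_sum fun k _ => ?_
      have hY : S.usage C z N k ∈ Icc (0 : ℝ) 1 := ⟨S.usage_nonneg hC0 z N k, hz k⟩
      rw [← Finset.mul_sum, hcost _ hY]
      exact hdual (c k) (hc0 k) ((hcm k).trans_lt hmm) _ hY
    linarith
  -- the online welfare
  have hon : ∑ n ∈ Finset.range N, u n + ∑ k, (F (c k) - a * c k ^ s) -
      κ * (ε * S.pbar + a * s * (η + ε)) ≤ S.welfare C N v x := by
    rw [S.welfare_eq C N v x fun n k => φ (S.usage C x n k)]
    have h1 : ∑ k, (F (c k) - a * c k ^ s) - κ * (ε * S.pbar + a * s * (η + ε)) ≤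
        ∑ k, (∑ n ∈ Finset.range N, φ (S.usage C x n k) * S.share C k (x n) -
          S.cost (S.usage C x N k)) := by
      have : κ * (ε * S.pbar + a * s * (η + ε)) =
          ∑ _k : K, (ε * S.pbar + a * s * (η + ε)) := by
        rw [Finset.sum_const, nsmul_eq_mul, Finset.card_univ]
      rw [this, ← Finset.sum_sub_distrib]
      refine Finset.sum_le_sum fun k _ => ?_
      have h2 := potential_le_revenue (y := fun n => S.usage C x n k) (ε := ε) hm0 hm1.le hφ hF0
        (fun y y' h1 h2 h3 => hF y y' h1 h2 (h3.trans_lt hmm)) (S.usage_zero C x k)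
        (fun n => humono k (Nat.le_succ n))
        (fun n => by rw [usage_succ]; linarith [hshare k (x n)]) N (hu1 N le_rfl k)
      simp only [usage_succ, add_sub_cancel_left] at h2
      rw [hcost _ ⟨hu0 N k, hu1 N le_rfl k⟩]
      change F (c k) + φ m' * (S.usage C x N k - c k) - ε * φ (c k) ≤ _ at h2
      have h3 := rpow_sub_rpow_le hs (hc0 k) (hcu k) (hu1 N le_rfl k)
      have h4 : S.usage C x N k - c k ≤ η + ε := by
        have := hfinal k N le_rfl
        rcases min_choice (S.usage C x N k) m' with h | h
        · rw [show c k = _ from h]; linarith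
        · rw [show c k = _ from h]; linarith
      have h5 : 0 ≤ φ m' * (S.usage C x N k - c k) :=
        mul_nonneg (hφ.2 _ ⟨hm0, hm1.le⟩) (sub_nonneg.2 (hcu k))
      have h6 := mul_le_mul_of_nonneg_left (hle (c k) (hc0 k) ((hcm k).trans_lt hmm)) hε0.le
      have h7 := mul_le_mul_of_nonneg_left h3 ha.le
      have h8 := mul_le_mul_of_nonneg_left h4 has.le
      linarith
    have : ∑ n ∈ Finset.range N, (value (v n) (x n) -
        ∑ k, φ (S.usage C x n k) * S.share C k (x n)) = ∑ n ∈ Finset.range N, u n := rfl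
    linarith
  have hU : 0 ≤ ∑ n ∈ Finset.range N, u n :=
    Finset.sum_nonneg fun n hn => hupos n (Finset.mem_range.1 hn)
  have hα0 : 0 < α := by linarith
  have hdiv : S.optWelfare C N v / α ≤ ∑ n ∈ Finset.range N, u n +
      ∑ k, (F (c k) - a * c k ^ s) + η * (dM / dm) * κ := by
    rw [div_le_iff₀ hα0]
    refine hopt.trans ?_
    rw [← Finset.mul_sum]
    -- The utilities and the error enter the bound on the optimum with factor 1, so `1 ≤ α` lets
    -- them survive the division by `α` undiminished.
    have h1 : 0 ≤ η * (dM / dm) * κ := by positivity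
    nlinarith [mul_nonneg (sub_nonneg.2 hα) hU, mul_nonneg (sub_nonneg.2 hα) h1]
  have h9 : ε * (κ * (a * s + S.pbar)) ≤ δ / 2 :=
    (mul_le_mul_of_nonneg_right hεe (by positivity)).trans heδ
  linarith

end Setup

/-! ### Sales curves from rising valuations -/

/-- `ψ p` is the utilization reached when the valuations have risen to `p`, and `Ψ` is the integral
of `ψ`. -/
structure IsSalesCurve (ψ Ψ : ℝ → ℝ) : Prop where
  nonneg : ∀ p, 0 ≤ ψ p
  le_one : ∀ p, ψ p ≤ 1
  zero : Ψ 0 = 0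
  cont : Continuous Ψ
  deriv_right : ∀ p, HasDerivWithinAt Ψ (ψ p) (Ici p) p
  subgrad : ∀ p q, Ψ p + ψ p * (q - p) ≤ Ψ q

theorem IsSalesCurve.integral_nonneg {ψ Ψ : ℝ → ℝ} (h : IsSalesCurve ψ Ψ) {p : ℝ} (hp : 0 ≤ p) :
    0 ≤ Ψ p := by
  have := h.subgrad 0 p
  rw [h.zero] at this
  nlinarith [mul_nonneg (h.nonneg 0) hp]

theorem IsSalesCurve.integral_le {ψ Ψ : ℝ → ℝ} (h : IsSalesCurve ψ Ψ) {p : ℝ} (hp : 0 ≤ p) :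
    Ψ p ≤ p := by
  have := h.subgrad p 0
  rw [h.zero] at this
  nlinarith [mul_le_mul_of_nonneg_right (h.le_one p) hp]

/-- The sales curve satisfies the constraints of a `β`-competitive mechanism up to the error `δ`. -/
def IsCompetitiveCurve (a s pbar β δ : ℝ) (ψ Ψ : ℝ → ℝ) : Prop :=
  IsSalesCurve ψ Ψ ∧ ∀ p ∈ Icc 0 pbar, ∀ q ∈ Icc (0 : ℝ) 1,
    (p * q - a * q ^ s) / β - δ ≤ p * ψ p - Ψ p - a * ψ p ^ s

open Classical in
/-- The total weight of the sales at prices up to `p`. -/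
noncomputable def salesRate (N : ℕ) (w P : ℕ → ℝ) (p : ℝ) : ℝ :=
  ∑ n ∈ Finset.range N, w n * if P n ≤ p then 1 else 0

/-- The integral of `salesRate`. -/
noncomputable def salesIntegral (N : ℕ) (w P : ℕ → ℝ) (p : ℝ) : ℝ :=
  ∑ n ∈ Finset.range N, w n * max (p - P n) 0

/-- The integral is a nonnegative combination of hinges `max (p - P n) 0`, which are convex with
right derivative the indicator of `P n ≤ p`. -/
theorem isSalesCurve_of_weights {N : ℕ} {w P : ℕ → ℝ} (hw : ∀ n, 0 ≤ w n) (hP : ∀ n, 0 ≤ P n)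
    (hsum : ∑ n ∈ Finset.range N, w n ≤ 1) :
    IsSalesCurve (salesRate N w P) (salesIntegral N w P) where
  nonneg p := Finset.sum_nonneg fun n _ => mul_nonneg (hw n) (by split_ifs <;> norm_num)
  le_one p := (Finset.sum_le_sum fun n _ => by
    split_ifs
    · rw [mul_one]
    · rw [mul_zero]; exact hw n).trans hsum
  zero := Finset.sum_eq_zero fun n _ => by
    rw [max_eq_right (by linarith [hP n]), mul_zero]
  cont := by unfold salesIntegral; fun_prop
  deriv_right p := by
    unfold salesRate salesIntegral
    refine HasDerivWithinAt.fun_sum fun n _ => HasDerivWithinAt.const_mul _ ?_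
    split_ifs with h
    · refine ((hasDerivWithinAt_id p (Ici p)).sub_const (P n)).congr (fun q hq => ?_) ?_
      · rw [max_eq_left (by have : p ≤ q := hq; linarith)]; rfl
      · rw [max_eq_left (by linarith)]; rfl
    · push Not at h
      refine HasDerivAt.hasDerivWithinAt ?_
      refine (hasDerivAt_const p (0 : ℝ)).congr_of_eventuallyEq ?_
      filter_upwards [Iio_mem_nhds h] with q hq
      rw [max_eq_right (by have : q < P n := hq; linarith)]
  subgrad p q := by
    unfold salesRate salesIntegral
    rw [Finset.sum_mul, ← Finset.sum_add_distrib]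
    refine Finset.sum_le_sum fun n _ => ?_
    rw [mul_assoc, ← mul_add]
    refine mul_le_mul_of_nonneg_left ?_ (hw n)
    split_ifs with h
    · rw [max_eq_left (by linarith)]
      exact le_trans (by linarith) (le_max_left _ _)
    · rw [max_eq_right (by linarith)]; simp

open Classical in
-- Summation by parts: p ψ(p) - Ψ(p) is the Stieltjes integral of the price against the sales, that
-- is, the total valuation of what was sold up to price `p`.
theorem mul_salesRate_sub_salesIntegral (N : ℕ) (w P : ℕ → ℝ) (p : ℝ) :
    p * salesRate N w P p - salesIntegral N w P p =
      ∑ n ∈ Finset.range N, if P n ≤ p then w n * P n else 0 := by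
  unfold salesRate salesIntegral
  rw [Finset.mul_sum, ← Finset.sum_sub_distrib]
  refine Finset.sum_congr rfl fun n _ => ?_
  split_ifs with h
  · rw [max_eq_left (by linarith)]; ring
  · rw [max_eq_right (by linarith)]; ring

namespace Setup

variable {K B : Type*}

/-- The price level announced to customer `n`: the levels `0, η, 2η, …` are each repeated for `L`
customers. -/
noncomputable def level (L : ℕ) (η : ℝ) (n : ℕ) : ℝ := ((n / L : ℕ) : ℝ) * η

open Classical in
/-- The valuations of customers who want the bundle `b`, of size `r`, with rising valuations. -/
noncomputable def staircase (b : B) (r : ℝ) (L : ℕ) (η : ℝ) (n : ℕ) (b' : B) : ℝ :=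
  if b' = b then level L η n * r else -1

open Classical in
/-- The weights of the sales of bundle `b` in the allocation `x`. -/
noncomputable def saleWeight (b : B) (r : ℝ) (x : ℕ → Option B) (n : ℕ) : ℝ := if x n = some b then r else 0

theorem level_nonneg {η : ℝ} (hη : 0 ≤ η) (L n : ℕ) : 0 ≤ level L η n :=
  mul_nonneg (Nat.cast_nonneg _) hη

theorem level_le_iff {L : ℕ} (hL : 0 < L) {η p : ℝ} (hη : 0 < η) (hp : 0 ≤ p) (n : ℕ) :
    level L η n ≤ p ↔ n < (⌊p / η⌋₊ + 1) * L := by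
  rw [level, ← le_div_iff₀ hη, ← Nat.le_floor_iff (by positivity), ← Nat.lt_succ_iff,
    Nat.div_lt_iff_lt_mul hL]

theorem saleWeight_nonneg (b : B) {r : ℝ} (hr : 0 ≤ r) (x : ℕ → Option B) (n : ℕ) :
    0 ≤ saleWeight b r x n := by
  unfold saleWeight; split_ifs <;> simp [hr]

theorem staircase_admissible (S : Setup K B) {b : B} {k : K} (hb : 0 < S.demand b k)
    (hbk : ∀ j, j ≠ k → S.demand b j = 0) (hp : 0 < S.pbar) {C : ℝ} (hC : 0 < C) {M L : ℕ}
    (hM : 0 < M) (hL : 0 < L) {N : ℕ} (hN : N ≤ (M + 1) * L) :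
    S.Admissible C N (staircase b (S.demand b k / C) L (S.pbar / M)) := by
  intro n hn b' k' hk'
  have hM' : (0 : ℝ) < M := by exact_mod_cast hM
  by_cases h : b' = b
  · subst h
    have : k' = k := by by_contra hne; exact hk' (hbk k' hne)
    subst this
    simp only [staircase, if_true, share]
    rw [mul_div_assoc, div_self (by positivity), mul_one]
    rw [level_le_iff hL (by positivity) hp.le, div_div_cancel₀ hp.ne', Nat.floor_natCast]
    omega
  · simp only [staircase, if_neg h]
    refine le_trans ?_ hp.le
    exact div_nonpos_of_nonpos_of_nonneg (by norm_num) (S.share_nonneg hC _ _)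

theorem sum_block {N i j : ℕ} (hij : j + i ≤ N) (g : ℕ → ℝ) :
    ∑ n ∈ Finset.range N, (if n ∈ Finset.Ico j (j + i) then g n else 0) =
      ∑ n ∈ Finset.Ico j (j + i), g n := by
  rw [← Finset.sum_filter]
  refine Finset.sum_congr ?_ fun _ _ => rfl
  ext n; simp; omega

theorem cost_nonneg (S : Setup K B) {a s : ℝ} (ha : 0 < a)
    (hcost : ∀ y ∈ Icc (0 : ℝ) 1, S.cost y = a * y ^ s) {y : ℝ} (hy : y ∈ Icc (0 : ℝ) 1) :
    0 ≤ S.cost y := by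
  rw [hcost y hy]; exact mul_nonneg ha.le (Real.rpow_nonneg hy.1 s)

theorem sum_saleWeight_le (S : Setup K B) {b : B} {k : K} {C : ℝ} (hC : 0 < C)
    (x : ℕ → Option B) (N : ℕ) :
    ∑ n ∈ Finset.range N, saleWeight b (S.demand b k / C) x n ≤ S.usage C x N k := by
  refine Finset.sum_le_sum fun n _ => ?_
  unfold saleWeight
  split_ifs with h
  · rw [h]; rfl
  · exact S.share_nonneg hC k _

variable [Fintype K]

theorem bddAbove_welfare [Fintype B] (S : Setup K B) {a s : ℝ} (ha : 0 < a)
    (hcost : ∀ y ∈ Icc (0 : ℝ) 1, S.cost y = a * y ^ s) {C : ℝ} (hC : 0 < C) (N : ℕ)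
    (v : ℕ → B → ℝ) : BddAbove (S.welfare C N v '' {x | S.Feasible C N x}) := by
  refine ⟨∑ n ∈ Finset.range N, ∑ b, |v n b|, ?_⟩
  rintro _ ⟨x, hx, rfl⟩
  have h1 : 0 ≤ ∑ k, S.cost (S.usage C x N k) := Finset.sum_nonneg fun k _ =>
    S.cost_nonneg ha hcost ⟨S.usage_nonneg hC x N k, hx k⟩
  have h2 : ∑ n ∈ Finset.range N, value (v n) (x n) ≤ ∑ n ∈ Finset.range N, ∑ b, |v n b| := by
    refine Finset.sum_le_sum fun n _ => ?_
    cases x n with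
    | none => exact Finset.sum_nonneg fun b _ => abs_nonneg _
    | some b =>
      exact (le_abs_self _).trans (Finset.single_le_sum (f := fun b => |v n b|)
        (fun b _ => abs_nonneg _) (Finset.mem_univ b))
  unfold welfare; linarith

/-- Serving `⌊q / r⌋` of the customers at the price level `j * η`. -/
theorem le_optWelfare_staircase [Fintype B] (S : Setup K B) {a s : ℝ} (ha : 0 < a) (hs : 1 < s)
    (hcost : ∀ y ∈ Icc (0 : ℝ) 1, S.cost y = a * y ^ s) {b : B} {k : K}
    (hb : 0 < S.demand b k) (hbk : ∀ j, j ≠ k → S.demand b j = 0) {C : ℝ} (hC : 0 < C) {L : ℕ}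
    (hL : ⌊1 / (S.demand b k / C)⌋₊ < L) {η : ℝ} (hη : 0 ≤ η) (j : ℕ) {q : ℝ}
    (hq : q ∈ Icc (0 : ℝ) 1) :
    j * η * (q - S.demand b k / C) - a * q ^ s ≤
      S.optWelfare C ((j + 1) * L) (staircase b (S.demand b k / C) L η) := by
  classical
  set r := S.demand b k / C with hr
  have hr0 : 0 < r := by positivity
  set i := ⌊q / r⌋₊ with hi
  -- Rounding down to whole bundles costs at most one bundle of value, and the served quantity does
  -- not exceed `q`, so the cost bound is preserved.
  have hiq : i * r ≤ q := by
    rw [← le_div_iff₀ hr0]; exact Nat.floor_le (div_nonneg hq.1 hr0.le)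
  have hiq' : q - r ≤ i * r := by
    have := Nat.lt_floor_add_one (q / r)
    rw [div_lt_iff₀ hr0] at this
    rw [hi]; linarith
  have hiL : i < L := (Nat.floor_le_floor (div_le_div_of_nonneg_right hq.2 hr0.le)).trans_lt hL
  set z : ℕ → Option B := fun n => if n ∈ Finset.Ico (j * L) (j * L + i) then some b else none
    with hz
  have hN : j * L + i ≤ (j + 1) * L := by rw [add_mul]; omega
  have hus : ∀ k', S.usage C z ((j + 1) * L) k' = i * S.share C k' (some b) := by
    intro k'
    have : ∀ n, S.share C k' (z n) =
        if n ∈ Finset.Ico (j * L) (j * L + i) then S.share C k' (some b) else 0 := by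
      intro n; simp only [hz]; split_ifs <;> rfl
    rw [usage, Finset.sum_congr rfl fun n _ => this n, sum_block hN]
    simp
  have husk : S.usage C z ((j + 1) * L) k = i * r := hus k
  have hus0 : ∀ k', k' ≠ k → S.usage C z ((j + 1) * L) k' = 0 := by
    intro k' hk'; rw [hus, share, hbk k' hk']; simp
  have hfeas : S.Feasible C ((j + 1) * L) z := by
    intro k'
    by_cases h : k' = k
    · rw [h, husk]; exact hiq.trans hq.2
    · rw [hus0 k' h]; exact zero_le_one
  refine le_trans ?_ (le_csSup (S.bddAbove_welfare ha hcost hC _ _) ⟨z, hfeas, rfl⟩)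
  have hval : ∑ n ∈ Finset.range ((j + 1) * L), value (staircase b r L η n) (z n) =
      j * η * (i * r) := by
    have : ∀ n, value (staircase b r L η n) (z n) =
        if n ∈ Finset.Ico (j * L) (j * L + i) then level L η n * r else 0 := by
      intro n; simp only [hz]; split_ifs <;> simp [value, staircase]
    rw [Finset.sum_congr rfl fun n _ => this n, sum_block hN]
    have h2 : ∀ n ∈ Finset.Ico (j * L) (j * L + i), level L η n * r = j * η * r := by
      intro n hn
      rw [Finset.mem_Ico] at hn
      have : n / L = j := by
        rw [Nat.div_eq_iff (by omega)]
        constructor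
        · linarith [hn.1]
        · have := hn.2; omega
      rw [level, this]
    rw [Finset.sum_congr rfl h2]
    simp; ring
  have hcst : ∑ k', S.cost (S.usage C z ((j + 1) * L) k') = a * (i * r) ^ s := by
    rw [Finset.sum_eq_single k]
    · rw [husk, hcost _ ⟨by positivity, hiq.trans hq.2⟩]
    · intro k' _ hk'
      rw [hus0 k' hk', hcost 0 ⟨le_rfl, zero_le_one⟩, Real.zero_rpow (by linarith), mul_zero]
    · simp
  rw [welfare, hval, hcst]
  have h1 : (i * r) ^ s ≤ q ^ s := Real.rpow_le_rpow (by positivity) hiq (by linarith)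
  have h2 := mul_le_mul_of_nonneg_left hiq' (show (0 : ℝ) ≤ j * η by positivity)
  nlinarith [mul_le_mul_of_nonneg_left h1 ha.le]

/-- Selling any other bundle only hurts: it is valued at -1, and the costs it causes are nonnegative
and can be dropped. -/
theorem welfare_staircase_le (S : Setup K B) {a s : ℝ} (ha : 0 < a) (hs : 1 < s)
    (hcost : ∀ y ∈ Icc (0 : ℝ) 1, S.cost y = a * y ^ s) {b : B} {k : K} {C : ℝ} (hC : 0 < C)
    {L : ℕ} {η : ℝ} {N : ℕ} {x : ℕ → Option B} (hr : 0 ≤ S.demand b k / C)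
    (hx : S.Feasible C N x) :
    S.welfare C N (staircase b (S.demand b k / C) L η) x ≤
      ∑ n ∈ Finset.range N, saleWeight b (S.demand b k / C) x n * level L η n -
        a * (∑ n ∈ Finset.range N, saleWeight b (S.demand b k / C) x n) ^ s := by
  have h1 : ∑ n ∈ Finset.range N, value (staircase b (S.demand b k / C) L η n) (x n) ≤
      ∑ n ∈ Finset.range N, saleWeight b (S.demand b k / C) x n * level L η n := by
    refine Finset.sum_le_sum fun n _ => ?_
    unfold saleWeight
    cases hxn : x n with
    | none => simp [value]
    | some b' =>
      by_cases h : b' = b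
      · simp [value, staircase, h, mul_comm]
      · simp [value, staircase, h]
  have hmem : ∀ k', S.usage C x N k' ∈ Icc (0 : ℝ) 1 := fun k' =>
    ⟨S.usage_nonneg hC x N k', hx k'⟩
  have h2 : S.cost (S.usage C x N k) ≤ ∑ k', S.cost (S.usage C x N k') :=
    Finset.single_le_sum (f := fun k' => S.cost (S.usage C x N k'))
      (fun k' _ => S.cost_nonneg ha hcost (hmem k')) (Finset.mem_univ k)
  rw [hcost _ (hmem k)] at h2
  have h3 := Real.rpow_le_rpow (Finset.sum_nonneg fun n _ => saleWeight_nonneg b hr x n)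
    (S.sum_saleWeight_le (b := b) (k := k) hC x N) (by linarith : 0 ≤ s)
  unfold welfare
  nlinarith [mul_le_mul_of_nonneg_left h3 ha.le]

/-- A competitive mechanism facing a fine staircase of valuations produces a sales curve that
satisfies the corresponding constraints. -/
theorem exists_staircase [Fintype B] (S : Setup K B) {a s : ℝ} (ha : 0 < a) (hs : 1 < s)
    (hcost : ∀ y ∈ Icc (0 : ℝ) 1, S.cost y = a * y ^ s) (hp : 0 < S.pbar) {b : B} {k : K}
    (hb : 0 < S.demand b k) (hbk : ∀ j, j ≠ k → S.demand b j = 0)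
    {mech : ℝ → ℕ → (ℕ → B → ℝ) → (ℕ → Option B) → Prop} {β : ℝ}
    (hmech : S.Competitive mech β)
    (htrunc : ∀ C N N' v x, N' ≤ N → mech C N v x → mech C N' v x) {δ : ℝ} (hδ : 0 < δ) :
    ∃ C > 0, ∃ M : ℕ, 0 < M ∧ S.pbar / M ≤ δ ∧ S.demand b k / C ≤ δ ∧
      ∀ L, L = ⌊1 / (S.demand b k / C)⌋₊ + 1 → ∀ x,
        mech C ((M + 1) * L) (staircase b (S.demand b k / C) L (S.pbar / M)) x →
        IsCompetitiveCurve a s S.pbar β δ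
          (salesRate ((M + 1) * L) (saleWeight b (S.demand b k / C) x) (level L (S.pbar / M)))
          (salesIntegral ((M + 1) * L) (saleWeight b (S.demand b k / C) x)
            (level L (S.pbar / M))) := by
  obtain ⟨hβ, hcomp⟩ := hmech
  -- One third of `δ` each goes to the competitive guarantee, to the price grid `η`, and to the size
  -- `r` of a bundle at value `pbar`.
  obtain ⟨C₀, hC₀, hcomp⟩ := hcomp (δ / 3) (by positivity)
  obtain ⟨M, hM⟩ := exists_nat_gt (S.pbar / (δ / 3))
  have hM' : (0 : ℝ) < M := lt_trans (by positivity) hM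
  have hM0 : 0 < M := by exact_mod_cast hM'
  set η := S.pbar / M with hη
  have hη0 : 0 < η := by positivity
  have hηδ : η ≤ δ / 3 := by
    rw [div_lt_iff₀ (by positivity)] at hM
    rw [hη, div_le_iff₀ hM']; linarith
  set C := max C₀ (max (S.demand b k / δ) (S.demand b k * S.pbar / (δ / 3))) with hC
  have hC0 : 0 < C := lt_max_of_lt_left hC₀
  set r := S.demand b k / C with hr
  have hr0 : 0 < r := by positivity
  have hrδ : r ≤ δ := by
    have : S.demand b k / δ ≤ C := (le_max_left _ _).trans (le_max_right _ _)
    rw [div_le_iff₀ hδ] at this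
    rw [hr, div_le_iff₀ hC0]; linarith
  have hrp : r * S.pbar ≤ δ / 3 := by
    have : S.demand b k * S.pbar / (δ / 3) ≤ C := (le_max_right _ _).trans (le_max_right _ _)
    rw [div_le_iff₀ (by positivity)] at this
    rw [hr, div_mul_eq_mul_div, div_le_iff₀ hC0]; linarith
  refine ⟨C, hC0, M, hM0, by linarith, hrδ, fun L hL x hx => ?_⟩
  have hL0 : 0 < L := by omega
  set N := (M + 1) * L with hN
  set w := saleWeight b r x with hw
  set P := level L η with hP
  have hfeas := (hcomp C (le_max_left _ _) N _ x
    (S.staircase_admissible hb hbk hp hC0 hM0 hL0 le_rfl) hx).1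
  have hw0 : ∀ n, 0 ≤ w n := fun n => saleWeight_nonneg b hr0.le x n
  refine ⟨isSalesCurve_of_weights hw0 (level_nonneg hη0.le L)
    ((S.sum_saleWeight_le (b := b) (k := k) hC0 x N).trans (hfeas k)), ?_⟩
  intro p hpm q hq
  set j := ⌊p / η⌋₊ with hj
  have hjM : j ≤ M := by
    have : p / η ≤ M := by
      rw [div_le_iff₀ hη0, hη, mul_div_cancel₀ _ hM'.ne']; exact hpm.2
    rw [hj]; exact (Nat.floor_le_floor this).trans (by simp)
  have hjp : j * η ≤ p := by
    rw [← le_div_iff₀ hη0]; exact Nat.floor_le (div_nonneg hpm.1 hη0.le)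
  have hjp' : p - η ≤ j * η := by
    have := Nat.lt_floor_add_one (p / η)
    rw [div_lt_iff₀ hη0] at this
    rw [hj]; linarith
  have hjN : (j + 1) * L ≤ N := Nat.mul_le_mul_right _ (by omega)
  have hsub : Finset.range ((j + 1) * L) = {n ∈ Finset.range N | P n ≤ p} := by
    ext n
    rw [Finset.mem_filter, hP, level_le_iff hL0 hη0 hpm.1, Finset.mem_range, Finset.mem_range]
    exact ⟨fun h => ⟨h.trans_le hjN, h⟩, fun h => h.2⟩
  -- The guarantee is applied to the instance stopped after the last level not above `p`; the
  -- decisions made so far are those made on the full staircase.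
  obtain ⟨hf, hc⟩ := hcomp C (le_max_left _ _) ((j + 1) * L) _ x
    (S.staircase_admissible hb hbk hp hC0 hM0 hL0 hjN) (htrunc C N _ _ x hjN hx)
  have hopt := S.le_optWelfare_staircase ha hs hcost hb hbk hC0 (L := L) (by rw [hL]; omega)
    hη0.le j hq
  have hwel := S.welfare_staircase_le ha hs hcost hC0 (L := L) (η := η) hr0.le hf
  rw [mul_salesRate_sub_salesIntegral, ← Finset.sum_filter, ← hsub]
  have hrate : salesRate N w P p = ∑ n ∈ Finset.range ((j + 1) * L), w n := by
    rw [hsub, Finset.sum_filter]; unfold salesRate; simp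
  rw [hrate]
  have hβ0 : 0 < β := by linarith
  have h1 : (p * q - a * q ^ s) / β - δ / 3 - δ / 3 ≤
      S.optWelfare C ((j + 1) * L) (staircase b r L η) / β := by
    have h2 : (p * q - a * q ^ s) / β - δ / 3 - δ / 3 ≤
        (p * q - a * q ^ s - δ / 3 - δ / 3) / β := by
      have : δ / 3 / β ≤ δ / 3 := div_le_self (by positivity) hβ
      rw [sub_div _ (δ / 3), sub_div _ (δ / 3)]; linarith
    refine h2.trans (div_le_div_of_nonneg_right (le_trans ?_ hopt) hβ0.le)
    have h3 : (p - j * η) * q ≤ η * 1 :=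
      mul_le_mul (by linarith) hq.2 hq.1 hη0.le
    have h4 : j * η * r ≤ S.pbar * r :=
      mul_le_mul_of_nonneg_right (hjp.trans hpm.2) hr0.le
    linarith
  linarith

theorem AlgOutcome.exists_curve [Fintype B] (S : Setup K B) {a s : ℝ} (ha : 0 < a) (hs : 1 < s)
    (hcost : ∀ y ∈ Icc (0 : ℝ) 1, S.cost y = a * y ^ s) (hp : 0 < S.pbar)
    (hsingle : ∃ b k, 0 < S.demand b k ∧ ∀ j, j ≠ k → S.demand b j = 0)
    {A : ℝ → (n : ℕ) → (Fin (n + 1) → B → ℝ) → Option B} {β : ℝ}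
    (hA : S.Competitive (AlgOutcome A) β) {δ : ℝ} (hδ : 0 < δ) :
    ∃ ψ Ψ, IsCompetitiveCurve a s S.pbar β δ ψ Ψ := by
  obtain ⟨b, k, hb, hbk⟩ := hsingle
  obtain ⟨C, -, M, -, -, -, h⟩ := S.exists_staircase ha hs hcost hp hb hbk hA
    (fun C N N' v x hN hx n hn => hx n (hn.trans_le hN)) hδ
  exact ⟨_, _, h _ rfl (fun n => A C n fun i => staircase b _ _ _ i) fun n _ => rfl⟩

/-- Competitiveness quantifies over outcomes, so a run on the staircase must exist before anything
can be extracted from it. -/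
theorem PPM.exists_outcome [Finite B] (S : Setup K B) (φ : ℝ → ℝ) (C : ℝ) (N : ℕ)
    (v : ℕ → B → ℝ) : ∃ x, S.PPM φ C N v x := by
  induction N with
  | zero => exact ⟨fun _ => none, fun n hn => absurd hn (Nat.not_lt_zero n)⟩
  | succ N ih =>
    obtain ⟨x, hx⟩ := ih
    obtain ⟨b, hb⟩ := Finite.exists_max fun o => S.utility C φ (S.usage C x N) (v N) o
    have h0 : 0 ≤ S.utility C φ (S.usage C x N) (v N) b := by
      have := hb none; rwa [utility_none] at this
    classical
    refine ⟨Function.update x N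
      (if ∀ k, S.usage C x N k + S.share C k b ≤ 1 then b else none), fun n hn => ?_⟩
    have hus : ∀ n ≤ N, S.usage C (Function.update x N
        (if ∀ k, S.usage C x N k + S.share C k b ≤ 1 then b else none)) n = S.usage C x n :=
      fun n hn => S.usage_congr C fun i hi => Function.update_of_ne (by omega) _ _
    rw [hus n (by omega)]
    rcases Nat.lt_succ_iff_lt_or_eq.1 hn with hn | rfl
    · rw [Function.update_of_ne hn.ne]; exact hx n hn
    · refine ⟨b, hb, ?_⟩
      rw [Function.update_self]
      split_ifs with h
      · exact Or.inl ⟨h0, h, rfl⟩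
      · push Not at h
        exact Or.inr ⟨Or.inr h, rfl⟩

/-- The utilization in a run of the posted price mechanism on the staircase follows the inverse of
the pricing function. -/
theorem PPM.exists_curve [Fintype B] (S : Setup K B) {a s : ℝ} (ha : 0 < a) (hs : 1 < s)
    (hcost : ∀ y ∈ Icc (0 : ℝ) 1, S.cost y = a * y ^ s) (hp : 0 < S.pbar)
    (hsingle : ∃ b k, 0 < S.demand b k ∧ ∀ j, j ≠ k → S.demand b j = 0)
    {φ : ℝ → ℝ} (hφ : IsPricingFunction φ) {β : ℝ}
    (hA : S.Competitive (S.PPM φ) β) {δ : ℝ} (hδ : 0 < δ) :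
    ∃ ψ Ψ, IsCompetitiveCurve a s S.pbar β δ ψ Ψ ∧
      (∀ y ∈ Icc (0 : ℝ) 1, ∀ p ∈ Icc 0 S.pbar, φ y + δ ≤ p → y + δ ≤ 1 → y ≤ ψ p) ∧
      (∀ y ∈ Icc (0 : ℝ) 1, ∀ p ∈ Icc 0 S.pbar, p < φ y → ψ p ≤ y + δ) := by
  obtain ⟨b, k, hb, hbk⟩ := hsingle
  have htrunc : ∀ C N N' v x, N' ≤ N → S.PPM φ C N v x → S.PPM φ C N' v x :=
    fun C N N' v x hN hx n hn => hx n (hn.trans_le hN)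
  obtain ⟨C, hC, M, hM, hMδ, hrδ, h⟩ := S.exists_staircase ha hs hcost hp hb hbk hA htrunc hδ
  set r := S.demand b k / C with hr
  have hr0 : 0 < r := by positivity
  set L := ⌊1 / r⌋₊ + 1 with hL
  have hL0 : 0 < L := by omega
  set N := (M + 1) * L with hN
  set η := S.pbar / M with hη
  have hM' : (0 : ℝ) < M := by exact_mod_cast hM
  have hη0 : 0 < η := by positivity
  obtain ⟨x, hx⟩ := PPM.exists_outcome S φ C N (staircase b r L η)
  refine ⟨_, _, h L rfl x hx, ?_⟩
  set w := saleWeight b r x with hw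
  set P := level L η with hP
  set z : ℕ → ℝ := fun n => ∑ i ∈ Finset.range n, w i with hz
  have hw0 : ∀ n, 0 ≤ w n := fun n => saleWeight_nonneg b hr0.le x n
  have hzs : ∀ n, z (n + 1) = z n + w n := fun n => Finset.sum_range_succ _ _
  have hz0 : z 0 = 0 := Finset.sum_range_zero _
  have hzmono : Monotone z := monotone_nat_of_le_succ fun n => by rw [hzs]; linarith [hw0 n]
  have hzpos : ∀ n, 0 ≤ z n := fun n => hz0 ▸ hzmono (Nat.zero_le n)
  -- only the bundle `b` is sold
  have honly : ∀ n < N, x n = none ∨ x n = some b := by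
    intro n hn
    obtain ⟨o, ho, h1⟩ := hx n hn
    rcases h1 with ⟨h0, -, h2⟩ | ⟨-, h2⟩
    · rw [h2]
      cases o with
      | none => exact Or.inl rfl
      | some b' =>
        right
        by_contra hne
        have hne' : b' ≠ b := fun h => hne (by rw [h])
        have : 0 ≤ ∑ j, φ (S.usage C x n j) * S.share C j (some b') :=
          Finset.sum_nonneg fun j _ => mul_nonneg
            (hφ.2 _ ⟨S.usage_nonneg hC x n j, PPM.usage_le_one hx hn.le j⟩)
            (S.share_nonneg hC _ _)
        simp only [utility, value, staircase, if_neg hne'] at h0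
        linarith
    · exact Or.inl h2
  have husage : ∀ n ≤ N, S.usage C x n k = z n := by
    intro n hn
    refine Finset.sum_congr rfl fun i hi => ?_
    rw [Finset.mem_range] at hi
    rcases honly i (by omega) with h | h
    · rw [h, hw]; simp [saleWeight, h, share]
    · rw [h, hw]; simp [saleWeight, h, share, hr]
  have hz1 : ∀ n ≤ N, z n ≤ 1 := fun n hn => by
    rw [← husage n hn]; exact PPM.usage_le_one hx hn k
  have hutil : ∀ n ≤ N, S.utility C φ (S.usage C x n) (staircase b r L η n) (some b) =
      (P n - φ (z n)) * r := by
    intro n hn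
    rw [utility, Finset.sum_eq_single k]
    · rw [husage n hn]; simp [value, staircase, share, ← hr, hP]; ring
    · intro j _ hj; simp [share, hbk j hj]
    · simp
  have hbuy : ∀ n < N, φ (z n) < P n → z n + r ≤ 1 → w n = r := by
    intro n hn h1 h2
    have h3 : 0 < S.utility C φ (S.usage C x n) (staircase b r L η n) (some b) := by
      rw [hutil n hn.le]; exact mul_pos (by linarith) hr0
    obtain ⟨o, ho, h4⟩ := hx n hn
    have h5 := h3.trans_le (ho (some b))
    have ho' : o = some b := by
      cases o with
      | none => rw [utility_none] at h5; exact absurd h5 (lt_irrefl _)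
      | some b' =>
        by_contra hne
        have hne' : b' ≠ b := fun h => hne (by rw [h])
        have : 0 ≤ ∑ j, φ (S.usage C x n j) * S.share C j (some b') :=
          Finset.sum_nonneg fun j _ => mul_nonneg
            (hφ.2 _ ⟨S.usage_nonneg hC x n j, PPM.usage_le_one hx hn.le j⟩)
            (S.share_nonneg hC _ _)
        simp only [utility, value, staircase, if_neg hne'] at h5
        linarith
    subst ho'
    rcases h4 with ⟨-, -, h6⟩ | ⟨h6, -⟩
    · rw [hw]; simp [saleWeight, h6]
    · exfalso
      rcases h6 with h6 | ⟨j, hj⟩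
      · linarith
      · by_cases hjk : j = k
        · rw [hjk, husage n hn.le] at hj
          have : S.share C k (some b) = r := rfl
          linarith
        · have : S.share C j (some b) = 0 := by simp [share, hbk j hjk]
          rw [this, add_zero] at hj
          linarith [PPM.usage_le_one hx hn.le j]
  have hnobuy : ∀ n < N, P n < φ (z n) → w n = 0 := by
    intro n hn h1
    rcases honly n hn with h | h
    · rw [hw]; simp [saleWeight, h]
    · exfalso
      obtain ⟨o, ho, ⟨h0, -, h2⟩ | ⟨-, h2⟩⟩ := hx n hn
      · rw [← h2, h, hutil n hn.le] at h0
        nlinarith [mul_neg_of_neg_of_pos (sub_neg.2 h1) hr0]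
      · rw [h] at h2; exact absurd h2 (by simp)
  have hrate : ∀ p ∈ Icc 0 S.pbar, salesRate N w P p = z ((⌊p / η⌋₊ + 1) * L) ∧
      (⌊p / η⌋₊ + 1) * L ≤ N := by
    intro p hpm
    have hjM : ⌊p / η⌋₊ ≤ M := by
      have : p / η ≤ M := by
        rw [div_le_iff₀ hη0, hη, mul_div_cancel₀ _ hM'.ne']; exact hpm.2
      exact (Nat.floor_le_floor this).trans (by simp)
    have hjN : (⌊p / η⌋₊ + 1) * L ≤ N := Nat.mul_le_mul_right _ (by omega)
    refine ⟨?_, hjN⟩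
    have hsub : Finset.range ((⌊p / η⌋₊ + 1) * L) = {n ∈ Finset.range N | P n ≤ p} := by
      ext n
      rw [Finset.mem_filter, hP, level_le_iff hL0 hη0 hpm.1, Finset.mem_range, Finset.mem_range]
      exact ⟨fun h => ⟨h.trans_le hjN, h⟩, fun h => h.2⟩
    simp only [hz]
    rw [hsub, Finset.sum_filter]; unfold salesRate; simp
  constructor
  · intro y hy p hpm hyp hyδ
    obtain ⟨h1, h2⟩ := hrate p hpm
    rw [h1]
    set j := ⌊p / η⌋₊ with hj
    by_contra! hlt
    -- all customers of the last stage buy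
    have hall : ∀ i ≤ L, z (j * L) + i * r ≤ z (j * L + i) := by
      intro i hi
      induction i with
      | zero => simp
      | succ i ih =>
        have ih := ih (by omega)
        have hn : j * L + i < (j + 1) * L := by rw [add_mul]; omega
        have hzn : z (j * L + i) < y := (hzmono hn.le).trans_lt hlt
        have hPn : P (j * L + i) = j * η := by
          have : (j * L + i) / L = j := by
            rw [Nat.div_eq_iff hL0]; constructor
            · linarith
            · omega
          rw [hP, level, this]
        have hjp : p - η < j * η := by
          have := Nat.lt_floor_add_one (p / η)
          rw [div_lt_iff₀ hη0] at this
          rw [hj]; linarith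
        have hφz : φ (z (j * L + i)) ≤ φ y :=
          hφ.1.monotoneOn ⟨hzpos _, hzn.le.trans hy.2⟩ hy hzn.le
        have := hbuy (j * L + i) (by omega) (by rw [hPn]; linarith) (by linarith)
        rw [← add_assoc, hzs, this]
        push_cast
        linarith
    have h3 := hall L le_rfl
    rw [show j * L + L = (j + 1) * L by ring] at h3
    -- A stage has more customers than the whole capacity can serve, so they cannot all have bought.
    have h4 : 1 < L * r := by
      have := Nat.lt_floor_add_one (1 / r)
      rw [div_lt_iff₀ hr0] at this
      rw [hL]; push_cast; exact this
    linarith [hzpos (j * L), hz1 _ h2]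
  · intro y hy p hpm hyp
    obtain ⟨h1, h2⟩ := hrate p hpm
    rw [h1]
    -- Once the utilization exceeds `y` the posted price is above `p` and sales stop, so the
    -- overshoot is at most one bundle.
    have hall : ∀ n ≤ (⌊p / η⌋₊ + 1) * L, z n ≤ y + r := by
      intro n hn
      induction n with
      | zero => rw [hz0]; linarith [hy.1]
      | succ n ih =>
        have ih := ih (by omega)
        rw [hzs]
        by_cases hzy : z n ≤ y
        · have : w n ≤ r := by rw [hw]; unfold saleWeight; split_ifs <;> linarith
          linarith
        · push Not at hzy
          have h3 : φ y ≤ φ (z n) := hφ.1.monotoneOn hy ⟨hzpos _, hz1 n (by omega)⟩ hzy.le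
          have h4 : P n ≤ p := by rw [hP, level_le_iff hL0 hη0 hpm.1]; omega
          rw [hnobuy n (by omega) (by linarith)]
          linarith
    linarith [hall _ le_rfl]

end Setup

/-! ### The constants u_s, α_s^min and α_s(u) -/

section Constants

variable {s : ℝ}

theorem rpow_eq_mul_rpow_sub_one {y : ℝ} (hy : 0 < y) (s : ℝ) : y ^ s = y * y ^ (s - 1) := by
  rw [mul_comm, ← Real.rpow_add_one hy.ne']; ring_nf

theorem rpow_eq_mul_rpow_sub_one' (hs : 1 < s) {y : ℝ} (hy : 0 ≤ y) : y ^ s = y * y ^ (s - 1) := by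
  rcases hy.eq_or_lt with rfl | hy
  · rw [Real.zero_rpow (by linarith), zero_mul]
  · exact rpow_eq_mul_rpow_sub_one hy s

theorem uS_pos (hs : 1 < s) : 0 < uS s := Real.rpow_pos_of_pos (by positivity) _

theorem uS_rpow (hs : 1 < s) : uS s ^ (s - 1) = 1 / s := by
  rw [uS, ← Real.rpow_mul (by positivity), one_div_mul_cancel (by linarith), Real.rpow_one]

theorem uS_lt_one (hs : 1 < s) : uS s < 1 :=
  Real.rpow_lt_one (by positivity) ((div_lt_one (by linarith)).2 hs)
    (one_div_pos.2 (by linarith))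

theorem uS_mul_alphaMin (hs : 1 < s) : uS s * alphaMin s = s := by
  have h0 : (0 : ℝ) < s := by linarith
  rw [uS, alphaMin, one_div, Real.inv_rpow h0.le, ← Real.rpow_neg h0.le, ← Real.rpow_add h0]
  have : -(1 / (s - 1)) + s / (s - 1) = 1 := by
    have : s - 1 ≠ 0 := by linarith
    field_simp; ring
  rw [this, Real.rpow_one]

theorem one_lt_alphaMin (hs : 1 < s) : 1 < alphaMin s :=
  Real.one_lt_rpow hs (div_pos (by linarith) (by linarith))

theorem alphaMin_rpow (hs : 1 < s) : alphaMin s ^ (s - 1) = s ^ s := by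
  rw [alphaMin, ← Real.rpow_mul (by linarith), div_mul_cancel₀ _ (by linarith)]

theorem uS_rpow_self (hs : 1 < s) : uS s ^ s = uS s / s := by
  rw [rpow_eq_mul_rpow_sub_one (uS_pos hs), uS_rpow hs]; ring

/-- This identifies α_s^min with α_s(u_s), the least value of α_s, because u - u^s peaks at u_s. -/
theorem alphaMin_mul (hs : 1 < s) : alphaMin s * (uS s - uS s ^ s) = s - 1 := by
  have := uS_mul_alphaMin hs
  rw [uS_rpow_self hs]
  have h0 : s ≠ 0 := by linarith
  field_simp
  linear_combination (s - 1) * this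

theorem sub_rpow_pos (hs : 1 < s) {u : ℝ} (h0 : 0 < u) (h1 : u < 1) : 0 < u - u ^ s := by
  have : u ^ s < u ^ (1 : ℝ) := Real.rpow_lt_rpow_of_exponent_gt h0 h1 hs
  rw [Real.rpow_one] at this
  linarith

theorem alphaS_mul (hs : 1 < s) {u : ℝ} (h0 : 0 < u) (h1 : u < 1) :
    alphaS s u * (u - u ^ s) = s - 1 :=
  div_mul_cancel₀ _ (sub_rpow_pos hs h0 h1).ne'

theorem alphaS_uS (hs : 1 < s) : alphaS s (uS s) = alphaMin s := by
  rw [alphaS, ← alphaMin_mul hs, mul_div_cancel_right₀]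
  exact (sub_rpow_pos hs (uS_pos hs) (uS_lt_one hs)).ne'

theorem rpow_lt_of_lt_uS (hs : 1 < s) {u : ℝ} (h0 : 0 ≤ u) (h1 : u < uS s) :
    u ^ (s - 1) < 1 / s := by
  rw [← uS_rpow hs]; exact Real.rpow_lt_rpow h0 h1 (by linarith)

/-- By the tangent of the power at `v`, whose slope is at most 1 up to u_s. -/
theorem sub_rpow_lt (hs : 1 < s) {u v : ℝ} (h0 : 0 < u) (huv : u < v) (hv : v ≤ uS s) :
    u - u ^ s < v - v ^ s := by
  have h1 := rpow_tangent_lt hs (h0.trans huv) h0.le huv.ne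
  have h2 : v ^ (s - 1) ≤ 1 / s := by
    rw [← uS_rpow hs]; exact Real.rpow_le_rpow (by linarith) hv (by linarith)
  have h3 : s * v ^ (s - 1) ≤ 1 := by
    rw [le_div_iff₀ (by linarith)] at h2; linarith
  nlinarith [mul_le_mul_of_nonneg_right h3 (sub_nonneg.2 huv.le)]

theorem alphaS_lt (hs : 1 < s) {u v : ℝ} (h0 : 0 < u) (huv : u < v) (hv : v ≤ uS s) :
    alphaS s v < alphaS s u :=
  div_lt_div_of_pos_left (by linarith)
    (sub_rpow_pos hs h0 (huv.trans_le hv |>.trans (uS_lt_one hs))) (sub_rpow_lt hs h0 huv hv)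

theorem alphaOne_of_le (hs : 1 < s) {u : ℝ} (h : u ≤ uS s) : alphaOne s u = alphaS s u := by
  unfold alphaOne
  split_ifs with h'
  · rfl
  · rw [le_antisymm h (not_lt.1 h'), alphaS_uS hs]

theorem alphaOne_of_ge {u : ℝ} (h : uS s ≤ u) : alphaOne s u = alphaMin s :=
  if_neg (not_lt.2 h)

theorem alphaOne_anti (hs : 1 < s) {u v : ℝ} (h0 : 0 < u) (huv : u ≤ v) :
    alphaOne s v ≤ alphaOne s u := by
  rcases huv.eq_or_lt with rfl | huv
  · exact le_rfl
  rcases le_total v (uS s) with hv | hv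
  · rw [alphaOne_of_le hs hv, alphaOne_of_le hs (huv.le.trans hv)]
    exact (alphaS_lt hs h0 huv hv).le
  · rw [alphaOne_of_ge hv]
    rcases lt_or_ge u (uS s) with hu | hu
    · rw [alphaOne_of_le hs hu.le, ← alphaS_uS hs]
      exact (alphaS_lt hs h0 hu le_rfl).le
    · rw [alphaOne_of_ge hu]

theorem alphaMin_le_alphaOne (hs : 1 < s) {u : ℝ} (h0 : 0 < u) : alphaMin s ≤ alphaOne s u := by
  rcases le_total u (uS s) with hu | hu
  · rw [← alphaOne_of_ge (le_refl (uS s))]; exact alphaOne_anti hs h0 hu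
  · rw [alphaOne_of_ge hu]

theorem alphaOne_pos (hs : 1 < s) {u : ℝ} (h0 : 0 < u) : 0 < alphaOne s u := by
  linarith [alphaMin_le_alphaOne hs h0, one_lt_alphaMin hs]

end Constants

/-! ### The surplus and its Grönwall inequality -/

section Calculus

/-- Only right derivatives are available, because the sales curve jumps and its integral has
corners. -/
theorem le_of_deriv_right_nonneg {f : ℝ → ℝ} {l h : ℝ} (hlh : l ≤ h)
    (hf : ContinuousOn f (Icc l h))
    (hf' : ∀ x ∈ Ico l h, ∃ d, 0 ≤ d ∧ HasDerivWithinAt f d (Ici x) x) : f l ≤ f h := by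
  choose! d hd hfd using hf'
  exact image_le_of_deriv_right_le_deriv_boundary (f := fun _ => f l) (f' := fun _ => 0)
    continuousOn_const (fun x _ => hasDerivWithinAt_const _ _ _) le_rfl hf hfd hd ⟨hlh, le_rfl⟩

end Calculus

/-- The difference between the integrals of a sales curve and of the inverse of `φ`, at the price
`φ y`, where `F` is a primitive of `φ`. -/
def surplus (Ψ φ F : ℝ → ℝ) (y : ℝ) : ℝ := Ψ (φ y) - y * φ y + F y

/-- The terms with F' = φ cancel. Monotonicity of `φ` is needed to transport the right derivative of
`Ψ` through the composition. -/
theorem surplus_hasDerivWithinAt {ψ Ψ φ F : ℝ → ℝ} (hΨ : IsSalesCurve ψ Ψ) {l h y d : ℝ}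
    (hφ : MonotoneOn φ (Icc l h)) (hy : y ∈ Ico l h) (hd : HasDerivAt φ d y)
    (hF : HasDerivAt F (φ y) y) :
    HasDerivWithinAt (surplus Ψ φ F) (d * (ψ (φ y) - y)) (Ici y) y := by
  have hmaps : MapsTo φ (Icc y h) (Ici (φ y)) := fun z hz =>
    hφ ⟨hy.1, hy.2.le⟩ ⟨hy.1.trans hz.1, hz.2⟩ hz.1
  have h1 : HasDerivWithinAt (Ψ ∘ φ) (ψ (φ y) * d) (Ici y) y :=
    ((hΨ.deriv_right (φ y)).comp y hd.hasDerivWithinAt hmaps).mono_of_mem_nhdsWithin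
      (Icc_mem_nhdsGE hy.2)
  have h2 := (h1.sub ((hasDerivWithinAt_id y _).mul (hd.hasDerivWithinAt (s := Ici y)))).add
    (hF.hasDerivWithinAt (s := Ici y))
  refine (h2.congr_deriv ?_)
  simp; ring

/-- The competitive constraint at price `φ y` is combined with the tangent of the cost at `y`. The
right-hand side is the derivative of the surplus up to the factor φ' / (φ - f'), so this is a
Grönwall inequality; `q` is the quantity that attains the conjugate. -/
theorem surplus_le {a s pbar α β δ : ℝ} {ψ Ψ φ F : ℝ → ℝ} (ha : 0 < a) (hs : 1 < s)
    (h : IsCompetitiveCurve a s pbar β δ ψ Ψ) {y q : ℝ} (hy : 0 ≤ y) (hq : q ∈ Icc (0 : ℝ) 1)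
    (hφ : φ y ∈ Icc 0 pbar) (hF : φ y * q - a * q ^ s = α * (F y - a * y ^ s)) :
    surplus Ψ φ F y - δ + (α / β - 1) * (F y - a * y ^ s) ≤
      (φ y - a * s * y ^ (s - 1)) * (ψ (φ y) - y) := by
  have h1 := h.2 _ hφ q hq
  rw [hF] at h1
  have h2 := mul_le_mul_of_nonneg_left (rpow_tangent_le hs hy (h.1.nonneg (φ y))) ha.le
  rw [mul_div_right_comm] at h1
  unfold surplus
  linarith

/-! ### Prices f'(y/μ) and the lower bound α_s^min -/

section PowerSegment

variable {a s : ℝ}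

theorem marginalCost_hasDerivAt {μ y : ℝ} (hμ : 0 < μ) (hy : 0 < y) :
    HasDerivAt (fun y => marginalCost a s (y / μ)) ((s - 1) * marginalCost a s (y / μ) / y) y := by
  have h1 : HasDerivAt (fun y => y / μ) (1 / μ) y := (hasDerivAt_id y).div_const μ
  have h2 := ((h1.rpow_const (p := s - 1) (Or.inl (by positivity))).const_mul (a * s))
  unfold marginalCost
  refine h2.congr_deriv ?_
  rw [rpow_eq_mul_rpow_sub_one (y := y / μ) (by positivity) (s - 1)]
  field_simp

theorem powerPotential_hasDerivAt {μ y : ℝ} (hμ : 0 < μ) (hy : 0 < y) :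
    HasDerivAt (fun y => a * μ * (y / μ) ^ s) (marginalCost a s (y / μ)) y := by
  have h1 : HasDerivAt (fun y => y / μ) (1 / μ) y := (hasDerivAt_id y).div_const μ
  have h2 := ((h1.rpow_const (p := s) (Or.inl (by positivity))).const_mul (a * μ))
  unfold marginalCost
  refine h2.congr_deriv ?_
  field_simp

theorem marginalCost_nonneg (ha : 0 < a) (hs : 1 < s) {y : ℝ} (hy : 0 ≤ y) :
    0 ≤ marginalCost a s y :=
  mul_nonneg (mul_nonneg ha.le (by linarith)) (Real.rpow_nonneg hy _)

theorem marginalCost_strictMonoOn (ha : 0 < a) (hs : 1 < s) {μ : ℝ} (hμ : 0 < μ) :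
    StrictMonoOn (fun y => marginalCost a s (y / μ)) (Ici 0) := fun y hy z _ hyz =>
  mul_lt_mul_of_pos_left (Real.rpow_lt_rpow (div_nonneg hy hμ.le)
    (div_lt_div_of_pos_right hyz hμ) (by linarith)) (mul_pos ha (by linarith))

theorem mul_marginalCost_div (hs : 1 < s) {μ y : ℝ} (hμ : 0 < μ) (hy : 0 ≤ y) :
    y * marginalCost a s (y / μ) = s * (a * μ * (y / μ) ^ s) := by
  rw [marginalCost, rpow_eq_mul_rpow_sub_one' hs (div_nonneg hy hμ.le)]
  field_simp

theorem marginalCost_continuous (hs : 1 < s) (μ : ℝ) :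
    Continuous fun y => marginalCost a s (y / μ) := by
  unfold marginalCost
  exact continuous_const.mul ((continuous_id.div_const μ).rpow_const fun _ => Or.inr (by linarith))

theorem powerPotential_continuous (hs : 1 < s) (μ : ℝ) :
    Continuous fun y : ℝ => a * μ * (y / μ) ^ s :=
  continuous_const.mul ((continuous_id.div_const μ).rpow_const fun _ => Or.inr (by linarith))

theorem powerPotential_sub {μ y : ℝ} (hμ : 0 < μ) (hy : 0 ≤ y) :
    a * μ * (y / μ) ^ s - a * y ^ s = a * (μ - μ ^ s) * (y / μ) ^ s := by
  rw [Real.div_rpow hy hμ.le]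
  have := (Real.rpow_pos_of_pos hμ s).ne'
  field_simp

theorem surplus_continuousOn_power {ψ Ψ : ℝ → ℝ} (hs : 1 < s) (hΨ : IsSalesCurve ψ Ψ) (μ : ℝ) :
    Continuous (surplus Ψ (fun y => marginalCost a s (y / μ))
      (fun y => a * μ * (y / μ) ^ s)) :=
  ((hΨ.cont.comp (marginalCost_continuous hs μ)).sub
    (continuous_id.mul (marginalCost_continuous hs μ))).add (powerPotential_continuous hs μ)

/-- The growth of the surplus where `φ y = f' (y / μ)`. -/
theorem power_surplus_deriv {pbar α β δ μ y : ℝ} {ψ Ψ : ℝ → ℝ} (ha : 0 < a) (hs : 1 < s)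
    (h : IsCompetitiveCurve a s pbar β δ ψ Ψ) (hμ : 0 < μ) (hμ1 : μ < 1)
    (hα : α * (μ - μ ^ s) = s - 1) (hy : 0 < y) (hyμ : y ≤ μ)
    (hφ : marginalCost a s (y / μ) ≤ pbar) :
    ∃ d, (s - 1) / (1 - μ ^ (s - 1)) * (α / β - 1) * (a * (μ - μ ^ s) * (y / μ) ^ s) *
          y ^ (-((s - 1) / (1 - μ ^ (s - 1))) - 1) ≤ d ∧
      HasDerivWithinAt (fun y => y ^ (-((s - 1) / (1 - μ ^ (s - 1)))) *
        (surplus Ψ (fun y => marginalCost a s (y / μ)) (fun y => a * μ * (y / μ) ^ s) y - δ))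
        d (Ici y) y := by
  set κ := μ ^ (s - 1) with hκ
  have hκ1 : κ < 1 := Real.rpow_lt_one hμ.le hμ1 (by linarith)
  set e := (s - 1) / (1 - κ) with he
  have he0 : 0 < e := div_pos (by linarith) (by linarith)
  set φ : ℝ → ℝ := fun y => marginalCost a s (y / μ) with hφd
  set F : ℝ → ℝ := fun y => a * μ * (y / μ) ^ s with hFd
  have hmono : MonotoneOn φ (Icc 0 (y + 1)) :=
    (marginalCost_strictMonoOn ha hs hμ).monotoneOn.mono Icc_subset_Ici_self
  have h1 := surplus_hasDerivWithinAt h.1 hmono ⟨hy.le, by linarith⟩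
    (marginalCost_hasDerivAt hμ hy) (powerPotential_hasDerivAt hμ hy)
  have h2 : HasDerivWithinAt (fun y : ℝ => y ^ (-e)) (-e * y ^ (-e - 1)) (Ici y) y :=
    (Real.hasDerivAt_rpow_const (Or.inl hy.ne')).hasDerivWithinAt
  have h3 := h2.mul (h1.sub_const δ)
  refine ⟨_, ?_, h3⟩
  have hq : y / μ ∈ Icc (0 : ℝ) 1 := ⟨by positivity, (div_le_one hμ).2 hyμ⟩
  have h4 := surplus_le (α := α) (φ := φ) (F := F) ha hs h hy.le hq
    ⟨marginalCost_nonneg ha hs hq.1, hφ⟩ (by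
      simp only [hφd, hFd]
      rw [powerPotential_sub hμ hy.le, marginalCost, rpow_eq_mul_rpow_sub_one (y := y / μ)
        (by positivity) s]
      linear_combination -(a * (y / μ * (y / μ) ^ (s - 1))) * hα)
  have h5 : F y - a * y ^ s = a * (μ - μ ^ s) * (y / μ) ^ s := powerPotential_sub hμ hy.le
  have h6 : φ y - a * s * y ^ (s - 1) = (1 - κ) * φ y := by
    simp only [hφd, marginalCost, hκ]
    rw [Real.div_rpow hy.le hμ.le]
    have := (Real.rpow_pos_of_pos hμ (s - 1)).ne'
    field_simp
  rw [h5, h6] at h4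
  have h7 : y ^ (-e) = y * y ^ (-e - 1) := rpow_eq_mul_rpow_sub_one hy _
  have h8 : 0 ≤ y ^ (-e - 1) := Real.rpow_nonneg hy.le _
  have h9 : (s - 1) = e * (1 - κ) := by
    rw [he, div_mul_cancel₀]; linarith
  have h10 := mul_le_mul_of_nonneg_left (mul_le_mul_of_nonneg_left h4 he0.le) h8
  change _ ≤ -e * y ^ (-e - 1) * (surplus Ψ φ F y - δ) +
    y ^ (-e) * ((s - 1) * φ y / y * (ψ (φ y) - y))
  have h11 : y ^ (-e) * ((s - 1) * φ y / y * (ψ (φ y) - y)) =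
      y ^ (-e - 1) * (e * ((1 - κ) * φ y * (ψ (φ y) - y))) := by
    rw [h7, h9]; field_simp
  rw [h11]
  -- Here φ' = (s-1) φ / y and φ - f' = (1-κ) φ, so the Grönwall factor is e / y with e = (s-1) /
  -- (1-κ), which the integrating factor y^(-e) absorbs.
  linarith

/-- The a priori bound that starts the Grönwall argument near 0: the surplus is at least of order
-y^s, since `Ψ` is nonnegative. -/
theorem neg_le_power_surplus {μ y : ℝ} {ψ Ψ : ℝ → ℝ} (ha : 0 < a) (hs : 1 < s)
    (h : IsSalesCurve ψ Ψ) (hμ : 0 < μ) (hy : 0 ≤ y) :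
    -(s * (a * μ * (y / μ) ^ s)) ≤
      surplus Ψ (fun y => marginalCost a s (y / μ)) (fun y => a * μ * (y / μ) ^ s) y := by
  have h1 := h.integral_nonneg (marginalCost_nonneg ha hs (div_nonneg hy hμ.le))
  have h2 : 0 ≤ a * μ * (y / μ) ^ s := by positivity
  unfold surplus
  rw [mul_marginalCost_div hs hμ hy]
  linarith

theorem power_surplus_le {μ y : ℝ} {ψ Ψ : ℝ → ℝ} (ha : 0 < a) (hs : 1 < s)
    (h : IsSalesCurve ψ Ψ) (hμ : 0 < μ) (hy : 0 ≤ y) :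
    surplus Ψ (fun y => marginalCost a s (y / μ)) (fun y => a * μ * (y / μ) ^ s) y ≤
      marginalCost a s (y / μ) := by
  have h1 := h.integral_le (marginalCost_nonneg ha hs (div_nonneg hy hμ.le))
  have h2 : 0 ≤ a * μ * (y / μ) ^ s := by positivity
  unfold surplus
  rw [mul_marginalCost_div hs hμ hy]
  nlinarith

end PowerSegment

/-- For `β < α_s^min` the sales curves of `β`-competitive mechanisms do not exist. -/
theorem not_competitiveCurve_of_lt_alphaMin {a s pbar β : ℝ} (ha : 0 < a) (hs : 1 < s)
    (hp : 0 < pbar) (hβ : 1 ≤ β) (hβα : β < alphaMin s) :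
    ∃ δ > 0, ∀ ψ Ψ, ¬ IsCompetitiveCurve a s pbar β δ ψ Ψ := by
  set μ := uS s with hμd
  have hμ : 0 < μ := uS_pos hs
  have hμ1 : μ < 1 := uS_lt_one hs
  -- At μ = u_s the exponent of the integrating factor equals that of the forcing term, so their
  -- product is a multiple of 1 / y and integrates to a logarithm.
  have he : (s - 1) / (1 - μ ^ (s - 1)) = s := by
    have : s - 1 ≠ 0 := by linarith
    have : s ≠ 0 := by linarith
    rw [hμd, uS_rpow hs]; field_simp
  have has : 0 < a * s := mul_pos ha (by linarith)
  obtain ⟨w, hw0, hwμ, hwp⟩ : ∃ w, 0 < w ∧ w ≤ μ ∧ marginalCost a s (w / μ) ≤ pbar := by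
    have hi : 0 < invMarginalCost a s pbar := Real.rpow_pos_of_pos (by positivity) _
    refine ⟨μ * min 1 (invMarginalCost a s pbar), by positivity, ?_, ?_⟩
    · exact mul_le_of_le_one_right hμ.le (min_le_left _ _)
    · rw [mul_div_cancel_left₀ _ hμ.ne', marginalCost]
      have h1 : min 1 (invMarginalCost a s pbar) ^ (s - 1) ≤ pbar / (a * s) := by
        refine (Real.rpow_le_rpow (by positivity) (min_le_right _ _) (by linarith)).trans ?_
        rw [invMarginalCost, ← Real.rpow_mul (by positivity), one_div_mul_cancel (by linarith),
          Real.rpow_one]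
      rw [le_div_iff₀ has] at h1
      linarith
  have hγ : 0 < alphaMin s / β - 1 := by
    rw [sub_pos, lt_div_iff₀ (by linarith)]; linarith
  set c := s * (alphaMin s / β - 1) * (a * (μ - μ ^ s)) * μ ^ (-s) with hc
  have hc0 : 0 < c := by
    have h1 := sub_rpow_pos hs hμ hμ1
    have h2 := Real.rpow_pos_of_pos hμ (-s)
    have h3 : 0 < s := by linarith
    positivity
  set X := w ^ (-s) * marginalCost a s (w / μ) - c * Real.log w + s * (a * μ * μ ^ (-s)) + 1
    with hX
  -- `X` gathers the a priori bounds at both ends of `[y₀, w]`; a small `y₀` makes the logarithmic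
  -- growth exceed it. The summand 1 in `X` pays for the error δ = y₀^s, scaled by y₀^(-s).
  obtain ⟨y₀, hy0, hy0w, hy0X⟩ : ∃ y₀, 0 < y₀ ∧ y₀ ≤ w ∧ X < -(c * Real.log y₀) := by
    refine ⟨min w (Real.exp (-(X + 1) / c)), by positivity, min_le_left _ _, ?_⟩
    have h1 : Real.log (min w (Real.exp (-(X + 1) / c))) ≤ -(X + 1) / c := by
      rw [← Real.log_exp (-(X + 1) / c)]
      refine Real.log_le_log (by positivity) ?_
      rw [Real.log_exp]; exact min_le_right _ _
    have h2 := mul_le_mul_of_nonneg_left h1 hc0.le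
    rw [mul_div_cancel₀ _ hc0.ne'] at h2
    linarith
  refine ⟨y₀ ^ s, Real.rpow_pos_of_pos hy0 s, fun ψ Ψ h => ?_⟩
  set φ : ℝ → ℝ := fun y => marginalCost a s (y / μ) with hφ
  set F : ℝ → ℝ := fun y => a * μ * (y / μ) ^ s with hF
  have hgrow : (fun y => y ^ (-s) * (surplus Ψ φ F y - y₀ ^ s) - c * Real.log y) y₀ ≤
      (fun y => y ^ (-s) * (surplus Ψ φ F y - y₀ ^ s) - c * Real.log y) w := by
    refine le_of_deriv_right_nonneg
      (f := fun y => y ^ (-s) * (surplus Ψ φ F y - y₀ ^ s) - c * Real.log y) hy0w ?_ ?_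
    · have h1 := surplus_continuousOn_power (a := a) hs h.1 μ
      refine ContinuousOn.sub (ContinuousOn.mul ?_ (h1.continuousOn.sub continuousOn_const))
        (ContinuousOn.mul continuousOn_const ?_)
      · exact fun y hy => ((Real.continuousAt_rpow_const _ _
          (Or.inl (hy0.trans_le hy.1).ne')).continuousWithinAt)
      · exact fun y hy => (Real.continuousAt_log (hy0.trans_le hy.1).ne').continuousWithinAt
    · intro y hy
      have hypos : 0 < y := hy0.trans_le hy.1
      obtain ⟨d, hd, hderiv⟩ := power_surplus_deriv ha hs h hμ hμ1 (alphaMin_mul hs) hypos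
        (hy.2.le.trans hwμ)
        (((marginalCost_strictMonoOn ha hs hμ).monotoneOn hypos.le hw0.le hy.2.le).trans hwp)
      rw [he] at hd hderiv
      refine ⟨_, ?_, hderiv.sub
        (((Real.hasDerivAt_log hypos.ne').const_mul c).hasDerivWithinAt (s := Ici y))⟩
      refine sub_nonneg.2 (le_trans (le_of_eq ?_) hd)
      rw [Real.div_rpow hypos.le hμ.le, hc, Real.rpow_sub_one hypos.ne', Real.rpow_neg hypos.le,
        Real.rpow_neg hμ.le]
      have h1 := (Real.rpow_pos_of_pos hypos s).ne'
      have h2 := (Real.rpow_pos_of_pos hμ s).ne'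
      field_simp
  have h1 := neg_le_power_surplus ha hs h.1 hμ hy0.le
  have h2 := power_surplus_le ha hs h.1 hμ hw0.le
  change -(s * (a * μ * (y₀ / μ) ^ s)) ≤ surplus Ψ φ F y₀ at h1
  change surplus Ψ φ F w ≤ _ at h2
  simp only at hgrow
  have h3 : 0 < y₀ ^ (-s) := Real.rpow_pos_of_pos hy0 _
  have h4 : 0 < w ^ (-s) := Real.rpow_pos_of_pos hw0 _
  have h5 : y₀ ^ (-s) * y₀ ^ s = 1 := by
    rw [Real.rpow_neg hy0.le, inv_mul_cancel₀ (Real.rpow_pos_of_pos hy0 s).ne']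
  have h6 : y₀ ^ (-s) * (s * (a * μ * (y₀ / μ) ^ s)) = s * (a * μ * μ ^ (-s)) := by
    rw [Real.div_rpow hy0.le hμ.le, Real.rpow_neg hμ.le]
    have h2 := (Real.rpow_pos_of_pos hμ s).ne'
    field_simp
    linear_combination h5
  have h7 := mul_le_mul_of_nonneg_left h1 h3.le
  have h8 := mul_le_mul_of_nonneg_left h2 h4.le
  have h9 : 0 < w ^ (-s) * y₀ ^ s := mul_pos h4 (Real.rpow_pos_of_pos hy0 s)
  linarith

theorem Setup.not_competitive_of_lt_alphaMin {K B : Type*} [Fintype K] [Fintype B]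
    (S : Setup K B) {a s : ℝ} (ha : 0 < a) (hs : 1 < s)
    (hcost : ∀ y ∈ Icc (0 : ℝ) 1, S.cost y = a * y ^ s) (hp : 0 < S.pbar)
    (hsingle : ∃ b k, 0 < S.demand b k ∧ ∀ j, j ≠ k → S.demand b j = 0) {β : ℝ} (hβ : 1 ≤ β)
    (hβα : β < alphaMin s) : ¬ ∃ A, S.Competitive (AlgOutcome A) β := by
  rintro ⟨A, hA⟩
  obtain ⟨δ, hδ, h⟩ := not_competitiveCurve_of_lt_alphaMin ha hs hp hβ hβα
  obtain ⟨ψ, Ψ, hψ⟩ := AlgOutcome.exists_curve S ha hs hcost hp hsingle hA hδ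
  exact h ψ Ψ hψ

/-! ### The initial value problem above f'(1), and critical dividing thresholds -/

section Ivp

variable {a s : ℝ}

theorem gammaInt_integrand_continuous (hs : 1 < s) :
    Continuous fun η : ℝ => η ^ (s - 1) * Real.exp (-η) :=
  (continuous_id.rpow_const fun _ => Or.inr (by linarith)).mul
    (Real.continuous_exp.comp continuous_neg)

theorem gammaInt_symm (s x z : ℝ) : gammaInt s x z = -gammaInt s z x :=
  intervalIntegral.integral_symm _ _

theorem gammaInt_hasDerivAt_left (hs : 1 < s) (x z : ℝ) :
    HasDerivAt (fun x => gammaInt s x z) (-(x ^ (s - 1) * Real.exp (-x))) x :=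
  intervalIntegral.integral_hasDerivAt_left
    ((gammaInt_integrand_continuous hs).intervalIntegrable _ _)
    ((gammaInt_integrand_continuous hs).stronglyMeasurableAtFilter _ _)
    (gammaInt_integrand_continuous hs).continuousAt

theorem gammaInt_continuous (hs : 1 < s) : Continuous fun q : ℝ × ℝ => gammaInt s q.1 q.2 := by
  have h : Continuous fun x : ℝ => gammaInt s x 0 :=
    continuous_iff_continuousAt.2 fun x => (gammaInt_hasDerivAt_left hs x 0).continuousAt
  have e : (fun q : ℝ × ℝ => gammaInt s q.1 q.2) =
      fun q : ℝ × ℝ => gammaInt s q.1 0 - gammaInt s q.2 0 := by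
    ext q
    rw [gammaInt_symm s q.2 0, sub_neg_eq_add]
    exact (intervalIntegral.integral_add_adjacent_intervals
      ((gammaInt_integrand_continuous hs).intervalIntegrable _ _)
      ((gammaInt_integrand_continuous hs).intervalIntegrable _ _)).symm
  rw [e]
  exact (h.comp continuous_fst).sub (h.comp continuous_snd)

/-- The formula is variation of constants for this linear equation; the substitution η = αy produces
the incomplete gamma integral. -/
theorem phiIvp_hasDerivAt (hs : 1 < s) {u y : ℝ} (hu : 0 < u) (hy : 0 ≤ y) :
    HasDerivAt (fun y => phiIvp a s y u)
      (alphaOne s u * (phiIvp a s y u - marginalCost a s y)) y := by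
  unfold phiIvp
  set α := alphaOne s u with hα
  have hα0 : 0 < α := alphaOne_pos hs hu
  have h1 : HasDerivAt (fun y => y * α) α y := by simpa using (hasDerivAt_id y).mul_const α
  have h2 : HasDerivAt (fun y => gammaInt s (y * α) (α * u))
      (-((y * α) ^ (s - 1) * Real.exp (-(y * α))) * α) y :=
    HasDerivAt.comp y (h₂ := fun x => gammaInt s x (α * u))
      (gammaInt_hasDerivAt_left hs (y * α) (α * u)) h1
  have h3 := ((h1.exp.div_const (α ^ (s - 1))).const_mul (a * s)).mul h2
  have h4 : HasDerivAt (fun y => (y - u) * α) α y := by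
    simpa using ((hasDerivAt_id y).sub_const u).mul_const α
  refine (h3.add (h4.exp.const_mul (a * s))).congr_deriv ?_
  rw [Real.mul_rpow hy hα0.le, Real.exp_neg, marginalCost]
  have h5 := (Real.rpow_pos_of_pos hα0 (s - 1)).ne'
  have h6 := (Real.exp_pos (y * α)).ne'
  field_simp
  ring

theorem phiIvp_self (a s u : ℝ) : phiIvp a s u u = a * s := by
  unfold phiIvp gammaInt
  rw [mul_comm u (alphaOne s u), intervalIntegral.integral_same]
  simp

theorem phiIvp_continuousOn (hs : 1 < s) {u : ℝ} (hu : 0 < u) :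
    ContinuousOn (fun y => phiIvp a s y u) (Ici 0) := fun _ hy =>
  (phiIvp_hasDerivAt hs hu hy).continuousAt.continuousWithinAt

theorem marginalCost_le (ha : 0 < a) (hs : 1 < s) {y : ℝ} (h0 : 0 ≤ y) (h1 : y ≤ 1) :
    marginalCost a s y ≤ a * s :=
  mul_le_of_le_one_right (mul_pos ha (by linarith)).le (Real.rpow_le_one h0 h1 (by linarith))

theorem marginalCost_lt (ha : 0 < a) (hs : 1 < s) {y : ℝ} (h0 : 0 ≤ y) (h1 : y < 1) :
    marginalCost a s y < a * s :=
  mul_lt_of_lt_one_right (mul_pos ha (by linarith)) (Real.rpow_lt_one h0 h1 (by linarith))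

/-- The constant f'(1) is a subsolution on [u, 1], since f' ≤ f'(1) there. -/
theorem le_phiIvp (ha : 0 < a) (hs : 1 < s) {u y : ℝ} (hu : 0 < u) (huy : u ≤ y) (hy : y ≤ 1) :
    a * s ≤ phiIvp a s y u := by
  set α := alphaOne s u with hα
  have hα0 : 0 < α := alphaOne_pos hs hu
  have h := le_of_deriv_right_nonneg
    (f := fun y => Real.exp (-(α * y)) * (phiIvp a s y u - a * s)) huy ?_ ?_
  · simp only [phiIvp_self, sub_self, mul_zero] at h
    have := nonneg_of_mul_nonneg_right h (Real.exp_pos _)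
    linarith
  · exact ContinuousOn.mul (by fun_prop) (((phiIvp_continuousOn hs hu).mono
      fun z hz => hu.le.trans hz.1).sub continuousOn_const)
  · intro z hz
    have hz0 : 0 ≤ z := hu.le.trans hz.1
    have h1 : HasDerivAt (fun y => -(α * y)) (-α) z := by
      simpa using ((hasDerivAt_id z).const_mul α).fun_neg
    refine ⟨_, ?_, (h1.exp.mul ((phiIvp_hasDerivAt hs hu hz0).sub_const
      (a * s))).hasDerivWithinAt⟩
    have h2 : 0 ≤ Real.exp (-(α * z)) * (α * (a * s - marginalCost a s z)) :=
      mul_nonneg (Real.exp_pos _).le (mul_nonneg hα0.le (sub_nonneg.2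
        (marginalCost_le ha hs hz0 (hz.2.le.trans hy))))
    rw [← hα]
    linarith

theorem marginalCost_lt_phiIvp (ha : 0 < a) (hs : 1 < s) {u y : ℝ} (hu : 0 < u) (huy : u ≤ y)
    (hy : y < 1) : marginalCost a s y < phiIvp a s y u :=
  (marginalCost_lt ha hs (hu.le.trans huy) hy).trans_le (le_phiIvp ha hs hu huy hy.le)

theorem phiIvp_strictMonoOn (ha : 0 < a) (hs : 1 < s) {u : ℝ} (hu : 0 < u) :
    StrictMonoOn (fun y => phiIvp a s y u) (Icc u 1) := by
  refine strictMonoOn_of_deriv_pos (convex_Icc u 1)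
    ((phiIvp_continuousOn hs hu).mono fun z hz => hu.le.trans hz.1) fun y hy => ?_
  rw [interior_Icc] at hy
  rw [(phiIvp_hasDerivAt hs hu (hu.le.trans hy.1.le)).deriv]
  exact mul_pos (alphaOne_pos hs hu) (sub_pos.2 (marginalCost_lt_phiIvp ha hs hu hy.1.le hy.2))

/-- A smaller threshold starts rising earlier and at no smaller rate α₁. The difference is already
positive at `u'`, and multiplied by exp(-α'y) it does not decrease. -/
theorem phiIvp_lt_phiIvp (ha : 0 < a) (hs : 1 < s) {u u' y : ℝ} (hu : 0 < u) (huu : u < u')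
    (huy : u' ≤ y) (hy : y ≤ 1) : phiIvp a s y u' < phiIvp a s y u := by
  have hu' : 0 < u' := hu.trans huu
  set α := alphaOne s u with hα
  set α' := alphaOne s u' with hα'
  have hα0 : 0 < α' := alphaOne_pos hs hu'
  have hαα : α' ≤ α := alphaOne_anti hs hu huu.le
  have h := le_of_deriv_right_nonneg
    (f := fun y => Real.exp (-(α' * y)) * (phiIvp a s y u - phiIvp a s y u')) huy ?_ ?_
  · have h0 : phiIvp a s u u < phiIvp a s u' u := phiIvp_strictMonoOn ha hs hu
      ⟨le_rfl, huu.le.trans (huy.trans hy)⟩ ⟨huu.le, huy.trans hy⟩ huu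
    rw [phiIvp_self] at h0
    have h1 := (mul_pos (Real.exp_pos (-(α' * u'))) (sub_pos.2 h0)).trans_le
      (by simpa only [phiIvp_self] using h)
    exact sub_pos.1 (pos_of_mul_pos_right h1 (Real.exp_pos _).le)
  · exact ContinuousOn.mul (by fun_prop)
      (((phiIvp_continuousOn hs hu).mono fun z hz => hu'.le.trans hz.1).sub
      ((phiIvp_continuousOn hs hu').mono fun z hz => hu'.le.trans hz.1))
  · intro z hz
    have hz0 : 0 ≤ z := hu'.le.trans hz.1
    have h1 : HasDerivAt (fun y => -(α' * y)) (-α') z := by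
      simpa using ((hasDerivAt_id z).const_mul α').fun_neg
    refine ⟨_, ?_, (h1.exp.mul ((phiIvp_hasDerivAt hs hu hz0).sub
      (phiIvp_hasDerivAt hs hu' hz0))).hasDerivWithinAt⟩
    have h2 : 0 ≤ Real.exp (-(α' * z)) *
        ((α - α') * (phiIvp a s z u - marginalCost a s z)) :=
      mul_nonneg (Real.exp_pos _).le (mul_nonneg (sub_nonneg.2 hαα) (sub_nonneg.2
        (marginalCost_lt_phiIvp ha hs hu (huu.le.trans hz.1) (hz.2.trans_le hy)).le))
    rw [← hα, ← hα']
    simp only [Pi.sub_apply]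
    linarith

theorem phiIvp_one_continuousOn_of (hs : 1 < s) {I : Set ℝ} (hI : ∀ u ∈ I, 0 < u)
    (hα : ContinuousOn (alphaOne s) I) : ContinuousOn (fun u => phiIvp a s 1 u) I := by
  have hg : ContinuousOn (fun u => gammaInt s (1 * alphaOne s u) (alphaOne s u * u)) I :=
    (gammaInt_continuous hs).comp_continuousOn
      ((continuousOn_const.mul hα).prodMk (hα.mul continuousOn_id))
  unfold phiIvp
  refine ((continuousOn_const.mul (ContinuousOn.div ?_ ?_ ?_)).mul hg).add
    (continuousOn_const.mul ?_)
  · exact Real.continuous_exp.comp_continuousOn (continuousOn_const.mul hα)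
  · exact hα.rpow_const fun u _ => Or.inr (by linarith)
  · exact fun u hu => (Real.rpow_pos_of_pos (alphaOne_pos hs (hI u hu)) _).ne'
  · exact Real.continuous_exp.comp_continuousOn
      ((continuousOn_const.sub continuousOn_id).mul hα)

theorem phiIvp_one_continuousOn_Icc (hs : 1 < s) :
    ContinuousOn (fun u => phiIvp a s 1 u) (Icc (uS s) 1) :=
  phiIvp_one_continuousOn_of hs (fun _ hu => (uS_pos hs).trans_le hu.1)
    (continuousOn_const.congr fun _ hu => alphaOne_of_ge hu.1)

theorem phiIvp_one_continuousOn_Ioc (hs : 1 < s) :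
    ContinuousOn (fun u => phiIvp a s 1 u) (Ioc 0 (uS s)) := by
  refine phiIvp_one_continuousOn_of hs (fun _ hu => hu.1) ?_
  refine ContinuousOn.congr (f := alphaS s) ?_ fun _ hu => alphaOne_of_le hs hu.2
  refine continuousOn_const.div (continuousOn_id.sub
    (continuousOn_id.rpow_const fun u _ => Or.inr (by linarith))) fun u hu => ?_
  exact (sub_rpow_pos hs hu.1 (hu.2.trans_lt (uS_lt_one hs))).ne'

/-- Since α₁(u) ≥ (s-1)/u and φ - f' ≥ a(s-1) on [u, u_s], the value at u_s is at least of order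
1/u, which is unbounded as u tends to 0. -/
theorem exists_lt_phiIvp_one (ha : 0 < a) (hs : 1 < s) (p : ℝ) :
    ∃ u ∈ Ioo 0 (uS s), p < phiIvp a s 1 u := by
  set μ := uS s with hμd
  have hμ : 0 < μ := uS_pos hs
  have hμ1 : μ < 1 := uS_lt_one hs
  set c := (s - 1) * (a * (s - 1)) * (μ / 2) with hc
  have hc0 : 0 < c := mul_pos (mul_pos (by linarith) (mul_pos ha (by linarith))) (by linarith)
  obtain ⟨u, hu0, huμ, huc⟩ : ∃ u, 0 < u ∧ u ≤ μ / 2 ∧ |p| * u ≤ c := by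
    refine ⟨min (μ / 2) (c / (|p| + 1)), by positivity, min_le_left _ _, ?_⟩
    have h1 : min (μ / 2) (c / (|p| + 1)) ≤ c / (|p| + 1) := min_le_right _ _
    rw [le_div_iff₀ (by positivity)] at h1
    have : 0 ≤ min (μ / 2) (c / (|p| + 1)) := by positivity
    linarith
  have huμ' : u < μ := by linarith
  refine ⟨u, ⟨hu0, huμ'⟩, ?_⟩
  set α := alphaOne s u with hα
  have hα0 : 0 < α := alphaOne_pos hs hu0
  have h := le_of_deriv_right_nonneg
    (f := fun y => phiIvp a s y u - α * (a * (s - 1)) * y) huμ'.le ?_ ?_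
  · simp only [phiIvp_self] at h
    have h1 : phiIvp a s μ u ≤ phiIvp a s 1 u := (phiIvp_strictMonoOn ha hs hu0).monotoneOn
      ⟨huμ'.le, hμ1.le⟩ ⟨by linarith, le_rfl⟩ hμ1.le
    have h2 : s - 1 ≤ α * u := by
      have h3 := alphaS_mul hs hu0 (huμ'.trans hμ1)
      rw [← alphaOne_of_le hs huμ'.le, ← hα] at h3
      have : 0 ≤ α * u ^ s := by positivity
      linarith
    have h3 : |p| * u ≤ (α * (a * (s - 1)) * (μ - u)) * u := by
      refine huc.trans ?_
      have h4 : 0 ≤ a * (s - 1) := mul_nonneg ha.le (by linarith)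
      calc c = (s - 1) * ((a * (s - 1)) * (μ / 2)) := by rw [hc]; ring
        _ ≤ (α * u) * ((a * (s - 1)) * (μ - u)) :=
          mul_le_mul h2 (mul_le_mul_of_nonneg_left (by linarith) h4) (by positivity)
            (by positivity)
        _ = _ := by ring
    have h5 := le_of_mul_le_mul_right h3 hu0
    have h6 := le_abs_self p
    have h7 : 0 < a * s := mul_pos ha (by linarith)
    linarith
  · exact ((phiIvp_continuousOn hs hu0).mono fun z hz => hu0.le.trans hz.1).sub (by fun_prop)
  · intro z hz
    have hz0 : 0 ≤ z := hu0.le.trans hz.1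
    refine ⟨_, ?_, ((phiIvp_hasDerivAt hs hu0 hz0).sub
      (((hasDerivAt_id z).const_mul (α * (a * (s - 1)))))).hasDerivWithinAt⟩
    have h1 := le_phiIvp ha hs hu0 hz.1 (hz.2.le.trans hμ1.le)
    have h2 : marginalCost a s z ≤ a := by
      have h3 := (rpow_lt_of_lt_uS hs hz0 hz.2).le
      rw [le_div_iff₀ (by linarith)] at h3
      have := mul_le_mul_of_nonneg_left h3 ha.le
      unfold marginalCost
      linarith
    have h3 := mul_le_mul_of_nonneg_left (show a * (s - 1) ≤ phiIvp a s z u - marginalCost a s z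
      by linarith) hα0.le
    rw [← hα]
    linarith

/-- The α₂ equation evaluated at α₁ just says that the solution starting at `u` reaches the price
bound exactly at full capacity. -/
theorem alphaTwoEq_iff (ha : 0 < a) (hs : 1 < s) {u p : ℝ} (hu : 0 < u) :
    AlphaTwoEq a s p u (alphaOne s u) ↔ phiIvp a s 1 u = p := by
  unfold AlphaTwoEq phiIvp
  set α := alphaOne s u with hα
  have hα0 : 0 < α := alphaOne_pos hs hu
  have h5 := (Real.rpow_pos_of_pos hα0 (s - 1)).ne'
  have h6 := (Real.exp_pos α).ne'
  have h7 := (Real.exp_pos (u * α)).ne'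
  have hs0 : s ≠ 0 := by linarith
  rw [one_mul, mul_comm α u, gammaInt_symm s α (u * α), sub_mul, one_mul, Real.exp_sub]
  set g := gammaInt s (u * α) α
  constructor
  · intro h
    rw [h]; field_simp; ring
  · intro h
    rw [← h]; field_simp; ring

theorem isCDT_iff (ha : 0 < a) (hs : 1 < s) {u p : ℝ} :
    IsCDT a s p u ↔ u ∈ Ioo 0 1 ∧ phiIvp a s 1 u = p :=
  and_congr_right fun hu => alphaTwoEq_iff ha hs hu.1

theorem phiIvp_uS (hs : 1 < s) (a y : ℝ) :
    phiIvp a s y (uS s) = a * s * (Real.exp (alphaMin s * y) / s ^ s) *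
      (-gammaInt s s (alphaMin s * y)) +
      a * s * (Real.exp (alphaMin s * y) / Real.exp s) := by
  have h1 : alphaMin s * uS s = s := by rw [mul_comm, uS_mul_alphaMin hs]
  rw [phiIvp, alphaOne_of_ge le_rfl, h1, alphaMin_rpow hs, sub_mul, uS_mul_alphaMin hs,
    Real.exp_sub, mul_comm y, gammaInt_symm s _ s]

theorem rhoSEq_iff (ha : 0 < a) (hs : 1 < s) {ρ p : ℝ} :
    RhoSEq a s p ρ ↔ phiIvp a s ρ (uS s) = p := by
  rw [phiIvp_uS hs]
  unfold RhoSEq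
  have h5 := (Real.rpow_pos_of_pos (show 0 < s by linarith) s).ne'
  have h6 := (Real.exp_pos (alphaMin s * ρ)).ne'
  have h7 := (Real.exp_pos s).ne'
  have hs0 : s ≠ 0 := by linarith
  set g := gammaInt s s (alphaMin s * ρ)
  constructor
  · intro h
    rw [h]; field_simp; ring
  · intro h
    rw [← h]; field_simp; ring

theorem cS_eq (hs : 1 < s) (a : ℝ) : cS a s = phiIvp a s 1 (uS s) := by
  rw [phiIvp_uS hs, cS, mul_one]
  have h5 := (Real.rpow_pos_of_pos (show 0 < s by linarith) s).ne'
  field_simp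
  ring

theorem cdt_unique (ha : 0 < a) (hs : 1 < s) {u v p : ℝ} (hu : IsCDT a s p u)
    (hv : IsCDT a s p v) : u = v := by
  rw [isCDT_iff ha hs] at hu hv
  by_contra hne
  rcases lt_or_gt_of_ne hne with h | h
  · linarith [phiIvp_lt_phiIvp ha hs hu.1.1 h hv.1.2.le le_rfl, hu.2, hv.2]
  · linarith [phiIvp_lt_phiIvp ha hs hv.1.1 h hu.1.2.le le_rfl, hu.2, hv.2]

theorem exists_cdt_of_le_cS (ha : 0 < a) (hs : 1 < s) {p : ℝ} (h1 : a * s < p)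
    (h2 : p ≤ cS a s) : ∃ u ∈ Ico (uS s) 1, IsCDT a s p u := by
  rw [cS_eq hs] at h2
  have h3 := intermediate_value_Icc' (uS_lt_one hs).le (phiIvp_one_continuousOn_Icc (a := a) hs)
  obtain ⟨u, hu, hup⟩ := h3 ⟨by rw [phiIvp_self]; exact h1.le, h2⟩
  have hu1 : u < 1 := by
    refine lt_of_le_of_ne hu.2 ?_
    rintro rfl
    simp only [phiIvp_self] at hup
    linarith
  exact ⟨u, ⟨hu.1, hu1⟩, (isCDT_iff ha hs).2 ⟨⟨(uS_pos hs).trans_le hu.1, hu1⟩, hup⟩⟩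

theorem exists_cdt_of_cS_lt (ha : 0 < a) (hs : 1 < s) {p : ℝ} (h2 : cS a s < p) :
    ∃ u ∈ Ioo 0 (uS s), IsCDT a s p u := by
  rw [cS_eq hs] at h2
  obtain ⟨u₀, hu0, hlt⟩ := exists_lt_phiIvp_one ha hs p
  have h3 := intermediate_value_Icc' hu0.2.le ((phiIvp_one_continuousOn_Ioc (a := a) hs).mono
    fun z hz => ⟨hu0.1.trans_le hz.1, hz.2⟩)
  obtain ⟨u, hu, hup⟩ := h3 ⟨h2.le, hlt.le⟩
  have hu1 : u < uS s := by
    refine lt_of_le_of_ne hu.2 ?_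
    rintro rfl
    simp only at hup
    linarith
  have hpos := hu0.1.trans_le hu.1
  exact ⟨u, ⟨hpos, hu1⟩, (isCDT_iff ha hs).2 ⟨⟨hpos, hu1.trans (uS_lt_one hs)⟩, hup⟩⟩

end Ivp

/-! ### The surplus along the initial value problem -/

theorem primitive_sub_bounds {g F : ℝ → ℝ} {y z : ℝ} (hyz : y ≤ z) (hF : ContinuousOn F (Icc y z))
    (hF' : ∀ x ∈ Ioo y z, HasDerivAt F (g x) x) (hg : MonotoneOn g (Icc y z)) :
    g y * (z - y) ≤ F z - F y ∧ F z - F y ≤ g z * (z - y) := by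
  rcases hyz.eq_or_lt with rfl | hlt
  · simp
  obtain ⟨c, hc, h⟩ := exists_hasDerivAt_eq_slope F g hlt hF hF'
  have h0 : 0 < z - y := sub_pos.2 hlt
  rw [eq_div_iff h0.ne'] at h
  rw [← h]
  exact ⟨mul_le_mul_of_nonneg_right (hg ⟨le_rfl, hyz⟩ ⟨hc.1.le, hc.2.le⟩ hc.1.le) h0.le,
    mul_le_mul_of_nonneg_right (hg ⟨hc.1.le, hc.2.le⟩ ⟨hyz, le_rfl⟩ hc.2.le) h0.le⟩

/-- A primitive of `y ↦ phiIvp a s y u`. -/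
noncomputable def ivpPotential (a s u y : ℝ) : ℝ :=
  a * y ^ s + (phiIvp a s y u - a) / alphaOne s u

section IvpSegment

variable {a s : ℝ}

theorem ivpPotential_hasDerivAt (hs : 1 < s) {u y : ℝ} (hu : 0 < u) (hy : 0 < y) :
    HasDerivAt (ivpPotential a s u) (phiIvp a s y u) y := by
  have hα := (alphaOne_pos hs hu).ne'
  have h1 := ((Real.hasDerivAt_rpow_const (p := s) (Or.inl hy.ne')).const_mul a).add
    (((phiIvp_hasDerivAt (a := a) hs hu hy.le).sub_const a).div_const (alphaOne s u))
  refine h1.congr_deriv ?_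
  unfold marginalCost
  field_simp
  ring

theorem ivpPotential_continuousOn (hs : 1 < s) {u : ℝ} (hu : 0 < u) :
    ContinuousOn (ivpPotential a s u) (Ioi 0) := fun _ hy =>
  (ivpPotential_hasDerivAt hs hu hy).continuousAt.continuousWithinAt

theorem ivpPotential_sub (a s u y : ℝ) :
    ivpPotential a s u y - a * y ^ s = (phiIvp a s y u - a) / alphaOne s u := by
  unfold ivpPotential; ring

theorem ivpPotential_self (hs : 1 < s) {u : ℝ} (hu : 0 < u)
    (hα : alphaOne s u * (u - u ^ s) = s - 1) : ivpPotential a s u u = a * u := by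
  have hα0 := (alphaOne_pos hs hu).ne'
  have : (a * s - a) / alphaOne s u = a * (u - u ^ s) := by
    rw [div_eq_iff hα0]; linear_combination -a * hα
  rw [ivpPotential, phiIvp_self, this]; ring

/-- The relation between α and `u` makes the two potentials agree at `u`, so the estimates on the
two segments can be chained. -/
theorem surplus_power_eq_ivp (hs : 1 < s) {u : ℝ} (hu : 0 < u)
    (hα : alphaOne s u * (u - u ^ s) = s - 1) (Ψ : ℝ → ℝ) :
    surplus Ψ (fun y => marginalCost a s (y / u)) (fun y => a * u * (y / u) ^ s) u =
      surplus Ψ (fun y => phiIvp a s y u) (ivpPotential a s u) u := by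
  simp only [surplus, ivpPotential_self hs hu hα, phiIvp_self, div_self hu.ne', marginalCost,
    Real.one_rpow, mul_one]

theorem ivp_surplus_continuousOn {ψ Ψ : ℝ → ℝ} (hs : 1 < s) (hΨ : IsSalesCurve ψ Ψ) {u : ℝ}
    (hu : 0 < u) :
    ContinuousOn (surplus Ψ (fun y => phiIvp a s y u) (ivpPotential a s u)) (Icc u 1) := by
  have h1 : ContinuousOn (fun y => phiIvp a s y u) (Icc u 1) :=
    (phiIvp_continuousOn hs hu).mono fun z hz => hu.le.trans hz.1
  exact ((hΨ.cont.comp_continuousOn h1).sub (continuousOn_id.mul h1)).add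
    ((ivpPotential_continuousOn hs hu).mono fun z hz => hu.trans_le hz.1)

/-- On this segment the conjugate is attained at q = 1 and φ' / (φ - f') = α, so the integrating
factor is exp(-αy). -/
theorem ivp_surplus_mono {β δ u y z : ℝ} {ψ Ψ : ℝ → ℝ} (ha : 0 < a) (hs : 1 < s) (hu : 0 < u)
    (h : IsCompetitiveCurve a s (phiIvp a s 1 u) β δ ψ Ψ) (hβ : 0 < β)
    (hβα : β ≤ alphaOne s u) (huy : u ≤ y) (hyz : y ≤ z) (hz : z ≤ 1) :
    Real.exp (-(alphaOne s u * y)) *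
        (surplus Ψ (fun y => phiIvp a s y u) (ivpPotential a s u) y - δ) ≤
      Real.exp (-(alphaOne s u * z)) *
        (surplus Ψ (fun y => phiIvp a s y u) (ivpPotential a s u) z - δ) := by
  set α := alphaOne s u with hα
  have hα0 : 0 < α := alphaOne_pos hs hu
  refine le_of_deriv_right_nonneg (f := fun y => Real.exp (-(α * y)) *
        (surplus Ψ (fun y => phiIvp a s y u) (ivpPotential a s u) y - δ)) hyz ?_ ?_
  · exact ContinuousOn.mul (by fun_prop) (((ivp_surplus_continuousOn hs h.1 hu).mono
      (Icc_subset_Icc huy hz)).sub continuousOn_const)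
  · intro x hx
    have hux : u ≤ x := huy.trans hx.1
    have hx1 : x < 1 := hx.2.trans_le hz
    have hx0 : 0 < x := hu.trans_le hux
    have h1 : HasDerivAt (fun y => -(α * y)) (-α) x := by
      simpa using ((hasDerivAt_id x).const_mul α).fun_neg
    have hmono := (phiIvp_strictMonoOn ha hs hu).monotoneOn
    have h2 := surplus_hasDerivWithinAt h.1 hmono ⟨hux, hx1⟩
      (phiIvp_hasDerivAt hs hu hx0.le) (ivpPotential_hasDerivAt hs hu hx0)
    refine ⟨_, ?_, (h1.exp.hasDerivWithinAt (s := Ici x)).mul (h2.sub_const δ)⟩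
    have h3 : a * s ≤ phiIvp a s x u := le_phiIvp ha hs hu hux hx1.le
    have h4 : 0 < a * s := mul_pos ha (by linarith)
    have h5 := surplus_le (α := α) (q := 1) (φ := fun y => phiIvp a s y u)
      (F := ivpPotential a s u) ha hs h hx0.le ⟨zero_le_one, le_rfl⟩
      ⟨h4.le.trans h3, hmono ⟨hux, hx1.le⟩ ⟨hux.trans hx1.le, le_rfl⟩ hx1.le⟩ (by
        rw [ivpPotential_sub, ← hα, mul_div_cancel₀ _ hα0.ne', Real.one_rpow]; ring)
    rw [ivpPotential_sub, ← hα] at h5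
    have h6 : 0 ≤ (α / β - 1) * ((phiIvp a s x u - a) / α) := by
      refine mul_nonneg ?_ (div_nonneg ?_ hα0.le)
      · rw [sub_nonneg, le_div_iff₀ hβ]; linarith
      · nlinarith
    have h7 := mul_le_mul_of_nonneg_left (mul_le_mul_of_nonneg_left
      (show _ ≤ _ by linarith only [h5, h6] : surplus Ψ (fun y => phiIvp a s y u)
        (ivpPotential a s u) x - δ ≤ (phiIvp a s x u - a * s * x ^ (s - 1)) *
          (ψ (phiIvp a s x u) - x)) hα0.le) (Real.exp_pos (-(α * x))).le
    rw [← hα]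
    unfold marginalCost
    linarith only [h7]

/-- The constraint at the top price bounds Ψ(pbar) from above. As utilization cannot exceed 1 and
pbar ≥ f'(1), even a full resource yields net value at most pbar - a. -/
theorem ivp_surplus_one_le {β δ u : ℝ} {ψ Ψ : ℝ → ℝ} (ha : 0 < a) (hs : 1 < s) (hu : 0 < u)
    (hu1 : u < 1) (h : IsCompetitiveCurve a s (phiIvp a s 1 u) β δ ψ Ψ) :
    surplus Ψ (fun y => phiIvp a s y u) (ivpPotential a s u) 1 ≤
      δ - (phiIvp a s 1 u - a) * (1 / β - 1 / alphaOne s u) := by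
  set p := phiIvp a s 1 u with hp
  have h3 : a * s ≤ p := le_phiIvp ha hs hu hu1.le le_rfl
  have h4 : 0 < a * s := mul_pos ha (by linarith)
  have h1 := h.2 p ⟨h4.le.trans h3, le_rfl⟩ 1 ⟨zero_le_one, le_rfl⟩
  have h2 := mul_le_mul_of_nonneg_left (rpow_tangent_le hs zero_le_one (h.1.nonneg p)) ha.le
  rw [Real.one_rpow, Real.one_rpow] at h2
  rw [Real.one_rpow] at h1
  have h5 := mul_nonneg (sub_nonneg.2 h3) (sub_nonneg.2 (h.1.le_one p))
  unfold surplus ivpPotential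
  rw [Real.one_rpow, ← hp]
  have h6 : (p - a) * (1 / β - 1 / alphaOne s u) = (p * 1 - a * 1) / β - (p - a) / alphaOne s u := by
    ring
  rw [h6]
  linarith

theorem power_surplus_mono {pbar α β δ μ y z : ℝ} {ψ Ψ : ℝ → ℝ} (ha : 0 < a) (hs : 1 < s)
    (h : IsCompetitiveCurve a s pbar β δ ψ Ψ) (hβ : 0 < β) (hβα : β ≤ α) (hμ : 0 < μ)
    (hμ1 : μ < 1) (hα : α * (μ - μ ^ s) = s - 1) (hp : a * s ≤ pbar) (hy : 0 < y)
    (hyz : y ≤ z) (hz : z ≤ μ) :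
    y ^ (-((s - 1) / (1 - μ ^ (s - 1)))) *
        (surplus Ψ (fun y => marginalCost a s (y / μ)) (fun y => a * μ * (y / μ) ^ s) y - δ) ≤
      z ^ (-((s - 1) / (1 - μ ^ (s - 1)))) *
        (surplus Ψ (fun y => marginalCost a s (y / μ)) (fun y => a * μ * (y / μ) ^ s) z - δ) := by
  refine le_of_deriv_right_nonneg (f := fun y => y ^ (-((s - 1) / (1 - μ ^ (s - 1)))) *
        (surplus Ψ (fun y => marginalCost a s (y / μ)) (fun y => a * μ * (y / μ) ^ s) y - δ))
        hyz ?_ ?_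
  · have h1 := surplus_continuousOn_power (a := a) hs h.1 μ
    refine ContinuousOn.mul ?_ (h1.continuousOn.sub continuousOn_const)
    exact fun y hy' => ((Real.continuousAt_rpow_const _ _
      (Or.inl (hy.trans_le hy'.1).ne')).continuousWithinAt)
  · intro x hx
    have hx0 : 0 < x := hy.trans_le hx.1
    have hxμ : x ≤ μ := hx.2.le.trans hz
    obtain ⟨d, hd, hderiv⟩ := power_surplus_deriv ha hs h hμ hμ1 hα hx0 hxμ
      ((marginalCost_le ha hs (by positivity) ((div_le_one hμ).2 hxμ)).trans hp)
    refine ⟨d, le_trans ?_ hd, hderiv⟩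
    have h1 : 0 ≤ α / β - 1 := by rw [sub_nonneg, le_div_iff₀ hβ]; linarith
    have h2 := (sub_rpow_pos hs hμ hμ1).le
    have h3 : μ ^ (s - 1) < 1 := Real.rpow_lt_one hμ.le hμ1 (by linarith)
    have h4 : 0 ≤ (s - 1) / (1 - μ ^ (s - 1)) := div_nonneg (by linarith) (by linarith)
    positivity

/-- In the second high-uncertainty case the surplus is almost nonnegative. -/
theorem exists_surplus_bound {β u l ε : ℝ} (ha : 0 < a) (hs : 1 < s) (hu : 0 < u) (hu1 : u < uS s)
    (hβ : 0 < β) (hβα : β ≤ alphaOne s u) (hl : 0 < l) (hlu : l ≤ u) (hε : 0 < ε) :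
    ∃ δ₀ > 0, ∀ δ, 0 < δ → δ ≤ δ₀ → ∀ ψ Ψ,
      IsCompetitiveCurve a s (phiIvp a s 1 u) β δ ψ Ψ →
      (∀ y ∈ Icc l u, -ε ≤ surplus Ψ (fun y => marginalCost a s (y / u))
        (fun y => a * u * (y / u) ^ s) y) ∧
      ∀ y ∈ Icc u 1, -ε ≤ surplus Ψ (fun y => phiIvp a s y u) (ivpPotential a s u) y := by
  have hu1' : u < 1 := hu1.trans (uS_lt_one hs)
  set α := alphaOne s u with hα
  have hα0 : 0 < α := alphaOne_pos hs hu
  have hαu : α * (u - u ^ s) = s - 1 := by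
    rw [hα, alphaOne_of_le hs hu1.le]; exact alphaS_mul hs hu hu1'
  have hκ1 : u ^ (s - 1) < 1 / s := rpow_lt_of_lt_uS hs hu.le hu1
  have hκ2 : u ^ (s - 1) < 1 := Real.rpow_lt_one hu.le hu1' (by linarith)
  set e := (s - 1) / (1 - u ^ (s - 1)) with he
  have he0 : 0 < e := div_pos (by linarith) (by linarith)
  -- Below u_s the integrating factor y^(-e) is weaker than the a priori bound of order y^s, so the
  -- initial value of the scaled surplus vanishes as y₀ tends to 0. At u_s itself this would fail.
  have hes : 0 < s - e := by
    rw [he, sub_pos, div_lt_iff₀ (by linarith)]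
    rw [lt_div_iff₀ (by linarith)] at hκ1
    linarith
  -- Crossing [u, 1] magnifies a negative surplus by at most exp α. The factor 2 covers two errors
  -- at y₀: the a priori bound and `δ`.
  set ε' := ε / (2 * Real.exp α) with hε'
  have hε'0 : 0 < ε' := by positivity
  set c := s * (a * u / u ^ s) with hc
  have hc0 : 0 < c := by
    have := Real.rpow_pos_of_pos hu s
    have : 0 < s := by linarith
    positivity
  obtain ⟨y₀, hy0, hy0l, hy0c⟩ : ∃ y₀, 0 < y₀ ∧ y₀ ≤ l ∧ c * y₀ ^ (s - e) ≤ ε' := by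
    have h1 : 0 < (ε' / c) ^ (1 / (s - e)) := Real.rpow_pos_of_pos (by positivity) _
    refine ⟨min l ((ε' / c) ^ (1 / (s - e))), by positivity, min_le_left _ _, ?_⟩
    have h2 := Real.rpow_le_rpow (z := s - e) (by positivity)
      (min_le_right l ((ε' / c) ^ (1 / (s - e)))) hes.le
    rw [← Real.rpow_mul (by positivity), one_div_mul_cancel hes.ne', Real.rpow_one,
      le_div_iff₀ hc0] at h2
    linarith
  refine ⟨ε' * y₀ ^ e, mul_pos hε'0 (Real.rpow_pos_of_pos hy0 e), fun δ hδ hδ0 ψ Ψ h => ?_⟩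
  have has : a * s ≤ phiIvp a s 1 u := le_phiIvp ha hs hu hu1'.le le_rfl
  have hlow : ∀ y, y₀ ≤ y → y ≤ u → -(2 * ε') ≤ surplus Ψ (fun y => marginalCost a s (y / u))
        (fun y => a * u * (y / u) ^ s) y - δ := by
    intro y hy hyu
    have hypos := hy0.trans_le hy
    have h1 := power_surplus_mono ha hs h hβ hβα hu hu1' hαu has hy0 hy hyu
    rw [← he] at h1
    have h2 := neg_le_power_surplus ha hs h.1 hu hy0.le
    have h3 : s * (a * u * (y₀ / u) ^ s) = c * y₀ ^ s := by
      rw [Real.div_rpow hy0.le hu.le, hc]; ring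
    rw [h3] at h2
    set A := surplus Ψ (fun y => marginalCost a s (y / u)) (fun y => a * u * (y / u) ^ s) with hA
    have h4 : 0 < y₀ ^ (-e) := Real.rpow_pos_of_pos hy0 _
    have h5 : y₀ ^ (-e) * y₀ ^ s = y₀ ^ (s - e) := by
      rw [← Real.rpow_add hy0]; ring_nf
    have h6 : y₀ ^ (-e) * y₀ ^ e = 1 := by
      rw [← Real.rpow_add hy0]; simp
    have h7 := mul_le_mul_of_nonneg_left h2 h4.le
    have h8 := mul_le_mul_of_nonneg_left hδ0 h4.le
    have h9 : -(2 * ε') ≤ y ^ (-e) * (A y - δ) := by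
      have e1 : y₀ ^ (-e) * (ε' * y₀ ^ e) = ε' := by linear_combination ε' * h6
      have e2 : y₀ ^ (-e) * -(c * y₀ ^ s) = -(c * y₀ ^ (s - e)) := by
        linear_combination -c * h5
      rw [e1] at h8
      rw [e2] at h7
      linarith
    have h10 : y ^ e * y ^ (-e) = 1 := by rw [← Real.rpow_add hypos]; simp
    have h11 : 0 ≤ y ^ e := Real.rpow_nonneg hypos.le e
    have h12 : y ^ e ≤ 1 := Real.rpow_le_one hypos.le (hyu.trans hu1'.le) he0.le
    have h13 := mul_le_mul_of_nonneg_left h9 h11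
    have h14 : y ^ e * (y ^ (-e) * (A y - δ)) = A y - δ := by
      rw [← mul_assoc, h10, one_mul]
    rw [h14] at h13
    nlinarith
  have hexp : 1 ≤ Real.exp α := Real.one_le_exp hα0.le
  have h2ε : 2 * ε' * Real.exp α = ε := by rw [hε']; field_simp
  have h2ε' : 2 * ε' ≤ ε := by
    rw [← h2ε]; exact le_mul_of_one_le_right (by positivity) hexp
  constructor
  · intro y hy
    linarith [hlow y (hy0l.trans hy.1) hy.2]
  · intro y hy
    have h1 := hlow u (hy0l.trans hlu) le_rfl
    rw [surplus_power_eq_ivp hs hu hαu] at h1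
    have h3 := ivp_surplus_mono ha hs hu h hβ hβα le_rfl hy.1 hy.2
    set A := surplus Ψ (fun y => phiIvp a s y u) (ivpPotential a s u) with hA
    rw [← hα] at h3
    have h4 := mul_le_mul_of_nonneg_left h3 (Real.exp_pos (α * y)).le
    rw [← mul_assoc, ← mul_assoc, ← Real.exp_add, ← Real.exp_add, add_neg_cancel, Real.exp_zero,
      one_mul] at h4
    have h5 : Real.exp (α * y + -(α * u)) ≤ Real.exp α :=
      Real.exp_le_exp.2 (by nlinarith [mul_le_mul_of_nonneg_left hy.2 hα0.le, mul_pos hα0 hu])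
    have h6 := mul_le_mul_of_nonneg_left h1 (Real.exp_pos (α * y + -(α * u))).le
    have h7 := mul_le_mul_of_nonneg_right h5 (show 0 ≤ 2 * ε' by positivity)
    linarith

/-- At y = 1 the surplus is at least -X/3 by propagation from 0, yet at most δ - X by the capacity
limit. -/
theorem not_competitiveCurve_of_lt_alphaOne {β u : ℝ} (ha : 0 < a) (hs : 1 < s) (hu : 0 < u)
    (hu1 : u < uS s) (hβ : 1 ≤ β) (hβα : β < alphaOne s u) :
    ∃ δ > 0, ∀ ψ Ψ, ¬ IsCompetitiveCurve a s (phiIvp a s 1 u) β δ ψ Ψ := by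
  have hu1' : u < 1 := hu1.trans (uS_lt_one hs)
  have hβ0 : 0 < β := by linarith
  have has : a * s ≤ phiIvp a s 1 u := le_phiIvp ha hs hu hu1'.le le_rfl
  set X := (phiIvp a s 1 u - a) * (1 / β - 1 / alphaOne s u) with hX
  have hX0 : 0 < X := mul_pos (by nlinarith) (sub_pos.2 (one_div_lt_one_div_of_lt hβ0 hβα))
  obtain ⟨δ₀, hδ0, h⟩ := exists_surplus_bound ha hs hu hu1 hβ0 hβα.le hu le_rfl
    (show 0 < X / 3 by positivity)
  refine ⟨min δ₀ (X / 3), by positivity, fun ψ Ψ hψ => ?_⟩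
  have h1 := (h _ (by positivity) (min_le_left _ _) ψ Ψ hψ).2 1 ⟨hu1'.le, le_rfl⟩
  have h2 := ivp_surplus_one_le ha hs hu hu1' hψ
  rw [← hX] at h2
  linarith [min_le_right δ₀ (X / 3)]

/-- With β = α the bound at y = 1 is just `δ`, and the monotonicity of the scaled surplus carries it
backwards to every smaller utilization. -/
theorem surplus_le_error {δ u : ℝ} {ψ Ψ : ℝ → ℝ} (ha : 0 < a) (hs : 1 < s) (hu : 0 < u)
    (hu1 : u < uS s) (h : IsCompetitiveCurve a s (phiIvp a s 1 u) (alphaOne s u) δ ψ Ψ) :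
    (∀ y ∈ Ioc 0 u, surplus Ψ (fun y => marginalCost a s (y / u))
        (fun y => a * u * (y / u) ^ s) y ≤ δ) ∧
      ∀ y ∈ Icc u 1, surplus Ψ (fun y => phiIvp a s y u) (ivpPotential a s u) y ≤ δ := by
  have hu1' : u < 1 := hu1.trans (uS_lt_one hs)
  have hα0 : 0 < alphaOne s u := alphaOne_pos hs hu
  have hαu : alphaOne s u * (u - u ^ s) = s - 1 := by
    rw [alphaOne_of_le hs hu1.le]; exact alphaS_mul hs hu hu1'
  have has : a * s ≤ phiIvp a s 1 u := le_phiIvp ha hs hu hu1'.le le_rfl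
  have h2 : ∀ y ∈ Icc u 1, surplus Ψ (fun y => phiIvp a s y u) (ivpPotential a s u) y ≤ δ := by
    intro y hy
    have h1 := ivp_surplus_mono ha hs hu h hα0 le_rfl hy.1 hy.2 le_rfl
    have h2 := ivp_surplus_one_le ha hs hu hu1' h
    rw [sub_self, mul_zero, sub_zero] at h2
    have h3 := mul_nonpos_of_nonneg_of_nonpos (Real.exp_pos (-(alphaOne s u * 1))).le
      (sub_nonpos.2 h2)
    have h4 := nonpos_of_mul_nonpos_right (h1.trans h3) (Real.exp_pos _)
    linarith
  refine ⟨fun y hy => ?_, h2⟩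
  have h1 := power_surplus_mono ha hs h hα0 le_rfl hu hu1' hαu has hy.1 hy.2 le_rfl
  rw [surplus_power_eq_ivp hs hu hαu] at h1
  have h4 := mul_nonpos_of_nonneg_of_nonpos
    (Real.rpow_nonneg hu.le (-((s - 1) / (1 - u ^ (s - 1)))))
    (sub_nonpos.2 (h2 u ⟨le_rfl, hu1'.le⟩))
  have h5 := nonpos_of_mul_nonpos_right (h1.trans h4) (Real.rpow_pos_of_pos hy.1 _)
  linarith

end IvpSegment

/-! ### Uniqueness of the optimal pricing function -/

/-- If the sales curves of a posted price mechanism have vanishing surplus with respect to `g`, then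
`g` is its pricing function. -/
theorem pricing_eq_of_surplus {φ g F : ℝ → ℝ} {C : ℝ → (ℝ → ℝ) → (ℝ → ℝ) → Prop} {pbar l h : ℝ}
    (hl : 0 ≤ l) (hh : h ≤ 1) (hg : StrictMonoOn g (Icc l h)) (hgc : ContinuousOn g (Icc l h))
    (hF : ∀ y ∈ Ioo l h, HasDerivAt F (g y) y)
    (hgp : ∀ y ∈ Ioo l h, g y ∈ Icc 0 pbar)
    (hC : ∀ δ ψ Ψ, C δ ψ Ψ → IsSalesCurve ψ Ψ)
    (hA : ∀ y ∈ Ioo l h, ∀ ε > 0, ∃ δ₀ > 0, ∀ δ, 0 < δ → δ ≤ δ₀ → ∀ ψ Ψ, C δ ψ Ψ →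
      |surplus Ψ g F y| ≤ ε)
    (hφ : ∀ δ > 0, ∃ ψ Ψ, C δ ψ Ψ ∧
      (∀ y ∈ Icc (0 : ℝ) 1, ∀ p ∈ Icc 0 pbar, φ y + δ ≤ p → y + δ ≤ 1 → y ≤ ψ p) ∧
      (∀ y ∈ Icc (0 : ℝ) 1, ∀ p ∈ Icc 0 pbar, p < φ y → ψ p ≤ y + δ))
    {y : ℝ} (hy : y ∈ Ioo l h) : φ y = g y := by
  have hyI : y ∈ Icc (0 : ℝ) 1 := ⟨hl.trans hy.1.le, hy.2.le.trans hh⟩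
  have hgy : ContinuousAt g y := (hgc y ⟨hy.1.le, hy.2.le⟩).continuousAt (Icc_mem_nhds hy.1 hy.2)
  have hprim : ∀ x ∈ Ioo l h, ∀ z ∈ Ioo l h, x ≤ z →
      g x * (z - x) ≤ F z - F x ∧ F z - F x ≤ g z * (z - x) := fun x hx z hz hxz => by
    refine primitive_sub_bounds hxz (fun w hw => ?_) (fun w hw => ?_)
      (hg.monotoneOn.mono (Icc_subset_Icc hx.1.le hz.2.le))
    · exact (hF w ⟨hx.1.trans_le hw.1, hw.2.trans_lt hz.2⟩).continuousAt.continuousWithinAt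
    · exact hF w ⟨hx.1.trans hw.1, hw.2.trans hz.2⟩
  have hpair : ∀ x ∈ Ioo l h, ∀ z ∈ Ioo l h, ∀ d > 0, ∀ ε > 0, ∃ δ, 0 < δ ∧ δ ≤ d ∧
      ∃ ψ Ψ, IsSalesCurve ψ Ψ ∧ |surplus Ψ g F x| ≤ ε ∧ |surplus Ψ g F z| ≤ ε ∧
      (∀ y ∈ Icc (0 : ℝ) 1, ∀ p ∈ Icc 0 pbar, φ y + δ ≤ p → y + δ ≤ 1 → y ≤ ψ p) ∧
      (∀ y ∈ Icc (0 : ℝ) 1, ∀ p ∈ Icc 0 pbar, p < φ y → ψ p ≤ y + δ) := by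
    intro x hx z hz d hd ε hε
    obtain ⟨d₁, hd1, h1⟩ := hA x hx ε hε
    obtain ⟨d₂, hd2, h2⟩ := hA z hz ε hε
    have hpos : 0 < min d (min d₁ d₂) := by positivity
    obtain ⟨ψ, Ψ, hc, h3, h4⟩ := hφ _ hpos
    exact ⟨_, hpos, min_le_left _ _, ψ, Ψ, hC _ _ _ hc,
      h1 _ hpos ((min_le_right _ _).trans (min_le_left _ _)) _ _ hc,
      h2 _ hpos ((min_le_right _ _).trans (min_le_right _ _)) _ _ hc, h3, h4⟩
  rcases lt_trichotomy (φ y) (g y) with hlt | heq | hgt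
  -- Since φ y < g x, sales at price `g x` have reached `y`, so convexity gives `Ψ` a slope of at
  -- least `y` between g x and g z. A vanishing surplus allows a slope of at most `z < y`, up to
  -- errors below the gap `d`.
  · exfalso
    have hev : ∀ᶠ x in nhdsWithin y (Iio y), φ y < g x ∧ l < x :=
      ((hgy.eventually (lt_mem_nhds hlt)).and (lt_mem_nhds hy.1)).filter_mono nhdsWithin_le_nhds
    obtain ⟨x, ⟨hx1, hx2⟩, hxy⟩ := (hev.and self_mem_nhdsWithin).exists
    have hxy : x < y := hxy
    obtain ⟨z, hxz, hzy⟩ := exists_between hxy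
    have hx : x ∈ Ioo l h := ⟨hx2, hxy.trans hy.2⟩
    have hz : z ∈ Ioo l h := ⟨hx2.trans hxz, hzy.trans hy.2⟩
    have hgxz : g x < g z := hg ⟨hx.1.le, hx.2.le⟩ ⟨hz.1.le, hz.2.le⟩ hxz
    set d := (y - z) * (g z - g x) with hd
    have hd0 : 0 < d := mul_pos (by linarith) (by linarith)
    obtain ⟨δ, hδ, hδd, ψ, Ψ, hΨ, hAx, hAz, h1, -⟩ := hpair x hx z hz
      (min (g x - φ y) (1 - y)) (lt_min (by linarith) (by linarith [hy.2])) (d / 3)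
      (by positivity)
    have h2 := h1 y hyI (g x) (hgp x hx) (by linarith [min_le_left (g x - φ y) (1 - y)])
      (by linarith [min_le_right (g x - φ y) (1 - y)])
    have h3 := hΨ.subgrad (g x) (g z)
    have h4 := mul_le_mul_of_nonneg_right h2 (sub_nonneg.2 hgxz.le)
    have h5 := (hprim x hx z hz hxz.le).1
    rw [abs_le] at hAx hAz
    unfold surplus at hAx hAz
    linarith
  · exact heq
  -- The mirror image to the right of `y`: sales at price `g z` are at most y + δ, halfway to `x`,
  -- while a vanishing surplus requires a slope of at least `x`.
  · exfalso
    have hev : ∀ᶠ x in nhdsWithin y (Ioi y), g x < φ y ∧ x < h :=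
      ((hgy.eventually (gt_mem_nhds hgt)).and (gt_mem_nhds hy.2)).filter_mono nhdsWithin_le_nhds
    obtain ⟨z, ⟨hz1, hz2⟩, hyz⟩ := (hev.and self_mem_nhdsWithin).exists
    have hyz : y < z := hyz
    obtain ⟨x, hyx, hxz⟩ := exists_between hyz
    have hx : x ∈ Ioo l h := ⟨hy.1.trans hyx, hxz.trans hz2⟩
    have hz : z ∈ Ioo l h := ⟨hy.1.trans hyz, hz2⟩
    have hgxz : g x < g z := hg ⟨hx.1.le, hx.2.le⟩ ⟨hz.1.le, hz.2.le⟩ hxz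
    set d := (x - y) / 2 * (g z - g x) with hd
    have hd0 : 0 < d := mul_pos (by linarith) (by linarith)
    obtain ⟨δ, hδ, hδd, ψ, Ψ, hΨ, hAx, hAz, -, h1⟩ := hpair x hx z hz
      ((x - y) / 2) (by linarith) (d / 3) (by positivity)
    have h2 := h1 y hyI (g z) (hgp z hz) hz1
    have h3 := hΨ.subgrad (g z) (g x)
    have h4 := mul_le_mul_of_nonneg_right (show ψ (g z) ≤ x - (x - y) / 2 by linarith)
      (sub_nonneg.2 hgxz.le)
    have h5 := (hprim x hx z hz hxz.le).2
    rw [abs_le] at hAx hAz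
    unfold surplus at hAx hAz
    linarith

namespace Setup

variable {K B : Type*} [Fintype K] [Fintype B]

theorem not_competitive_of_lt_alphaOne (S : Setup K B) {a s u : ℝ} (ha : 0 < a) (hs : 1 < s)
    (hcost : ∀ y ∈ Icc (0 : ℝ) 1, S.cost y = a * y ^ s) (hp : 0 < S.pbar)
    (hsingle : ∃ b k, 0 < S.demand b k ∧ ∀ j, j ≠ k → S.demand b j = 0) (hu : 0 < u)
    (hu1 : u < uS s) (hup : phiIvp a s 1 u = S.pbar) {β : ℝ} (hβ : 1 ≤ β)
    (hβα : β < alphaOne s u) : ¬ ∃ A, S.Competitive (AlgOutcome A) β := by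
  rintro ⟨A, hA⟩
  obtain ⟨δ, hδ, h⟩ := not_competitiveCurve_of_lt_alphaOne ha hs hu hu1 hβ hβα
  obtain ⟨ψ, Ψ, hψ⟩ := AlgOutcome.exists_curve S ha hs hcost hp hsingle hA hδ
  rw [hup] at h
  exact h ψ Ψ hψ

/-- The pricing function that attains the ratio `α_s(u)` is unique. -/
theorem pricing_eq_of_competitive (S : Setup K B) {a s u : ℝ} (ha : 0 < a) (hs : 1 < s)
    (hcost : ∀ y ∈ Icc (0 : ℝ) 1, S.cost y = a * y ^ s) (hp : 0 < S.pbar)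
    (hsingle : ∃ b k, 0 < S.demand b k ∧ ∀ j, j ≠ k → S.demand b j = 0) (hu : 0 < u)
    (hu1 : u < uS s) (hup : phiIvp a s 1 u = S.pbar) {φ : ℝ → ℝ} (hφ : IsPricingFunction φ)
    (hcomp : S.Competitive (S.PPM φ) (alphaOne s u)) :
    (∀ y ∈ Icc 0 u, φ y = marginalCost a s (y / u)) ∧ ∀ y ∈ Ico u 1, φ y = phiIvp a s y u := by
  have hu1' : u < 1 := hu1.trans (uS_lt_one hs)
  have hα0 : 0 < alphaOne s u := alphaOne_pos hs hu
  have has : a * s ≤ S.pbar := hup ▸ le_phiIvp ha hs hu hu1'.le le_rfl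
  have hcurve := fun δ (hδ : δ > 0) =>
    PPM.exists_curve S ha hs hcost hp hsingle hφ hcomp hδ
  have h1 : ∀ y ∈ Ioo 0 u, φ y = marginalCost a s (y / u) := by
    intro y hy
    refine pricing_eq_of_surplus (g := fun y => marginalCost a s (y / u))
      (F := fun y => a * u * (y / u) ^ s)
      (C := fun δ ψ Ψ => IsCompetitiveCurve a s S.pbar (alphaOne s u) δ ψ Ψ) le_rfl hu1'.le
      ((marginalCost_strictMonoOn ha hs hu).mono Icc_subset_Ici_self)
      (marginalCost_continuous hs u).continuousOn
      (fun z hz => powerPotential_hasDerivAt hu hz.1) (fun z hz => ?_) (fun δ ψ Ψ h => h.1)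
      (fun z hz ε hε => ?_) hcurve hy
    · exact ⟨marginalCost_nonneg ha hs (div_nonneg hz.1.le hu.le),
        (marginalCost_le ha hs (div_nonneg hz.1.le hu.le)
          ((div_le_one hu).2 hz.2.le)).trans has⟩
    · obtain ⟨δ₀, hδ0, h⟩ := exists_surplus_bound ha hs hu hu1 hα0 le_rfl hz.1 hz.2.le hε
      rw [hup] at h
      refine ⟨min δ₀ ε, by positivity, fun δ hδ hδd ψ Ψ hψ => abs_le.2 ⟨?_, ?_⟩⟩
      · exact (h δ hδ (hδd.trans (min_le_left _ _)) ψ Ψ hψ).1 z ⟨le_rfl, hz.2.le⟩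
      · rw [← hup] at hψ
        exact ((surplus_le_error ha hs hu hu1 hψ).1 z ⟨hz.1, hz.2.le⟩).trans
          (hδd.trans (min_le_right _ _))
  have h2 : ∀ y ∈ Ioo u 1, φ y = phiIvp a s y u := by
    intro y hy
    refine pricing_eq_of_surplus (g := fun y => phiIvp a s y u)
      (F := ivpPotential a s u)
      (C := fun δ ψ Ψ => IsCompetitiveCurve a s S.pbar (alphaOne s u) δ ψ Ψ) hu.le le_rfl
      (phiIvp_strictMonoOn ha hs hu)
      ((phiIvp_continuousOn hs hu).mono fun z hz => hu.le.trans hz.1)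
      (fun z hz => ivpPotential_hasDerivAt hs hu (hu.trans hz.1)) (fun z hz => ?_)
      (fun δ ψ Ψ h => h.1) (fun z hz ε hε => ?_) hcurve hy
    · refine ⟨(mul_pos ha (by linarith)).le.trans (le_phiIvp ha hs hu hz.1.le hz.2.le), ?_⟩
      rw [← hup]
      exact (phiIvp_strictMonoOn ha hs hu).monotoneOn ⟨hz.1.le, hz.2.le⟩ ⟨hu1'.le, le_rfl⟩ hz.2.le
    · obtain ⟨δ₀, hδ0, h⟩ := exists_surplus_bound ha hs hu hu1 hα0 le_rfl hu le_rfl hε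
      rw [hup] at h
      refine ⟨min δ₀ ε, by positivity, fun δ hδ hδd ψ Ψ hψ => abs_le.2 ⟨?_, ?_⟩⟩
      · exact (h δ hδ (hδd.trans (min_le_left _ _)) ψ Ψ hψ).2 z ⟨hz.1.le, hz.2.le⟩
      · rw [← hup] at hψ
        exact ((surplus_le_error ha hs hu hu1 hψ).2 z ⟨hz.1.le, hz.2.le⟩).trans
          (hδd.trans (min_le_right _ _))
  -- The surplus argument covers open intervals only. The values at 0 and `u` follow from
  -- monotonicity and one-sided limits; nothing bounds the price at 1 from above, which is why it
  -- stays free.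
  have hφm := hφ.1.monotoneOn
  have h3 : φ 0 = marginalCost a s (0 / u) := by
    have h0 : marginalCost a s (0 / u) = 0 := by
      rw [zero_div, marginalCost, Real.zero_rpow (by linarith), mul_zero]
    rw [h0]
    refine le_antisymm ?_ (hφ.2 0 ⟨le_rfl, zero_le_one⟩)
    have hlim : Filter.Tendsto (fun y => marginalCost a s (y / u)) (nhdsWithin 0 (Ioi 0))
        (nhds 0) := by
      have := (marginalCost_continuous (a := a) hs u).tendsto 0
      rw [h0] at this
      exact this.mono_left nhdsWithin_le_nhds
    refine ge_of_tendsto hlim ?_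
    filter_upwards [Ioo_mem_nhdsGT hu] with y hy
    rw [← h1 y hy]
    exact hφm ⟨le_rfl, zero_le_one⟩ ⟨hy.1.le, (hy.2.trans hu1').le⟩ hy.1.le
  have h4 : φ u = a * s := by
    refine le_antisymm ?_ ?_
    · have hlim : Filter.Tendsto (fun y => phiIvp a s y u) (nhdsWithin u (Ioi u))
          (nhds (a * s)) := by
        have := (phiIvp_hasDerivAt (a := a) hs hu hu.le).continuousAt.tendsto
        rw [phiIvp_self] at this
        exact this.mono_left nhdsWithin_le_nhds
      refine ge_of_tendsto hlim ?_
      filter_upwards [Ioo_mem_nhdsGT hu1'] with y hy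
      rw [← h2 y hy]
      exact hφm ⟨hu.le, hu1'.le⟩ ⟨hu.le.trans hy.1.le, hy.2.le⟩ hy.1.le
    · have hlim : Filter.Tendsto (fun y => marginalCost a s (y / u)) (nhdsWithin u (Iio u))
          (nhds (a * s)) := by
        have := (marginalCost_continuous (a := a) hs u).tendsto u
        have e : marginalCost a s (u / u) = a * s := by
          rw [div_self hu.ne', marginalCost, Real.one_rpow, mul_one]
        rw [e] at this
        exact this.mono_left nhdsWithin_le_nhds
      refine le_of_tendsto hlim ?_
      filter_upwards [Ioo_mem_nhdsLT hu] with y hy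
      rw [← h1 y hy]
      exact hφm ⟨hy.1.le, (hy.2.trans hu1').le⟩ ⟨hu.le, hu1'.le⟩ hy.2.le
  constructor
  · intro y hy
    rcases hy.1.eq_or_lt with rfl | h0
    · exact h3
    rcases hy.2.eq_or_lt with rfl | h0'
    · rw [h4, div_self hu.ne', marginalCost, Real.one_rpow, mul_one]
    · exact h1 y ⟨h0, h0'⟩
  · intro y hy
    rcases hy.1.eq_or_lt with rfl | h0
    · rw [h4, phiIvp_self]
    · exact h2 y ⟨h0, hy.2⟩

end Setup

/-! ### The characteristic equation -/

section CharRoot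

variable {s : ℝ}

/-- In terms of x = 1/η the sign of P is that of (s-1) - α (x - x^s), so positivity and the root at
1/u_s are read off from the maximum of x - x^s. -/
theorem charPoly_eq (s α : ℝ) {η : ℝ} (hη : 0 < η) :
    charPoly s α η = η ^ s * (1 - α / (s - 1) * (η⁻¹ - η⁻¹ ^ s)) := by
  have h := (Real.rpow_pos_of_pos hη s).ne'
  rw [charPoly, Real.inv_rpow hη.le, Real.rpow_sub_one hη.ne']
  field_simp
  ring

theorem sub_rpow_lt_uS (hs : 1 < s) {x : ℝ} (hx : 0 ≤ x) (hne : x ≠ uS s) :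
    x - x ^ s < uS s - uS s ^ s := by
  have h := rpow_tangent_lt hs (uS_pos hs) hx hne
  rw [uS_rpow hs, mul_one_div_cancel (by linarith), one_mul] at h
  linarith

theorem charPoly_pos (hs : 1 < s) {η : ℝ} (hη : 0 < η) (hne : η ≠ 1 / uS s) :
    0 < charPoly s (alphaMin s) η := by
  rw [charPoly_eq s _ hη]
  refine mul_pos (Real.rpow_pos_of_pos hη s) (sub_pos.2 ?_)
  have h1 := sub_rpow_lt_uS hs (inv_pos.2 hη).le fun h => hne (by rw [← h, one_div, inv_inv])
  have h2 := mul_lt_mul_of_pos_left h1 (show 0 < alphaMin s by linarith [one_lt_alphaMin hs])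
  rw [alphaMin_mul hs] at h2
  rw [div_mul_eq_mul_div, div_lt_one (by linarith)]
  exact h2

theorem charPoly_double_root (hs : 1 < s) : charPoly s (alphaMin s) (1 / uS s) = 0 := by
  have h0 := uS_pos hs
  rw [charPoly_eq s _ (by positivity), one_div, inv_inv, div_mul_eq_mul_div, alphaMin_mul hs,
    div_self (by linarith), sub_self, mul_zero]

theorem charPoly_hasDerivAt (s α : ℝ) {η : ℝ} (hη : 0 < η) :
    HasDerivAt (charPoly s α)
      (s * η ^ (s - 1) - α / (s - 1) * ((s - 1) * η ^ (s - 1 - 1))) η :=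
  ((Real.hasDerivAt_rpow_const (Or.inl hη.ne')).sub
    ((Real.hasDerivAt_rpow_const (Or.inl hη.ne')).const_mul _)).add_const _

/-- The integrand of the characteristic equation. -/
noncomputable def charKernel (s η : ℝ) : ℝ := η ^ (s - 1) / charPoly s (alphaMin s) η

theorem charKernel_pos (hs : 1 < s) {η : ℝ} (hη : η ∈ Ioo 0 (1 / uS s)) : 0 < charKernel s η :=
  div_pos (Real.rpow_pos_of_pos hη.1 _) (charPoly_pos hs hη.1 hη.2.ne)

theorem charKernel_continuousOn (hs : 1 < s) :
    ContinuousOn (charKernel s) (Ioo 0 (1 / uS s)) := fun _ hη =>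
  ((Real.continuousAt_rpow_const _ _ (Or.inl hη.1.ne')).div
    (charPoly_hasDerivAt s _ hη.1).continuousAt
    (charPoly_pos hs hη.1 hη.2.ne).ne').continuousWithinAt

theorem charKernel_intervalIntegrable (hs : 1 < s) {x z : ℝ} (hx : x ∈ Ioo 0 (1 / uS s))
    (hz : z ∈ Ioo 0 (1 / uS s)) : IntervalIntegrable (charKernel s) volume x z :=
  ((charKernel_continuousOn hs).mono (ordConnected_Ioo.uIcc_subset hx hz)).intervalIntegrable

-- P vanishes at 1/u_s and is differentiable there, hence O(η - 1/u_s), so the kernel dominates a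
-- simple pole. A root of the integral equation therefore cannot reach or cross 1/u_s.
open Asymptotics Filter Topology in
theorem charKernel_not_intervalIntegrable (hs : 1 < s) {x z : ℝ} (hne : x ≠ z)
    (h : 1 / uS s ∈ uIcc x z) : ¬ IntervalIntegrable (charKernel s) volume x z := by
  have h0 : 0 < 1 / uS s := one_div_pos.2 (uS_pos hs)
  refine not_intervalIntegrable_of_sub_inv_isBigO_punctured ?_ hne h
  have h1 : charPoly s (alphaMin s) =O[𝓝[≠] (1 / uS s)] fun x => x - 1 / uS s := by
    have := ((charPoly_hasDerivAt s (alphaMin s) h0).isBigO_sub).mono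
      (nhdsWithin_le_nhds (s := {1 / uS s}ᶜ))
    simpa only [charPoly_double_root hs, sub_zero] using this
  have h2 : (fun x => (x - 1 / uS s)⁻¹) =O[𝓝[≠] (1 / uS s)]
      fun x => (charPoly s (alphaMin s) x)⁻¹ := by
    refine h1.inv_rev ?_
    filter_upwards [self_mem_nhdsWithin, nhdsWithin_le_nhds (lt_mem_nhds h0)] with x hx hx0 hx'
    exact absurd hx' (charPoly_pos hs hx0 hx).ne'
  have h3 : (fun _ => (1 : ℝ)) =O[𝓝[≠] (1 / uS s)] fun x : ℝ => x ^ (s - 1) := by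
    have hc : Tendsto (fun x : ℝ => x ^ (s - 1)) (𝓝[≠] (1 / uS s)) (𝓝 ((1 / uS s) ^ (s - 1))) :=
      (Real.continuousAt_rpow_const _ _ (Or.inl h0.ne')).tendsto.mono_left nhdsWithin_le_nhds
    refine isBigO_const_left_iff_pos_le_norm (by norm_num) |>.2
      ⟨(1 / uS s) ^ (s - 1) / 2, half_pos (Real.rpow_pos_of_pos h0 _), ?_⟩
    filter_upwards [hc.eventually (lt_mem_nhds (half_lt_self (Real.rpow_pos_of_pos h0 (s - 1))))]
      with x hx
    exact hx.le.trans (le_abs_self _)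
  have h4 := h3.mul h2
  refine (h4.congr_left fun _ => one_mul _).congr_right fun _ => ?_
  rw [charKernel, div_eq_mul_inv]

/-- The left-hand side of the characteristic equation. -/
noncomputable def charInt (s χ₀ χ : ℝ) : ℝ := ∫ η in χ₀..χ, charKernel s η

theorem charInt_hasDerivAt (hs : 1 < s) {χ₀ χ : ℝ} (h0 : χ₀ ∈ Ioo 0 (1 / uS s))
    (h : χ ∈ Ioo 0 (1 / uS s)) : HasDerivAt (charInt s χ₀) (charKernel s χ) χ :=
  intervalIntegral.integral_hasDerivAt_right (charKernel_intervalIntegrable hs h0 h)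
    ((charKernel_continuousOn hs).stronglyMeasurableAtFilter isOpen_Ioo χ h)
    ((charKernel_continuousOn hs).continuousAt (isOpen_Ioo.mem_nhds h))

theorem charInt_continuousOn (hs : 1 < s) {χ₀ : ℝ} (h0 : χ₀ ∈ Ioo 0 (1 / uS s)) :
    ContinuousOn (charInt s χ₀) (Ioo 0 (1 / uS s)) := fun _ h =>
  (charInt_hasDerivAt hs h0 h).continuousAt.continuousWithinAt

theorem charInt_strictMonoOn (hs : 1 < s) {χ₀ : ℝ} (h0 : χ₀ ∈ Ioo 0 (1 / uS s)) :
    StrictMonoOn (charInt s χ₀) (Ioo 0 (1 / uS s)) := by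
  refine strictMonoOn_of_deriv_pos (convex_Ioo _ _) (charInt_continuousOn hs h0) fun χ h => ?_
  rw [interior_Ioo] at h
  rw [(charInt_hasDerivAt hs h0 h).deriv]
  exact charKernel_pos hs h

theorem charInt_self (s χ₀ : ℝ) : charInt s χ₀ χ₀ = 0 := intervalIntegral.integral_same

/-- A bounded integral of a positive kernel would make it integrable up to the double root. Hence
the integral takes all values in [0, ∞) on [χ₀, 1/u_s). -/
theorem exists_charInt_gt (hs : 1 < s) {χ₀ : ℝ} (h0 : χ₀ ∈ Ioo 0 (1 / uS s)) (X : ℝ) :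
    ∃ χ ∈ Ioo χ₀ (1 / uS s), X < charInt s χ₀ χ := by
  by_contra! hcon
  refine charKernel_not_intervalIntegrable hs h0.2.ne right_mem_uIcc ?_
  rw [intervalIntegrable_iff_integrableOn_Ioc_of_le h0.2.le]
  have hlt : ∀ x : ℝ, 1 / uS s - Real.exp (-x) < 1 / uS s := fun x =>
    sub_lt_self _ (Real.exp_pos _)
  have hlim : Filter.Tendsto (fun x : ℝ => 1 / uS s - Real.exp (-x)) Filter.atTop
      (nhds (1 / uS s)) := by
    simpa using Real.tendsto_exp_neg_atTop_nhds_zero.const_sub (1 / uS s)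
  refine integrableOn_Ioc_of_intervalIntegral_norm_bounded_right (I := X) (fun x => ?_) hlim ?_
  · rcases le_or_gt (1 / uS s - Real.exp (-x)) χ₀ with h | h
    · rw [Ioc_eq_empty (not_lt.2 h)]; exact integrableOn_empty
    · exact (intervalIntegrable_iff_integrableOn_Ioc_of_le h.le).1
        (charKernel_intervalIntegrable hs h0 ⟨h0.1.trans h, hlt x⟩)
  · filter_upwards [hlim.eventually (lt_mem_nhds h0.2)] with x hx
    have h1 := hcon _ ⟨hx, hlt x⟩
    rw [charInt, intervalIntegral.integral_of_le hx.le] at h1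
    refine le_trans (le_of_eq ?_) h1
    refine setIntegral_congr_fun measurableSet_Ioc fun η hη => ?_
    exact Real.norm_of_nonneg
      (charKernel_pos hs ⟨h0.1.trans hη.1, hη.2.trans_lt (hlt x)⟩).le

theorem exists_charInt_eq (hs : 1 < s) {χ₀ : ℝ} (h0 : χ₀ ∈ Ioo 0 (1 / uS s)) {x : ℝ}
    (hx : 0 ≤ x) : ∃ χ ∈ Ico χ₀ (1 / uS s), charInt s χ₀ χ = x := by
  obtain ⟨χ₁, h1, hlt⟩ := exists_charInt_gt hs h0 x
  have hsub : Icc χ₀ χ₁ ⊆ Ioo 0 (1 / uS s) := fun z hz =>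
    ⟨h0.1.trans_le hz.1, hz.2.trans_lt h1.2⟩
  obtain ⟨χ, hχ, he⟩ := intermediate_value_Icc h1.1.le ((charInt_continuousOn hs h0).mono hsub)
    ⟨by rw [charInt_self]; exact hx, hlt.le⟩
  exact ⟨χ, ⟨hχ.1, hχ.2.trans_lt h1.2⟩, he⟩

/-- The inverse of `charInt`. -/
noncomputable def charInv (s χ₀ : ℝ) : ℝ → ℝ :=
  Function.invFunOn (charInt s χ₀) (Ioo 0 (1 / uS s))

theorem charInv_charInt (hs : 1 < s) {χ₀ χ : ℝ} (h0 : χ₀ ∈ Ioo 0 (1 / uS s))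
    (h : χ ∈ Ioo 0 (1 / uS s)) : charInv s χ₀ (charInt s χ₀ χ) = χ :=
  (charInt_strictMonoOn hs h0).injOn.leftInvOn_invFunOn h

theorem charInv_mem (hs : 1 < s) {χ₀ x : ℝ} (h0 : χ₀ ∈ Ioo 0 (1 / uS s)) (hx : 0 ≤ x) :
    charInv s χ₀ x ∈ Ico χ₀ (1 / uS s) ∧ charInt s χ₀ (charInv s χ₀ x) = x := by
  obtain ⟨χ, h1, rfl⟩ := exists_charInt_eq hs h0 hx
  rw [charInv_charInt hs h0 ⟨h0.1.trans_le h1.1, h1.2⟩]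
  exact ⟨h1, rfl⟩

theorem charInv_hasDerivAt (hs : 1 < s) {χ₀ x : ℝ} (h0 : χ₀ ∈ Ioo 0 (1 / uS s)) (hx : 0 ≤ x) :
    HasDerivAt (charInv s χ₀) (charKernel s (charInv s χ₀ x))⁻¹ x := by
  obtain ⟨χ, h1, rfl⟩ := exists_charInt_eq hs h0 hx
  have hχ : χ ∈ Ioo 0 (1 / uS s) := ⟨h0.1.trans_le h1.1, h1.2⟩
  have hmono := charInt_strictMonoOn hs h0
  -- Points on both sides of `χ` show that the image is a neighbourhood, so the inverse is
  -- differentiable on both sides even at x = 0, where χ = χ₀; this gives a two-sided derivative at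
  -- y = m.
  have hJ : charInt s χ₀ '' Ioo 0 (1 / uS s) ∈ nhds (charInt s χ₀ χ) := by
    obtain ⟨z₁, hz1, hz1'⟩ := exists_between hχ.1
    obtain ⟨z₂, hz2, hz2'⟩ := exists_between hχ.2
    have m1 : z₁ ∈ Ioo 0 (1 / uS s) := ⟨hz1, hz1'.trans hχ.2⟩
    have m2 : z₂ ∈ Ioo 0 (1 / uS s) := ⟨hχ.1.trans hz2, hz2'⟩
    have hsub : Icc z₁ z₂ ⊆ Ioo 0 (1 / uS s) := fun z hz =>
      ⟨hz1.trans_le hz.1, hz.2.trans_lt hz2'⟩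
    refine Filter.mem_of_superset (Icc_mem_nhds (hmono m1 hχ hz1') (hmono hχ m2 hz2)) ?_
    exact (intermediate_value_Icc (hz1'.trans hz2).le
      ((charInt_continuousOn hs h0).mono hsub)).trans (image_mono hsub)
  have hinvmono : StrictMonoOn (charInv s χ₀) (charInt s χ₀ '' Ioo 0 (1 / uS s)) := by
    rintro _ ⟨z, hz, rfl⟩ _ ⟨w, hw, rfl⟩ hlt
    rw [charInv_charInt hs h0 hz, charInv_charInt hs h0 hw]
    exact (hmono.lt_iff_lt hz hw).1 hlt
  have himg : charInv s χ₀ '' (charInt s χ₀ '' Ioo 0 (1 / uS s)) = Ioo 0 (1 / uS s) := by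
    ext z
    constructor
    · rintro ⟨_, ⟨w, hw, rfl⟩, rfl⟩
      rwa [charInv_charInt hs h0 hw]
    · exact fun hz => ⟨_, ⟨z, hz, rfl⟩, charInv_charInt hs h0 hz⟩
  have hcont : ContinuousAt (charInv s χ₀) (charInt s χ₀ χ) := by
    refine hinvmono.continuousAt_of_image_mem_nhds hJ ?_
    rw [himg, charInv_charInt hs h0 hχ]
    exact isOpen_Ioo.mem_nhds hχ
  refine HasDerivAt.of_local_left_inverse hcont ?_ ?_ ?_ (f := charInt s χ₀)
  · rw [charInv_charInt hs h0 hχ]; exact charInt_hasDerivAt hs h0 hχ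
  · rw [charInv_charInt hs h0 hχ]; exact (charKernel_pos hs hχ).ne'
  · filter_upwards [hJ]
    rintro _ ⟨z, hz, rfl⟩
    rw [charInv_charInt hs h0 hz]

/-- Integrability keeps ϕ/y below the double root, where the integral is injective; this gives
existence and uniqueness of the root together. -/
theorem isCharRoot_iff (hs : 1 < s) {χ₀ m y ϕ : ℝ} (h0 : χ₀ ∈ Ioo 0 (1 / uS s))
    (hy : y ∈ Ioc 0 m) (hϕ : 0 < ϕ) :
    IsCharRoot s χ₀ m y ϕ ↔ ϕ = y * charInv s χ₀ (Real.log (m / y)) := by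
  have hx : 0 ≤ Real.log (m / y) := Real.log_nonneg ((one_le_div hy.1).2 hy.2)
  obtain ⟨h1, h2⟩ := charInv_mem hs h0 hx
  have h1' : charInv s χ₀ (Real.log (m / y)) ∈ Ioo 0 (1 / uS s) := ⟨h0.1.trans_le h1.1, h1.2⟩
  constructor
  · rintro ⟨hi, he⟩
    have hlt : ϕ / y < 1 / uS s := by
      by_contra! hge
      exact charKernel_not_intervalIntegrable hs (h0.2.trans_le hge).ne
        (mem_uIcc_of_le h0.2.le hge) hi
    have hm : ϕ / y ∈ Ioo 0 (1 / uS s) := ⟨div_pos hϕ hy.1, hlt⟩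
    have : ϕ / y = charInv s χ₀ (Real.log (m / y)) :=
      (charInt_strictMonoOn hs h0).injOn hm h1' (Eq.trans he h2.symm)
    rw [← this, mul_div_cancel₀ _ hy.1.ne']
  · rintro rfl
    unfold IsCharRoot
    rw [mul_div_cancel_left₀ _ hy.1.ne']
    exact ⟨charKernel_intervalIntegrable hs h0 h1', h2⟩

end CharRoot

/-! ### Solutions of the differential equation below the price f'(1) -/

/-- `y ↦ a * s * ϕ y ^ (s - 1)` is a pricing function on `[0, m]` along which the potential of the
price grows as fast as the ratio `α` requires. -/
structure IsLowSegment (s α m : ℝ) (ϕ : ℝ → ℝ) : Prop where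
  zero : ϕ 0 = 0
  pos : ∀ y ∈ Ioc 0 m, 0 < ϕ y
  mono : StrictMonoOn ϕ (Ioc 0 m)
  linear : ∃ c, ∀ y ∈ Ioc 0 m, ϕ y ≤ c * y
  ode : ∀ y ∈ Ioc 0 m, ∃ d, HasDerivAt ϕ d y ∧
    (s - 1) * d * ϕ y ^ (s - 1) = α * (ϕ y ^ (s - 1) - y ^ (s - 1))

/-- The linear solutions of the homogeneous equation. They serve the boundary cases m = w and u =
u_s, where μ = u_s, and the second high-uncertainty case, where μ is the CDT. -/
theorem isLowSegment_div {s α μ m : ℝ} (hμ : 0 < μ)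
    (hα : α * (μ - μ ^ s) = s - 1) : IsLowSegment s α m fun y => y / μ where
  zero := zero_div μ
  pos y hy := div_pos hy.1 hμ
  mono y _ z _ hyz := div_lt_div_of_pos_right hyz hμ
  linear := ⟨1 / μ, fun y _ => by rw [one_div, div_eq_inv_mul]⟩
  ode y hy := by
    refine ⟨1 / μ, (hasDerivAt_id y).div_const μ, ?_⟩
    have h1 : (s - 1) * (1 / μ) = α * (1 - μ ^ (s - 1)) := by
      rw [rpow_eq_mul_rpow_sub_one hμ s] at hα
      rw [mul_one_div, div_eq_iff hμ.ne']; linear_combination -hα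
    have := (Real.rpow_pos_of_pos hμ (s - 1)).ne'
    rw [Real.div_rpow hy.1.le hμ.le, h1]
    field_simp

/-- With ϕ = yχ and dχ/dln(m/y) = P(χ)/χ^(s-1), the leading terms cancel in ϕ' = χ - P(χ)/χ^(s-1),
leaving α/(s-1) (1 - χ^(-(s-1))). This is positive exactly for χ > 1, hence the condition χ₀ ≥ 1. -/
theorem isLowSegment_charInv {s χ₀ m : ℝ} (hs : 1 < s) (h0 : χ₀ ∈ Ico 1 (1 / uS s)) :
    IsLowSegment s (alphaMin s) m fun y => y * charInv s χ₀ (Real.log (m / y)) := by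
  have h0' : χ₀ ∈ Ioo 0 (1 / uS s) := ⟨zero_lt_one.trans_le h0.1, h0.2⟩
  have hx : ∀ y ∈ Ioc 0 m, 0 ≤ Real.log (m / y) := fun y hy =>
    Real.log_nonneg ((one_le_div hy.1).2 hy.2)
  have hχ := fun y (hy : y ∈ Ioc 0 m) => (charInv_mem hs h0' (hx y hy)).1
  have hder : ∀ y ∈ Ioc 0 m, HasDerivAt (fun y => y * charInv s χ₀ (Real.log (m / y)))
      (alphaMin s / (s - 1) * (1 - (charInv s χ₀ (Real.log (m / y)) ^ (s - 1))⁻¹)) y := by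
    intro y hy
    have hm : 0 < m := hy.1.trans_le hy.2
    have h1 : HasDerivAt (fun y => Real.log (m / y)) (-(1 / y)) y := by
      have h2 : HasDerivAt (fun y => m / y) (m * -(y ^ 2)⁻¹) y := by
        simpa only [div_eq_mul_inv] using (hasDerivAt_inv hy.1.ne').const_mul m
      refine (h2.log (div_pos hm hy.1).ne').congr_deriv ?_
      have := hy.1.ne'
      field_simp
    have h2 := (hasDerivAt_id y).mul
      (HasDerivAt.comp y (charInv_hasDerivAt hs h0' (hx y hy)) h1)
    refine h2.congr_deriv ?_
    set χ := charInv s χ₀ (Real.log (m / y)) with hχd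
    have hχ0 : 0 < χ := h0'.1.trans_le (hχ y hy).1
    have hP := (charPoly_pos hs hχ0 (hχ y hy).2.ne).ne'
    have hχs := (Real.rpow_pos_of_pos hχ0 (s - 1)).ne'
    have hy0 := hy.1.ne'
    have hs1 : s - 1 ≠ 0 := by linarith
    change 1 * χ + y * ((charKernel s χ)⁻¹ * -(1 / y)) = _
    rw [charKernel, inv_div, charPoly, rpow_eq_mul_rpow_sub_one hχ0 s]
    field_simp
    ring
  refine ⟨zero_mul _, fun y hy => mul_pos hy.1 (h0'.1.trans_le (hχ y hy).1), ?_,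
    ⟨1 / uS s, fun y hy => ?_⟩, fun y hy => ⟨_, hder y hy, ?_⟩⟩
  · refine strictMonoOn_of_deriv_pos (convex_Ioc 0 m)
      (fun y hy => (hder y hy).continuousAt.continuousWithinAt) fun y hy => ?_
    rw [interior_Ioc] at hy
    have hy' : y ∈ Ioc 0 m := ⟨hy.1, hy.2.le⟩
    rw [(hder y hy').deriv]
    have hlog : 0 < Real.log (m / y) := Real.log_pos ((one_lt_div hy.1).2 hy.2)
    -- Equality would force χ = χ₀ = 1, where the integral is 0 and not log(m/y) > 0.
    have h1 : 1 < charInv s χ₀ (Real.log (m / y)) := by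
      refine lt_of_le_of_ne (h0.1.trans (hχ y hy').1) fun h => ?_
      have h2 := (charInv_mem hs h0' hlog.le)
      have h3 : charInv s χ₀ (Real.log (m / y)) = χ₀ := le_antisymm (h ▸ h0.1) h2.1.1
      rw [h3, charInt_self] at h2
      linarith [h2.2]
    have h2 : ((charInv s χ₀ (Real.log (m / y))) ^ (s - 1))⁻¹ < 1 :=
      inv_lt_one_of_one_lt₀ (Real.one_lt_rpow h1 (by linarith))
    exact mul_pos (div_pos (by linarith [one_lt_alphaMin hs]) (by linarith)) (by linarith)
  · rw [mul_comm]
    exact mul_le_mul_of_nonneg_right (hχ y hy).2.le hy.1.le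
  · have hχ0 : 0 < charInv s χ₀ (Real.log (m / y)) := h0'.1.trans_le (hχ y hy).1
    have hχs := (Real.rpow_pos_of_pos hχ0 (s - 1)).ne'
    rw [Real.mul_rpow hy.1.le hχ0.le]
    have hs1 : s - 1 ≠ 0 := by linarith
    field_simp

/-- The price with utilization equivalent `ϕ y = f'⁻¹ (price)`. -/
noncomputable def lowPrice (a s : ℝ) (ϕ : ℝ → ℝ) (y : ℝ) : ℝ := a * s * ϕ y ^ (s - 1)

/-- A primitive of `lowPrice` along a low segment. -/
noncomputable def lowPotential (a s α : ℝ) (ϕ : ℝ → ℝ) (y : ℝ) : ℝ :=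
  a * y ^ s + (s - 1) * a / α * ϕ y ^ s

namespace IsLowSegment

variable {a s α m : ℝ} {ϕ : ℝ → ℝ}

theorem nonneg (h : IsLowSegment s α m ϕ) {y : ℝ} (hy : y ∈ Icc 0 m) : 0 ≤ ϕ y := by
  rcases hy.1.eq_or_lt with rfl | h0
  · rw [h.zero]
  · exact (h.pos y ⟨h0, hy.2⟩).le

theorem strictMonoOn (h : IsLowSegment s α m ϕ) : StrictMonoOn ϕ (Icc 0 m) := by
  intro y hy z hz hyz
  have hz' : z ∈ Ioc 0 m := ⟨hy.1.trans_lt hyz, hz.2⟩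
  rcases hy.1.eq_or_lt with rfl | h0
  · rw [h.zero]; exact h.pos z hz'
  · exact h.mono ⟨h0, hy.2⟩ hz' hyz

theorem continuousOn (h : IsLowSegment s α m ϕ) : ContinuousOn ϕ (Icc 0 m) := by
  intro y hy
  rcases hy.1.eq_or_lt with rfl | h0
  · obtain ⟨c, hc⟩ := h.linear
    have hlim : Filter.Tendsto (fun y : ℝ => c * y) (nhdsWithin 0 (Icc 0 m)) (nhds 0) := by
      have : Filter.Tendsto (fun y : ℝ => c * y) (nhds 0) (nhds (c * 0)) :=
        (continuous_const.mul continuous_id).tendsto 0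
      rw [mul_zero] at this
      exact this.mono_left nhdsWithin_le_nhds
    rw [ContinuousWithinAt, h.zero]
    refine tendsto_of_tendsto_of_tendsto_of_le_of_le' tendsto_const_nhds hlim ?_ ?_
    · filter_upwards [self_mem_nhdsWithin] with z hz using h.nonneg hz
    · filter_upwards [self_mem_nhdsWithin] with z hz
      rcases hz.1.eq_or_lt with rfl | hz0
      · rw [h.zero, mul_zero]
      · exact hc z ⟨hz0, hz.2⟩
  · obtain ⟨d, hd, -⟩ := h.ode y ⟨h0, hy.2⟩
    exact hd.continuousAt.continuousWithinAt

theorem lowPrice_zero (h : IsLowSegment s α m ϕ) (hs : 1 < s) : lowPrice a s ϕ 0 = 0 := by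
  rw [lowPrice, h.zero, Real.zero_rpow (by linarith), mul_zero]

theorem lowPrice_strictMonoOn (h : IsLowSegment s α m ϕ) (ha : 0 < a) (hs : 1 < s) :
    StrictMonoOn (lowPrice a s ϕ) (Icc 0 m) := fun _ hy _ hz hyz =>
  mul_lt_mul_of_pos_left (Real.rpow_lt_rpow (h.nonneg hy) (h.strictMonoOn hy hz hyz)
    (by linarith)) (mul_pos ha (by linarith))

theorem lowPrice_continuousOn (h : IsLowSegment s α m ϕ) (hs : 1 < s) :
    ContinuousOn (lowPrice a s ϕ) (Icc 0 m) :=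
  continuousOn_const.mul (h.continuousOn.rpow_const fun _ _ => Or.inr (by linarith))

theorem lowPotential_zero (h : IsLowSegment s α m ϕ) (hs : 1 < s) :
    lowPotential a s α ϕ 0 = 0 := by
  rw [lowPotential, h.zero, Real.zero_rpow (by linarith)]; ring

theorem lowPotential_continuousOn (h : IsLowSegment s α m ϕ) (hs : 1 < s) :
    ContinuousOn (lowPotential a s α ϕ) (Icc 0 m) :=
  (continuousOn_const.mul (continuousOn_id.rpow_const fun _ _ => Or.inr (by linarith))).add
    (continuousOn_const.mul (h.continuousOn.rpow_const fun _ _ => Or.inr (by linarith)))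

/-- The potential is defined by α (F - f) = (s-1) a ϕ^s, the conjugate of the cost at price f'(ϕ);
the differential equation is precisely F' = φ. -/
theorem lowPotential_hasDerivAt (h : IsLowSegment s α m ϕ) (hα : 0 < α) {y : ℝ}
    (hy : y ∈ Ioc 0 m) : HasDerivAt (lowPotential a s α ϕ) (lowPrice a s ϕ y) y := by
  obtain ⟨d, hd, hode⟩ := h.ode y hy
  have h1 := ((Real.hasDerivAt_rpow_const (p := s) (Or.inl hy.1.ne')).const_mul a).add
    ((hd.rpow_const (p := s) (Or.inl (h.pos y hy).ne')).const_mul ((s - 1) * a / α))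
  refine h1.congr_deriv ?_
  unfold lowPrice
  field_simp
  linear_combination (a * s) * hode

theorem lowPotential_sub_bounds (h : IsLowSegment s α m ϕ) (ha : 0 < a) (hs : 1 < s)
    (hα : 0 < α) {y z : ℝ} (hy : 0 ≤ y) (hyz : y ≤ z) (hz : z ≤ m) :
    lowPotential a s α ϕ z - lowPotential a s α ϕ y ≤ lowPrice a s ϕ z * (z - y) :=
  (primitive_sub_bounds hyz
    ((h.lowPotential_continuousOn hs).mono (Icc_subset_Icc hy hz))
    (fun _ hx => h.lowPotential_hasDerivAt hα ⟨hy.trans_lt hx.1, hx.2.le.trans hz⟩)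
    ((h.lowPrice_strictMonoOn ha hs).monotoneOn.mono (Icc_subset_Icc hy hz))).2

/-- This is the tangent inequality at ϕ(y), the quantity at which marginal cost equals the price. -/
theorem lowPrice_dual (h : IsLowSegment s α m ϕ) (ha : 0 < a) (hs : 1 < s) (hα : 0 < α)
    {y Y : ℝ} (hy : y ∈ Icc 0 m) (hY : 0 ≤ Y) :
    lowPrice a s ϕ y * Y - a * Y ^ s ≤ α * (lowPotential a s α ϕ y - a * y ^ s) := by
  have h1 := mul_le_mul_of_nonneg_left (rpow_tangent_le hs (h.nonneg hy) hY) ha.le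
  have h2 : α * (lowPotential a s α ϕ y - a * y ^ s) = (s - 1) * a * ϕ y ^ s := by
    unfold lowPotential; field_simp; ring
  rw [h2]
  unfold lowPrice
  rw [rpow_eq_mul_rpow_sub_one' hs (h.nonneg hy)] at h1 ⊢
  linarith

end IsLowSegment

/-! ### Extension to [0, 1] and competitiveness -/

theorem strictMonoOn_ite {f g : ℝ → ℝ} {l m h : ℝ} (hf : StrictMonoOn f (Icc l m))
    (hg : StrictMonoOn g (Icc m h)) (hfg : f m ≤ g m) (hlm : l ≤ m) (hmh : m ≤ h) :
    StrictMonoOn (fun y => if y < m then f y else g y) (Icc l h) := by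
  intro y hy z hz hyz
  simp only
  by_cases hzm : z < m
  · rw [if_pos hzm, if_pos (hyz.trans hzm)]
    exact hf ⟨hy.1, (hyz.trans hzm).le⟩ ⟨hz.1, hzm.le⟩ hyz
  · rw [if_neg hzm]
    push Not at hzm
    by_cases hym : y < m
    · rw [if_pos hym]
      exact (hf ⟨hy.1, hym.le⟩ ⟨hlm, le_rfl⟩ hym).trans_le
        (hfg.trans (hg.monotoneOn ⟨le_rfl, hmh⟩ ⟨hzm, hz.2⟩ hzm))
    · rw [if_neg hym]
      push Not at hym
      exact hg ⟨hym, hy.2⟩ ⟨hzm, hz.2⟩ hyz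

theorem isPricingFunction_of_strictMonoOn {φ : ℝ → ℝ} (h : StrictMonoOn φ (Icc 0 1))
    (h0 : 0 ≤ φ 0) : IsPricingFunction φ :=
  ⟨h, fun _ hy => h0.trans (h.monotoneOn ⟨le_rfl, zero_le_one⟩ hy hy.1)⟩

theorem exists_pricing_low {a s α m p : ℝ} {ϕ : ℝ → ℝ} (ha : 0 < a) (hs : 1 < s)
    (h : IsLowSegment s α m ϕ) (hm0 : 0 < m) (hm1 : m ≤ 1) (hp : lowPrice a s ϕ m = p) :
    ∃ φ, IsPricingFunction φ ∧ ∀ y ∈ Icc 0 m, φ y = lowPrice a s ϕ y := by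
  refine ⟨fun y => if y < m then lowPrice a s ϕ y else p + (y - m),
    isPricingFunction_of_strictMonoOn (strictMonoOn_ite (h.lowPrice_strictMonoOn ha hs)
      (fun y _ z _ hyz => by simpa using hyz) (by simp [hp]) hm0.le hm1)
      (by simp [hm0, h.lowPrice_zero hs]), fun y hy => ?_⟩
  rcases hy.2.lt_or_eq with hlt | rfl
  · simp [hlt]
  · simp [hp]

theorem exists_pricing_high {a s α u ρ p : ℝ} {ϕ : ℝ → ℝ} (ha : 0 < a) (hs : 1 < s)
    (h : IsLowSegment s α u ϕ) (hu : 0 < u) (huρ : u < ρ) (hρ : ρ ≤ 1) (hϕu : ϕ u = 1)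
    (hp : phiIvp a s ρ u = p) :
    ∃ φ, IsPricingFunction φ ∧ (∀ y ∈ Icc 0 u, φ y = lowPrice a s ϕ y) ∧
      ∀ y ∈ Icc u ρ, φ y = phiIvp a s y u := by
  have hlow : lowPrice a s ϕ u = a * s := by rw [lowPrice, hϕu, Real.one_rpow, mul_one]
  have hhigh : StrictMonoOn (fun y => if y < ρ then phiIvp a s y u else p + (y - ρ)) (Icc u 1) :=
    strictMonoOn_ite ((phiIvp_strictMonoOn ha hs hu).mono (Icc_subset_Icc_right hρ))
      (fun y _ z _ hyz => by simpa using hyz) (by simp [hp]) huρ.le hρ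
  refine ⟨fun y => if y < u then lowPrice a s ϕ y else
      if y < ρ then phiIvp a s y u else p + (y - ρ),
    isPricingFunction_of_strictMonoOn (strictMonoOn_ite (h.lowPrice_strictMonoOn ha hs) hhigh
      (by simp [huρ, hlow, phiIvp_self]) hu.le (huρ.le.trans hρ))
      (by simp [hu, h.lowPrice_zero hs]), fun y hy => ?_, fun y hy => ?_⟩
  · rcases hy.2.lt_or_eq with hlt | rfl
    · simp [hlt]
    · simp [huρ, hlow, phiIvp_self]
  · rcases hy.2.lt_or_eq with hlt | rfl
    · simp [hlt, not_lt.2 hy.1]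
    · simp [not_lt.2 hy.1, hp]

namespace Setup

variable {K B : Type*} [Fintype K] [Finite B]

theorem competitive_low (S : Setup K B) {a s α m : ℝ} {ϕ φ : ℝ → ℝ} (ha : 0 < a) (hs : 1 < s)
    (hcost : ∀ y ∈ Icc (0 : ℝ) 1, S.cost y = a * y ^ s) (hp : 0 < S.pbar) (hα : 1 ≤ α)
    (h : IsLowSegment s α m ϕ) (hm0 : 0 < m) (hm1 : m ≤ 1) (hφ : IsPricingFunction φ)
    (hlow : ∀ y ∈ Icc 0 m, φ y = lowPrice a s ϕ y) (hm : φ m = S.pbar) :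
    S.Competitive (S.PPM φ) α := by
  have hα0 : 0 < α := by linarith
  refine S.competitive_of_potential (F := lowPotential a s α ϕ) (m := m) ha hs hcost hp hα hφ hm1
    (h.lowPotential_zero hs).le ?_ ?_ ?_ ?_ ?_
  · intro y y' h0 h1 h2
    rw [hlow y' ⟨h0.trans h1, h2.le⟩]
    exact h.lowPotential_sub_bounds ha hs hα0 h0 h1 h2.le
  · intro y h0 h1 Y hY
    rw [hlow y ⟨h0, h1.le⟩]
    exact h.lowPrice_dual ha hs hα0 ⟨h0, h1.le⟩ hY.1
  · intro y h0 h1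
    rw [← hm]
    exact hφ.1.monotoneOn ⟨h0, h1.le.trans hm1⟩ ⟨hm0.le, hm1⟩ h1.le
  · intro η hη
    have hc : ContinuousWithinAt (lowPrice a s ϕ) (Iio m) m :=
      ((h.lowPrice_continuousOn hs) m ⟨hm0.le, le_rfl⟩).mono_of_mem_nhdsWithin
        (Icc_mem_nhdsLT hm0)
    have hm' : lowPrice a s ϕ m = S.pbar := by rw [← hm, hlow m ⟨hm0.le, le_rfl⟩]
    obtain ⟨y, hy, hy'⟩ := ((hc.eventually (lt_mem_nhds
      (show S.pbar - η < lowPrice a s ϕ m by linarith))).and (Ioo_mem_nhdsLT hm0)).exists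
    refine ⟨y, hy'.1.le, hy'.2, ?_⟩
    rwa [hlow y ⟨hy'.1.le, hy'.2.le⟩]
  · intro y h0 h1
    rw [← hm]
    exact hφ.1 ⟨hm0.le, hm1⟩ ⟨hm0.le.trans h0.le, h1⟩ h0

theorem competitive_high (S : Setup K B) {a s u ρ : ℝ} {ϕ φ : ℝ → ℝ} (ha : 0 < a) (hs : 1 < s)
    (hcost : ∀ y ∈ Icc (0 : ℝ) 1, S.cost y = a * y ^ s) (hp : 0 < S.pbar)
    (h : IsLowSegment s (alphaOne s u) u ϕ) (hu : 0 < u) (huρ : u < ρ) (hρ : ρ ≤ 1)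
    (hϕu : ϕ u = 1) (hφ : IsPricingFunction φ)
    (hlow : ∀ y ∈ Ico 0 u, φ y = lowPrice a s ϕ y)
    (hhigh : ∀ y ∈ Ico u ρ, φ y = phiIvp a s y u) (hpρ : phiIvp a s ρ u = S.pbar)
    (hgt : ∀ y, ρ < y → y ≤ 1 → S.pbar < φ y) :
    S.Competitive (S.PPM φ) (alphaOne s u) := by
  set α := alphaOne s u with hα
  have hα0 : 0 < α := alphaOne_pos hs hu
  have hα1 : 1 ≤ α := by linarith [alphaMin_le_alphaOne hs hu, one_lt_alphaMin hs]
  have hlowu : lowPrice a s ϕ u = a * s := by rw [lowPrice, hϕu, Real.one_rpow, mul_one]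
  have hlow' : ∀ y ∈ Icc 0 u, φ y = lowPrice a s ϕ y := by
    intro y hy
    rcases hy.2.lt_or_eq with hlt | rfl
    · exact hlow y ⟨hy.1, hlt⟩
    · rw [hhigh y ⟨le_rfl, huρ⟩, phiIvp_self, hlowu]
  have hFu : lowPotential a s α ϕ u = ivpPotential a s u u := by
    rw [lowPotential, ivpPotential, hϕu, Real.one_rpow, phiIvp_self, ← hα]; ring
  set F : ℝ → ℝ := fun y => if y < u then lowPotential a s α ϕ y else ivpPotential a s u y with hF
  have hF1 : ∀ y ≤ u, F y = lowPotential a s α ϕ y := by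
    intro y hy
    rcases hy.lt_or_eq with hlt | rfl
    · simp [hF, hlt]
    · simp [hF, hFu]
  have hF2 : ∀ y, u ≤ y → F y = ivpPotential a s u y := fun y hy => if_neg (not_lt.2 hy)
  have hmono := phiIvp_strictMonoOn (a := a) ha hs hu
  have hinc1 : ∀ y y', 0 ≤ y → y ≤ y' → y' ≤ u → F y' - F y ≤ φ y' * (y' - y) := by
    intro y y' h0 h1 h2
    rw [hF1 y (h1.trans h2), hF1 y' h2, hlow' y' ⟨h0.trans h1, h2⟩]
    exact h.lowPotential_sub_bounds ha hs hα0 h0 h1 h2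
  have hinc2 : ∀ y y', u ≤ y → y ≤ y' → y' < ρ → F y' - F y ≤ φ y' * (y' - y) := by
    intro y y' h0 h1 h2
    rw [hF2 y h0, hF2 y' (h0.trans h1), hhigh y' ⟨h0.trans h1, h2⟩]
    exact (primitive_sub_bounds h1
      ((ivpPotential_continuousOn hs hu).mono fun z hz => hu.trans_le (h0.trans hz.1))
      (fun z hz => ivpPotential_hasDerivAt hs hu (hu.trans_le (h0.trans hz.1.le)))
      (hmono.monotoneOn.mono (Icc_subset_Icc h0 (h2.le.trans hρ)))).2
  refine S.competitive_of_potential (F := F) (m := ρ) ha hs hcost hp hα1 hφ hρ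
    (by rw [hF1 0 hu.le, h.lowPotential_zero hs]) ?_ ?_ ?_ ?_ hgt
  · intro y y' h0 h1 h2
    rcases le_total y' u with hy' | hy'
    · exact hinc1 y y' h0 h1 hy'
    rcases le_total u y with hy | hy
    · exact hinc2 y y' hy h1 h2
    · have h3 := hinc1 y u h0 hy le_rfl
      have h4 := hinc2 u y' le_rfl hy' h2
      have h5 : φ u ≤ φ y' := hφ.1.monotoneOn ⟨hu.le, huρ.le.trans hρ⟩
        ⟨h0.trans h1, h2.le.trans hρ⟩ hy'
      have h6 := mul_le_mul_of_nonneg_right h5 (sub_nonneg.2 hy)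
      linarith
  · intro y h0 h1 Y hY
    rcases le_total y u with hy | hy
    · rw [hF1 y hy, hlow' y ⟨h0, hy⟩]
      -- On the low segment the unconstrained conjugate is used. Above `u` the price is at least
      -- f'(1), so the conjugate over [0, 1] is attained at Y = 1, where the tangent is taken.
      exact h.lowPrice_dual ha hs hα0 ⟨h0, hy⟩ hY.1
    · rw [hF2 y hy, hhigh y ⟨hy, h1⟩, ivpPotential_sub, ← hα, mul_div_cancel₀ _ hα0.ne']
      have h2 := le_phiIvp ha hs hu hy (h1.le.trans hρ)
      have h3 := mul_le_mul_of_nonneg_left (rpow_tangent_le hs zero_le_one hY.1) ha.le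
      rw [Real.one_rpow, Real.one_rpow] at h3
      nlinarith [mul_nonneg (sub_nonneg.2 h2) (sub_nonneg.2 hY.2)]
  · intro y h0 h1
    rcases lt_or_ge y u with hy | hy
    · refine (hφ.1.monotoneOn ⟨h0, h1.le.trans hρ⟩ ⟨hu.le, huρ.le.trans hρ⟩ hy.le).trans ?_
      rw [hhigh u ⟨le_rfl, huρ⟩, ← hpρ]
      exact hmono.monotoneOn ⟨le_rfl, huρ.le.trans hρ⟩ ⟨huρ.le, hρ⟩ huρ.le
    · rw [hhigh y ⟨hy, h1⟩, ← hpρ]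
      exact hmono.monotoneOn ⟨hy, h1.le.trans hρ⟩ ⟨huρ.le, hρ⟩ h1.le
  · intro η hη
    have hc : ContinuousAt (fun y => phiIvp a s y u) ρ :=
      (phiIvp_hasDerivAt hs hu (hu.trans huρ).le).continuousAt
    obtain ⟨y, hy, hy'⟩ := (((hc.eventually (lt_mem_nhds
      (show S.pbar - η < phiIvp a s ρ u by linarith))).filter_mono
        (nhdsWithin_le_nhds (s := Iio ρ))).and (Ioo_mem_nhdsLT huρ)).exists
    refine ⟨y, hu.le.trans hy'.1.le, hy'.2, ?_⟩
    rwa [hhigh y ⟨hy'.1.le, hy'.2⟩]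

end Setup

/-! ### The pricing functions of the three cases -/

section Cases

variable {a s : ℝ}

theorem invMarginalCost_pos (ha : 0 < a) (hs : 1 < s) {p : ℝ} (hp : 0 < p) :
    0 < invMarginalCost a s p :=
  Real.rpow_pos_of_pos (div_pos hp (mul_pos ha (by linarith))) _

/-- So w = v u_s, and v/m runs through [1, 1/u_s) exactly for m in (w, v], reaching the double root
at m = w. -/
theorem invMarginalCost_div (ha : 0 < a) (hs : 1 < s) {p : ℝ} (hp : 0 < p) :
    invMarginalCost a s (p / s) = invMarginalCost a s p * uS s := by
  have h0 : 0 < s := by linarith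
  rw [invMarginalCost, invMarginalCost, uS, ← Real.mul_rpow (by positivity) (by positivity)]
  congr 1
  field_simp

theorem mul_invMarginalCost_rpow (ha : 0 < a) (hs : 1 < s) {p : ℝ} (hp : 0 < p) :
    a * s * invMarginalCost a s p ^ (s - 1) = p := by
  have h0 : 0 < a * s := mul_pos ha (by linarith)
  rw [invMarginalCost, ← Real.rpow_mul (by positivity), one_div_mul_cancel (by linarith),
    Real.rpow_one, mul_div_cancel₀ _ h0.ne']

theorem invMarginalCost_le_one (ha : 0 < a) (hs : 1 < s) {p : ℝ} (hp : 0 < p) (hpc : p ≤ a * s) :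
    invMarginalCost a s p ≤ 1 := by
  have h0 : 0 < a * s := mul_pos ha (by linarith)
  exact Real.rpow_le_one (by positivity) ((div_le_one h0).2 hpc) (one_div_pos.2 (by linarith)).le

theorem lowPrice_div_uS (hs : 1 < s) {y : ℝ} (hy : 0 ≤ y) :
    lowPrice a s (fun y => y / uS s) y = s * marginalCost a s y := by
  rw [lowPrice, marginalCost, Real.div_rpow hy (uS_pos hs).le, uS_rpow hs]
  field_simp

theorem charInv_zero (hs : 1 < s) {χ₀ : ℝ} (h0 : χ₀ ∈ Ico 1 (1 / uS s)) : charInv s χ₀ 0 = χ₀ := by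
  have h0' : χ₀ ∈ Ioo 0 (1 / uS s) := ⟨zero_lt_one.trans_le h0.1, h0.2⟩
  have := charInv_charInt hs h0' h0'
  rwa [charInt_self] at this

theorem low_div_mem (hs : 1 < s) {m v : ℝ} (hm : m ∈ Ioc (v * uS s) v) (hv : 0 < v) :
    v / m ∈ Ico 1 (1 / uS s) := by
  have h0 := uS_pos hs
  have hm0 : 0 < m := (mul_pos hv h0).trans hm.1
  refine ⟨(one_le_div hm0).2 hm.2, ?_⟩
  rw [div_lt_div_iff₀ hm0 h0, one_mul]
  exact hm.1

theorem existsUnique_charRoot_low (hs : 1 < s) {m v : ℝ} (hm : m ∈ Ioc (v * uS s) v) (hv : 0 < v)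
    (hv1 : v ≤ 1) {y : ℝ} (hy : y ∈ Ioc 0 m) :
    ∃! ϕ, ϕ ∈ Ioc (0 : ℝ) 1 ∧ IsCharRoot s (v / m) m y ϕ := by
  have h0 := low_div_mem hs hm hv
  have h0' : v / m ∈ Ioo 0 (1 / uS s) := ⟨zero_lt_one.trans_le h0.1, h0.2⟩
  have hm0 : 0 < m := hy.1.trans_le hy.2
  have hseg := isLowSegment_charInv (m := m) hs h0
  have hpos := hseg.pos y hy
  have hle := hseg.mono.monotoneOn hy ⟨hm0, le_rfl⟩ hy.2
  simp only [div_self hm0.ne', Real.log_one, charInv_zero hs h0, mul_div_cancel₀ _ hm0.ne'] at hle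
  exact ⟨_, ⟨⟨hpos, hle.trans hv1⟩, (isCharRoot_iff hs h0' hy hpos).2 rfl⟩,
    fun ϕ hϕ => (isCharRoot_iff hs h0' hy hϕ.1.1).1 hϕ.2⟩

theorem existsUnique_charRoot_high (hs : 1 < s) {u : ℝ} (hu : u ∈ Ioo (uS s) 1) {y : ℝ}
    (hy : y ∈ Ioo 0 u) : ∃! ϕ, ϕ ∈ Ioo (0 : ℝ) 1 ∧ IsCharRoot s (1 / u) u y ϕ := by
  have hu0 : 0 < u := (uS_pos hs).trans hu.1
  have h0 : 1 / u ∈ Ico 1 (1 / uS s) :=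
    ⟨(one_le_div hu0).2 hu.2.le, one_div_lt_one_div_of_lt (uS_pos hs) hu.1⟩
  have h0' : 1 / u ∈ Ioo 0 (1 / uS s) := ⟨zero_lt_one.trans_le h0.1, h0.2⟩
  have hseg := isLowSegment_charInv (m := u) hs h0
  have hy' : y ∈ Ioc 0 u := ⟨hy.1, hy.2.le⟩
  have hpos := hseg.pos y hy'
  have hlt := hseg.mono hy' ⟨hu0, le_rfl⟩ hy.2
  simp only [div_self hu0.ne', Real.log_one, charInv_zero hs h0,
    mul_one_div_cancel hu0.ne'] at hlt
  exact ⟨_, ⟨⟨hpos, hlt⟩, (isCharRoot_iff hs h0' hy' hpos).2 rfl⟩,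
    fun ϕ hϕ => (isCharRoot_iff hs h0' hy' hϕ.1.1).1 hϕ.2⟩

/-- The integral equation and its degenerate case m = w are unified into one low segment. It ends at
ϕ(m) = v, that is, at the price bound. -/
theorem exists_lowSegment_isPhiLUC (ha : 0 < a) (hs : 1 < s) {p : ℝ} (hp : 0 < p)
    (hpc : p ≤ a * s) {m : ℝ}
    (hm : m ∈ Icc (invMarginalCost a s (p / s)) (invMarginalCost a s p)) :
    ∃ ϕ, IsLowSegment s (alphaMin s) m ϕ ∧ lowPrice a s ϕ m = p ∧
      ∀ φ, IsPhiLUC a s p m φ ↔ ∀ y ∈ Icc 0 m, φ y = lowPrice a s ϕ y := by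
  have hv := invMarginalCost_pos ha hs hp
  have hv1 := invMarginalCost_le_one ha hs hp hpc
  have hw := invMarginalCost_div ha hs hp
  have hpv := mul_invMarginalCost_rpow ha hs hp
  set v := invMarginalCost a s p with hvd
  have hμ := uS_pos hs
  unfold IsPhiLUC
  rw [← hvd, hw]
  rw [hw] at hm
  have hm0 : 0 < m := (mul_pos hv hμ).trans_le hm.1
  by_cases hmw : m = v * uS s
  · refine ⟨fun y => y / uS s, isLowSegment_div hμ (alphaMin_mul hs), ?_, fun φ => ?_⟩
    · rw [lowPrice, hmw, mul_div_cancel_right₀ _ hμ.ne', hpv]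
    · constructor
      · rintro ⟨h, -⟩ y hy
        rw [h hmw y hy, lowPrice_div_uS hs hy.1]
      · intro h
        refine ⟨fun _ y hy => ?_, fun h' => absurd hmw h'⟩
        rw [h y hy, lowPrice_div_uS hs hy.1]
  · have hm' : m ∈ Ioc (v * uS s) v := ⟨lt_of_le_of_ne hm.1 (Ne.symm hmw), hm.2⟩
    have h0 := low_div_mem hs hm' hv
    have h0' : v / m ∈ Ioo 0 (1 / uS s) := ⟨zero_lt_one.trans_le h0.1, h0.2⟩
    have hseg := isLowSegment_charInv (m := m) hs h0
    refine ⟨_, hseg, ?_, fun φ => ?_⟩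
    · simp only [lowPrice, div_self hm0.ne', Real.log_one, charInv_zero hs h0,
        mul_div_cancel₀ _ hm0.ne', hpv]
    · constructor
      · rintro ⟨-, h⟩ y hy
        obtain ⟨h1, h2⟩ := h hmw
        rcases hy.1.eq_or_lt with rfl | hy0
        · rw [h1, hseg.lowPrice_zero hs]
        · obtain ⟨ϕ, hϕ, hr, he⟩ := h2 y ⟨hy0, hy.2⟩
          rw [he, (isCharRoot_iff hs h0' ⟨hy0, hy.2⟩ hϕ.1).1 hr, lowPrice]
      · intro h
        refine ⟨fun h' => absurd h' hmw, fun _ => ⟨?_, fun y hy => ?_⟩⟩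
        · rw [h 0 ⟨le_rfl, hm0.le⟩, hseg.lowPrice_zero hs]
        · obtain ⟨ϕ, ⟨hϕ, hr⟩, -⟩ := existsUnique_charRoot_low hs hm' hv hv1 hy
          refine ⟨ϕ, hϕ, hr, ?_⟩
          rw [h y ⟨hy.1.le, hy.2⟩, (isCharRoot_iff hs h0' hy hϕ.1).1 hr, lowPrice]

theorem exists_lowSegment_isPhiHUC (hs : 1 < s) (a : ℝ) {u : ℝ} (hu : u ∈ Ico (uS s) 1) :
    ∃ ϕ, IsLowSegment s (alphaMin s) u ϕ ∧ ϕ u = 1 ∧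
      ∀ ρ φ, IsPhiHUC a s u ρ φ ↔
        (∀ y ∈ Ico 0 u, φ y = lowPrice a s ϕ y) ∧ ∀ y ∈ Icc u ρ, φ y = phiIvp a s y u := by
  have hμ := uS_pos hs
  have hu0 : 0 < u := hμ.trans_le hu.1
  unfold IsPhiHUC
  by_cases huμ : u = uS s
  · refine ⟨fun y => y / uS s, isLowSegment_div hμ (alphaMin_mul hs), ?_, fun ρ φ => ?_⟩
    · rw [huμ]; exact div_self hμ.ne'
    · constructor
      · rintro ⟨h, -, h'⟩
        refine ⟨fun y hy => ?_, h'⟩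
        rw [h huμ y hy, lowPrice_div_uS hs hy.1]
      · rintro ⟨h, h'⟩
        refine ⟨fun _ y hy => ?_, fun hne => absurd huμ hne, h'⟩
        rw [h y hy, lowPrice_div_uS hs hy.1]
  · have hu' : u ∈ Ioo (uS s) 1 := ⟨lt_of_le_of_ne hu.1 (Ne.symm huμ), hu.2⟩
    have h0 : 1 / u ∈ Ico 1 (1 / uS s) :=
      ⟨(one_le_div hu0).2 hu.2.le, one_div_lt_one_div_of_lt (uS_pos hs) hu'.1⟩
    have h0' : 1 / u ∈ Ioo 0 (1 / uS s) := ⟨zero_lt_one.trans_le h0.1, h0.2⟩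
    have hseg := isLowSegment_charInv (m := u) hs h0
    refine ⟨_, hseg, ?_, fun ρ φ => ?_⟩
    · simp only [div_self hu0.ne', Real.log_one, charInv_zero hs h0, mul_one_div_cancel hu0.ne']
    · constructor
      · rintro ⟨-, h, h'⟩
        refine ⟨fun y hy => ?_, h'⟩
        obtain ⟨h1, h2⟩ := h huμ
        rcases hy.1.eq_or_lt with rfl | hy0
        · rw [h1, hseg.lowPrice_zero hs]
        · obtain ⟨ϕ, hϕ, hr, he⟩ := h2 y ⟨hy0, hy.2⟩
          rw [he, (isCharRoot_iff hs h0' ⟨hy0, hy.2.le⟩ hϕ.1).1 hr, lowPrice]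
      · rintro ⟨h, h'⟩
        refine ⟨fun h' => absurd h' huμ, fun _ => ⟨?_, fun y hy => ?_⟩, h'⟩
        · rw [h 0 ⟨le_rfl, hu0⟩, hseg.lowPrice_zero hs]
        · obtain ⟨ϕ, ⟨hϕ, hr⟩, -⟩ := existsUnique_charRoot_high hs hu' hy
          refine ⟨ϕ, hϕ, hr, ?_⟩
          rw [h y ⟨hy.1.le, hy.2⟩, (isCharRoot_iff hs h0' ⟨hy.1, hy.2.le⟩ hϕ.1).1 hr, lowPrice]

theorem exists_phiIvp_eq (hs : 1 < s) {u p : ℝ} (hu : 0 < u) (hu1 : u ≤ 1)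
    (h1 : a * s ≤ p) (h2 : p ≤ phiIvp a s 1 u) : ∃ ρ ∈ Icc u 1, phiIvp a s ρ u = p :=
  intermediate_value_Icc hu1
    ((phiIvp_continuousOn hs hu).mono fun _ hz => hu.le.trans hz.1)
    ⟨by simpa only [phiIvp_self] using h1, h2⟩

end Cases

namespace Setup

variable {K B : Type*} [Fintype K] [Fintype B]

theorem achieves_alphaMin (S : Setup K B) {a s : ℝ} (ha : 0 < a) (hs : 1 < s)
    (hcost : ∀ y ∈ Icc (0 : ℝ) 1, S.cost y = a * y ^ s) (hp : 0 < S.pbar)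
    (hsingle : ∃ b k, 0 < S.demand b k ∧ ∀ j, j ≠ k → S.demand b j = 0) {φ : ℝ → ℝ}
    (h : S.Competitive (S.PPM φ) (alphaMin s)) : S.AchievesOptimalRatio φ (s ^ (s / (s - 1))) :=
  ⟨h, fun _ h1 h2 => S.not_competitive_of_lt_alphaMin ha hs hcost hp hsingle h1 h2⟩

end Setup

end OnlinePricing

theorem theorem5 {K B : Type*} [Fintype K] [Fintype B] (S : OnlinePricing.Setup K B) (a s : ℝ)
    (ha : 0 < a) (hs : 1 < s) (hcost : ∀ y ∈ Set.Icc (0 : ℝ) 1, S.cost y = a * y ^ s)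
    (hp : 0 < S.pbar)
    (hsingle : ∃ b k, 0 < S.demand b k ∧ ∀ j, j ≠ k → S.demand b j = 0) :
    -- low-uncertainty case
    (S.pbar ≤ a * s →
      ∃ w v, w = OnlinePricing.invMarginalCost a s (S.pbar / s) ∧
        v = OnlinePricing.invMarginalCost a s S.pbar ∧ 0 < w ∧ w < v ∧ v ≤ 1 ∧
        (∀ m ∈ Set.Ioc w v, ∀ y ∈ Set.Ioc 0 m,
          ∃! ϕ, ϕ ∈ Set.Ioc (0 : ℝ) 1 ∧ OnlinePricing.IsCharRoot s (v / m) m y ϕ) ∧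
        ∀ m ∈ Set.Icc w v,
          (∃ φ, OnlinePricing.IsPricingFunction φ ∧ OnlinePricing.IsPhiLUC a s S.pbar m φ) ∧
          ∀ φ, OnlinePricing.IsPricingFunction φ → OnlinePricing.IsPhiLUC a s S.pbar m φ →
            φ m = S.pbar ∧ S.AchievesOptimalRatio φ (s ^ (s / (s - 1)))) ∧
    -- first high-uncertainty case
    (a * s < S.pbar → S.pbar ≤ OnlinePricing.cS a s →
      ∃ ucdt ρs, OnlinePricing.IsCDT a s S.pbar ucdt ∧
        (∀ u, OnlinePricing.IsCDT a s S.pbar u → u = ucdt) ∧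
        ucdt ∈ Set.Ico (OnlinePricing.uS s) 1 ∧
        ρs ∈ Set.Icc (OnlinePricing.uS s) 1 ∧ OnlinePricing.RhoSEq a s S.pbar ρs ∧
        (∀ ρ ∈ Set.Icc (OnlinePricing.uS s) 1, OnlinePricing.RhoSEq a s S.pbar ρ → ρ = ρs) ∧
        (∀ u ∈ Set.Ioc (OnlinePricing.uS s) ucdt, ∀ y ∈ Set.Ioo 0 u,
          ∃! ϕ, ϕ ∈ Set.Ioo (0 : ℝ) 1 ∧ OnlinePricing.IsCharRoot s (1 / u) u y ϕ) ∧
        ∀ u ∈ Set.Icc (OnlinePricing.uS s) ucdt,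
          ∃ ρ ∈ Set.Icc ρs 1,
            IsGreatest {y | y ∈ Set.Icc u 1 ∧ OnlinePricing.phiIvp a s y u = S.pbar} ρ ∧
            (u = OnlinePricing.uS s → ρ = ρs) ∧ (u = ucdt → ρ = 1) ∧
            (∃ φ, OnlinePricing.IsPricingFunction φ ∧ OnlinePricing.IsPhiHUC a s u ρ φ) ∧
            ∀ φ, OnlinePricing.IsPricingFunction φ → OnlinePricing.IsPhiHUC a s u ρ φ →
              S.AchievesOptimalRatio φ (s ^ (s / (s - 1)))) ∧
    -- second high-uncertainty case
    (OnlinePricing.cS a s < S.pbar →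
      ∃ ucdt, OnlinePricing.IsCDT a s S.pbar ucdt ∧
        (∀ u, OnlinePricing.IsCDT a s S.pbar u → u = ucdt) ∧
        ucdt ∈ Set.Ioo 0 (OnlinePricing.uS s) ∧
        (∃ φ, OnlinePricing.IsPricingFunction φ ∧
          (∀ y ∈ Set.Icc 0 ucdt, φ y = OnlinePricing.marginalCost a s (y / ucdt)) ∧
          ∀ y ∈ Set.Ico ucdt 1, φ y = OnlinePricing.phiIvp a s y ucdt) ∧
        ∀ φ, OnlinePricing.IsPricingFunction φ →
          (S.AchievesOptimalRatio φ ((s - 1) / (ucdt - ucdt ^ s)) ↔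
            (∀ y ∈ Set.Icc 0 ucdt, φ y = OnlinePricing.marginalCost a s (y / ucdt)) ∧
            ∀ y ∈ Set.Ico ucdt 1, φ y = OnlinePricing.phiIvp a s y ucdt)) := by
  refine ⟨fun hpc => ?_, fun hpc hpC => ?_, fun hpC => ?_⟩
  · have hv := OnlinePricing.invMarginalCost_pos ha hs hp
    have hv1 := OnlinePricing.invMarginalCost_le_one ha hs hp hpc
    have hw := OnlinePricing.invMarginalCost_div ha hs hp
    have hw0 := OnlinePricing.invMarginalCost_pos ha hs (div_pos hp (by linarith : 0 < s))
    refine ⟨_, _, rfl, rfl, hw0, ?_, hv1, fun m hm y hy => ?_, fun m hm => ?_⟩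
    · rw [hw]; exact mul_lt_of_lt_one_right hv (OnlinePricing.uS_lt_one hs)
    · rw [hw] at hm
      exact OnlinePricing.existsUnique_charRoot_low hs hm hv hv1 hy
    · have hm0 := hw0.trans_le hm.1
      have hm1 := hm.2.trans hv1
      obtain ⟨ϕ, hseg, hend, hiff⟩ := OnlinePricing.exists_lowSegment_isPhiLUC ha hs hp hpc hm
      refine ⟨?_, fun φ hφ hφm => ?_⟩
      · obtain ⟨φ, hφ, h⟩ := OnlinePricing.exists_pricing_low ha hs hseg hm0 hm1 hend
        exact ⟨φ, hφ, (hiff φ).2 h⟩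
      · have hlow := (hiff φ).1 hφm
        have hφp : φ m = S.pbar := by rw [hlow m ⟨hm0.le, le_rfl⟩, hend]
        exact ⟨hφp, S.achieves_alphaMin ha hs hcost hp hsingle
          (S.competitive_low ha hs hcost hp (OnlinePricing.one_lt_alphaMin hs).le hseg hm0 hm1 hφ
            hlow hφp)⟩
  · have hμ := OnlinePricing.uS_pos hs
    have hμ1 := OnlinePricing.uS_lt_one hs
    obtain ⟨c, hc, hcdt⟩ := OnlinePricing.exists_cdt_of_le_cS ha hs hpc hpC
    have hcp := ((OnlinePricing.isCDT_iff ha hs).1 hcdt).2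
    rw [OnlinePricing.cS_eq hs] at hpC
    obtain ⟨ρs, hρs, hρsp⟩ := OnlinePricing.exists_phiIvp_eq hs hμ hμ1.le hpc.le hpC
    refine ⟨c, ρs, hcdt, fun u hu => OnlinePricing.cdt_unique ha hs hu hcdt, hc, hρs,
      (OnlinePricing.rhoSEq_iff ha hs).2 hρsp, fun ρ hρ hρp => ?_, fun u hu y hy => ?_,
      fun u hu => ?_⟩
    · exact (OnlinePricing.phiIvp_strictMonoOn ha hs hμ).injOn hρ hρs
        (((OnlinePricing.rhoSEq_iff ha hs).1 hρp).trans hρsp.symm)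
    · exact OnlinePricing.existsUnique_charRoot_high hs ⟨hu.1, hu.2.trans_lt hc.2⟩ hy
    · have hu0 : 0 < u := hμ.trans_le hu.1
      have hu1 : u < 1 := hu.2.trans_lt hc.2
      have hanti : ∀ {u₁ u₂ y : ℝ}, 0 < u₁ → u₁ ≤ u₂ → u₂ ≤ y → y ≤ 1 →
          OnlinePricing.phiIvp a s y u₂ ≤ OnlinePricing.phiIvp a s y u₁ := by
        intro u₁ u₂ y h0 h1 h2 h3
        rcases h1.eq_or_lt with rfl | h1
        · exact le_rfl
        · exact (OnlinePricing.phiIvp_lt_phiIvp ha hs h0 h1 h2 h3).le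
      have hmono := OnlinePricing.phiIvp_strictMonoOn ha hs hu0
      -- For u ≤ u_cdt the solution ends at or above the price bound, because its value at 1
      -- decreases in the threshold.
      obtain ⟨ρ, hρ, hρp⟩ := OnlinePricing.exists_phiIvp_eq hs hu0 hu1.le hpc.le
        (hcp ▸ hanti hu0 hu.2 hc.2.le le_rfl)
      have huniq : ∀ y ∈ Set.Icc u 1, OnlinePricing.phiIvp a s y u = S.pbar → y = ρ :=
        fun y hy hyp => hmono.injOn hy hρ (hyp.trans hρp.symm)
      have huρ : u < ρ := by
        refine lt_of_le_of_ne hρ.1 ?_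
        rintro rfl
        rw [OnlinePricing.phiIvp_self] at hρp
        exact hpc.ne hρp
      -- The solution from u_s lies above the one from `u`, so it reaches the price bound no later.
      have hρρ : ρs ≤ ρ := by
        rcases le_total ρs u with h | h
        · exact h.trans hρ.1
        · have h1 := hanti hμ hu.1 h hρs.2
          rw [hρsp, ← hρp] at h1
          exact (hmono.le_iff_le ⟨h, hρs.2⟩ hρ).1 h1
      obtain ⟨ϕ, hseg, hϕu, hiff⟩ := OnlinePricing.exists_lowSegment_isPhiHUC hs a
        (⟨hu.1, hu1⟩ : u ∈ Set.Ico (OnlinePricing.uS s) 1)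
      have hα := OnlinePricing.alphaOne_of_ge hu.1
      refine ⟨ρ, ⟨hρρ, hρ.2⟩, ⟨⟨hρ, hρp⟩, fun y hy => (huniq y hy.1 hy.2).le⟩, ?_, ?_, ?_,
        fun φ hφ hφu => ?_⟩
      · rintro rfl
        exact (huniq ρs hρs hρsp).symm
      · rintro rfl
        exact (huniq 1 ⟨hu1.le, le_rfl⟩ hcp).symm
      · obtain ⟨φ, hφ, h1, h2⟩ := OnlinePricing.exists_pricing_high ha hs hseg hu0 huρ hρ.2 hϕu hρp
        exact ⟨φ, hφ, (hiff ρ φ).2 ⟨fun y hy => h1 y ⟨hy.1, hy.2.le⟩, h2⟩⟩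
      · obtain ⟨h1, h2⟩ := (hiff ρ φ).1 hφu
        have hφρ : φ ρ = S.pbar := by rw [h2 ρ ⟨huρ.le, le_rfl⟩, hρp]
        refine S.achieves_alphaMin ha hs hcost hp hsingle ?_
        rw [← hα] at hseg ⊢
        refine S.competitive_high ha hs hcost hp hseg hu0 huρ hρ.2 hϕu hφ h1
          (fun y hy => h2 y ⟨hy.1, hy.2.le⟩) hρp fun y hy hy1 => ?_
        rw [← hφρ]
        exact hφ.1 ⟨hu0.le.trans hρ.1, hρ.2⟩ ⟨(hu0.le.trans hρ.1).trans hy.le, hy1⟩ hy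
  · obtain ⟨u, hu, hcdt⟩ := OnlinePricing.exists_cdt_of_cS_lt ha hs hpC
    have hup := ((OnlinePricing.isCDT_iff ha hs).1 hcdt).2
    have hu1 := hu.2.trans (OnlinePricing.uS_lt_one hs)
    have hα := OnlinePricing.alphaOne_of_le hs hu.2.le
    have hseg : OnlinePricing.IsLowSegment s (OnlinePricing.alphaOne s u) u fun y => y / u :=
      OnlinePricing.isLowSegment_div hu.1 (by rw [hα]; exact OnlinePricing.alphaS_mul hs hu.1 hu1)
    refine ⟨u, hcdt, fun u' hu' => OnlinePricing.cdt_unique ha hs hu' hcdt, hu, ?_,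
      fun φ hφ => ?_⟩
    · obtain ⟨φ, hφ, h1, h2⟩ := OnlinePricing.exists_pricing_high ha hs hseg hu.1 hu1 le_rfl
        (div_self hu.1.ne') hup
      exact ⟨φ, hφ, h1, fun y hy => h2 y ⟨hy.1, hy.2.le⟩⟩
    · rw [show (s - 1) / (u - u ^ s) = OnlinePricing.alphaOne s u from hα.symm]
      constructor
      · exact fun h => S.pricing_eq_of_competitive ha hs hcost hp hsingle hu.1 hu.2 hup hφ h.1
      · rintro ⟨h1, h2⟩
        -- Here ρ = 1: no utilization lies beyond it, and prices are needed only on [0, 1).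
        refine ⟨S.competitive_high ha hs hcost hp hseg hu.1 hu1 le_rfl (div_self hu.1.ne') hφ
          (fun y hy => h1 y ⟨hy.1, hy.2.le⟩) h2 hup
          fun y hy hy1 => absurd hy1 (not_le.2 hy), fun β h3 h4 => ?_⟩
        exact S.not_competitive_of_lt_alphaOne ha hs hcost hp hsingle hu.1 hu.2 hup h3 h4
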